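/- **Setting.** Let $A_1=(\mathbb C^2)^{\otimes n}$ with $n\ge 1$, $d=2^n$, let $A_2$ be a Hilbert space of dimension $d_\chi\ge 1$ and $\bar A$ a finite-dimensional Hilbert space, and let $|\chi\rangle\in A_2\otimes\bar A$ have flat (full-rank) entanglement spectrum, $\mathrm{Tr}_{\bar A}|\chi\rangle\langle\chi|=I_{A_2}/d_\chi=:\chi_{A_2}$. Let $V^{(0)}:A_1\to A\otimes\bar A$, $A=A_1\otimes A_2$, be an exact code: $V^{(0)}|\psi\rangle=R_A^{(0)\dagger}R_{\bar A}^{(0)\dagger}\,|\psi\rangle_{A_1}|\chi\rangle_{A_2\bar A}$ for unitaries $R^{(0)}_A$ on $A$ and $R^{(0)}_{\bar A}$ on $\bar A$. For Hermitian $W$ let $V^{(\epsilon)}=e^{i\epsilon W}V^{(0)}$ be the skewed code. For local recovery unitaries $R_A,R_{\bar A}$ and a bulk state $\sigma$ put $$S_{PA}=S\big(\mathrm{Tr}_{\bar A}V^{(\epsilon)}\sigma V^{(\epsilon)\dagger}\big)-S\big(\mathrm{Tr}_{A_2\bar A}R_AR_{\bar A}V^{(\epsilon)}\sigma V^{(\epsilon)\dagger}R_A^\dagger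 R_{\bar A}^\dagger\big),\qquad S_{corr}=S(\chi_{A_2})-S_{PA},$$ where $S$ is the von Neumann entropy, and let $\langle S_{corr}\rangle$ be the average of $S_{corr}$ for $U\sigma U^\dagger$ over Haar-random $U\in U(A_1)$. (The proto-area entropy of the code is $S_{PA}$ for an optimal recovery, one that maximizes the coherent information $S(A_1)-S(A_1r)$ of the encode-and-recover channel on a maximally entangled input.) Let $W_R$ be Hermitian with $R_AR_{\bar A}e^{i\epsilon W}R_A^{(0)\dagger}R_{\bar A}^{(0)\dagger}=e^{i\epsilon W_R}$. The bulk state is the mixed state $\sigma$ on $A_1$ purified by $\bigotimes_{k=1}^n(\sqrt{p_k}|0\rangle|0\rangle+\sqrt{1-p_k}|1\rangle|1\rangle)$, $0<p_k<1$, with the $k$-th pair shared between the $k$-th bulk qubit and a reference qubit, in arbitrary local orthonormal bases. Its eigenvalues are $\lambda_b=\prod_k p_k^{1-b_k}(1-p_k)^{b_k}$, $b\in\{0,1\}^n$, and the entanglement entropy of the $k$-th pair is $h(p_k)=-p_k\ln p_k-(1-p_k)\ln(1-p_k)$. Put $$f_1(\lambda)=\frac1{2d}\sum_{i\ne j}(\lambda_i-\lambda_j)\ln\frac{\lambda_i}{\lambda_j},\qquad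 f_2(\lambda)=\frac2d+\frac1{2d}\sum_{i\neq j}\frac{(\lambda_i+\lambda_j)^2}{\lambda_i-\lambda_j}\ln\frac{\lambda_i}{\lambda_j}-2$$ (with $\frac{\ln(\lambda_i/\lambda_j)}{\lambda_i-\lambda_j}:=1/\lambda_i$ if $\lambda_i=\lambda_j$), $J=d_\chi\mathrm{Tr}_{\bar A}\{W_R,I_{A_1}\otimes|\chi\rangle\langle\chi|\}$, $D=i\,d_\chi\mathrm{Tr}_{\bar A}[W_R,I_{A_1}\otimes|\chi\rangle\langle\chi|]$, and $$c_1=\tfrac{d}{2d_\chi(d^2-1)}\Big(\mathrm{Tr}J^2-\tfrac1d\mathrm{Tr}(\mathrm{Tr}_{A_1}J)^2-\tfrac1{d_\chi}\mathrm{Tr}(\mathrm{Tr}_{A_2}J)^2+\tfrac1{dd_\chi}(\mathrm{Tr}J)^2\Big),$$ $$c_2=\tfrac{d}{2d_\chi(d^2-1)}\Big(\mathrm{Tr}D^2-\tfrac1d\mathrm{Tr}(\mathrm{Tr}_{A_1}D)^2\Big),\qquad c_3=\tfrac1{d_\chi(d^2-1)}\Big(\mathrm{Tr}(\mathrm{Tr}_{A_1}D)^2-\tfrac1d\mathrm{Tr}D^2\Big)+2c_2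 .$$ **Theorem.** 1. As $\epsilon\to0$, $$\langle S_{corr}\rangle=\frac{\epsilon^2}{2}\big(c_1f_1(\lambda)+c_2f_2(\lambda)+c_3\big)+O(\epsilon^3),$$ where, for a given code and bulk state, the error is uniform over all $W,R_A,R_{\bar A},W_R$ as above with $\|W_R\|_2\le K$, for each fixed $K$. In particular this holds for any family of optimal recoveries $R_A^{(\epsilon)},R_{\bar A}^{(\epsilon)}$ whose generators $W_R=W_R^{(\epsilon)}$ stay bounded as $\epsilon\to0$. 2. $f_1(\lambda)\ge0$ and $f_2(\lambda)\ge0$. Both decrease with the entanglement entropies of the pairs: if $h(p_k)\le h(q_k)$ for all $k$, then $f_i$ at $q$ is at most $f_i$ at $p$, and it is strictly smaller if $h(p_k)<h(q_k)$ for some $k$. 3. For every Hermitian $W_R$: $c_1,c_2,c_3\ge0$, and the leading coefficient $c_1f_1+c_2f_2+c_3$ is non-negative and decreases with the entropies of the pairs in the same sense, strictly if $c_1>0$ or $c_2>0$. For $n$ identical pairs ($p_1=\dots=p_n$) it decreases as the total bulk entropy $S(\sigma)$ increases, strictly if $c_1>0$ or $c_2>0$. -/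

import Mathlib

open MeasureTheory Filter Topology
open scoped Kronecker

noncomputable section

namespace SkewedCode

/-! ### Finite-dimensional quantum mechanics: operators are matrices over finite index types -/

section Basics

variable {X Y : Type*} [Fintype X] [Fintype Y]

/-- The rank-one operator `|v⟩⟨v|`. -/
def pureState (v : X → ℂ) : Matrix X X ℂ := Matrix.vecMulVec v (star v)

/-- Partial trace over the second tensor factor. -/
def traceRight (ρ : Matrix (X × Y) (X × Y) ℂ) : Matrix X X ℂ :=
  Matrix.of fun x x' => ∑ y, ρ (x, y) (x', y)

/-- Partial trace over the first tensor factor. -/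
def traceLeft (ρ : Matrix (X × Y) (X × Y) ℂ) : Matrix Y Y ℂ :=
  Matrix.of fun y y' => ∑ x, ρ (x, y) (x, y')

/-- The von Neumann entropy `-Tr (ρ log ρ)`, by functional calculus. -/
def entropy [DecidableEq X] (ρ : Matrix X X ℂ) : ℝ :=
  (cfc Real.negMulLog ρ).trace.re

end Basics

/-! ### Normalized Haar measure on the unitary group -/

section Haar

variable (X : Type*) [Fintype X] [DecidableEq X]

instance instMeasurableSpaceUnitary : MeasurableSpace (Matrix.unitaryGroup X ℂ) := borel _

instance instBorelSpaceUnitary : BorelSpace (Matrix.unitaryGroup X ℂ) := ⟨rfl⟩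

instance instCompactSpaceUnitary : CompactSpace (Matrix.unitaryGroup X ℂ) := by
  have hc : IsCompact (Set.pi Set.univ fun _ : X => Set.pi Set.univ fun _ : X =>
      Metric.closedBall (0 : ℂ) 1) :=
    isCompact_univ_pi fun _ => isCompact_univ_pi fun _ => isCompact_closedBall _ _
  refine isCompact_iff_compactSpace.mp (hc.of_isClosed_subset
    (isClosed_unitary (R := Matrix X X ℂ)) fun U hU => ?_)
  simpa [Set.mem_pi] using fun i j => entry_norm_bound_of_unitary hU i j

/-- The Haar measure of total mass one on `U(X)`. -/
def haarUnitary : Measure (Matrix.unitaryGroup X ℂ) :=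
  Measure.haarMeasure ⊤

end Haar

/-! ### Codes, recoveries, proto-area entropy

The boundary is `A ⊗ Abar` with `A = A₁ ⊗ A₂`; all of the bulk is carried by `A₁`, so that
`Abar` has no bulk factor and is written `B`. -/

section Codes

variable {A₁ A₂ B : Type*} [Fintype A₁] [Fintype A₂] [Fintype B]
  [DecidableEq A₁] [DecidableEq A₂] [DecidableEq B]

/-- `|χ⟩` on `A₂ ⊗ B` has flat entanglement spectrum, of Schmidt rank `d_χ = dim A₂`
(full rank on `A₂`): its reduced state on `A₂` is `I / d_χ`. -/
def IsFlat (χ : A₂ × B → ℂ) : Prop :=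
  traceRight (pureState χ) = ((Fintype.card A₂ : ℂ)⁻¹) • (1 : Matrix A₂ A₂ ℂ)

/-- The isometry `|ψ⟩ ↦ |ψ⟩_{A₁} |χ⟩_{A₂ B}`. -/
def attach (χ : A₂ × B → ℂ) : Matrix ((A₁ × A₂) × B) A₁ ℂ :=
  Matrix.of fun x j => if x.1.1 = j then χ (x.1.2, x.2) else 0

/-- `V₀` is an exact erasure-correcting encoding recovered by the local unitaries `RA₀`, `RB₀`:
`V₀ |ψ⟩ = RA₀† RB₀† |ψ⟩_{A₁} |χ⟩_{A₂ B}`. -/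
def IsExactCode (V₀ : Matrix ((A₁ × A₂) × B) A₁ ℂ) (χ : A₂ × B → ℂ)
    (RA₀ : Matrix.unitaryGroup (A₁ × A₂) ℂ) (RB₀ : Matrix.unitaryGroup B ℂ) : Prop :=
  V₀ = (RA₀.1 ⊗ₖ RB₀.1).conjTranspose * attach χ

/-- The unitary `exp (i ε W)`. -/
def expI {X : Type*} [Fintype X] [DecidableEq X] (ε : ℝ) (W : Matrix X X ℂ) : Matrix X X ℂ :=
  NormedSpace.exp ((Complex.I * (ε : ℂ)) • W)

/-- The encoding `exp (i ε W) V₀` of the skewed code. -/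
def skew (V₀ : Matrix ((A₁ × A₂) × B) A₁ ℂ)
    (W : Matrix ((A₁ × A₂) × B) ((A₁ × A₂) × B) ℂ) (ε : ℝ) : Matrix ((A₁ × A₂) × B) A₁ ℂ :=
  expI ε W * V₀

/-- The effective skewing Hermitian generator `WR` that combines the perturbation with the
recovery: `RA RB exp (i ε W) RA₀† RB₀† = exp (i ε WR)`. -/
def IsRecoveredGenerator (RA₀ : Matrix.unitaryGroup (A₁ × A₂) ℂ) (RB₀ : Matrix.unitaryGroup B ℂ)
    (W : Matrix ((A₁ × A₂) × B) ((A₁ × A₂) × B) ℂ) (ε : ℝ)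
    (RA : Matrix.unitaryGroup (A₁ × A₂) ℂ) (RB : Matrix.unitaryGroup B ℂ)
    (WR : Matrix ((A₁ × A₂) × B) ((A₁ × A₂) × B) ℂ) : Prop :=
  WR.IsHermitian ∧
    (RA.1 ⊗ₖ RB.1) * expI ε W * (RA₀.1 ⊗ₖ RB₀.1).conjTranspose = expI ε WR

/-- The recovered bulk state on `A₁`: encode with `V`, recover with `RA`, `RB`, and trace out
`A₂` and `B`. -/
def recoveredBulk (V : Matrix ((A₁ × A₂) × B) A₁ ℂ)
    (RA : Matrix.unitaryGroup (A₁ × A₂) ℂ) (RB : Matrix.unitaryGroup B ℂ)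
    (σ : Matrix A₁ A₁ ℂ) : Matrix A₁ A₁ ℂ :=
  traceRight (traceRight
    (((RA.1 ⊗ₖ RB.1) * V) * σ * ((RA.1 ⊗ₖ RB.1) * V).conjTranspose))

/-- The maximally entangled vector `d^{-1/2} ∑ |i⟩_L |i⟩_r`. -/
def maxEntangled (X : Type*) [Fintype X] [DecidableEq X] : X × X → ℂ :=
  fun x => if x.1 = x.2 then ((Real.sqrt (Fintype.card X) : ℝ) : ℂ)⁻¹ else 0

/-- The joint state of `A₁` and the reference `r ≅ L` after encoding and recovery of one half of
the maximally entangled state. -/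
def recoveredWithReference (V : Matrix ((A₁ × A₂) × B) A₁ ℂ)
    (RA : Matrix.unitaryGroup (A₁ × A₂) ℂ) (RB : Matrix.unitaryGroup B ℂ) :
    Matrix (A₁ × A₁) (A₁ × A₁) ℂ :=
  let K : Matrix (((A₁ × A₂) × B) × A₁) (A₁ × A₁) ℂ :=
    ((RA.1 ⊗ₖ RB.1) * V) ⊗ₖ (1 : Matrix A₁ A₁ ℂ)
  let ρ := K * pureState (maxEntangled A₁) * K.conjTranspose
  Matrix.of fun x x' => ∑ a, ∑ b, ρ (((x.1, a), b), x.2) (((x'.1, a), b), x'.2)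

/-- The coherent information `S(A₁) - S(A₁ r)` of the encode-and-recover channel. -/
def coherentInformation (V : Matrix ((A₁ × A₂) × B) A₁ ℂ)
    (RA : Matrix.unitaryGroup (A₁ × A₂) ℂ) (RB : Matrix.unitaryGroup B ℂ) : ℝ :=
  entropy (traceRight (recoveredWithReference V RA RB)) -
    entropy (recoveredWithReference V RA RB)

/-- The local recovery `RA`, `RB` maximizes the coherent information. -/
def IsOptimalRecovery (V : Matrix ((A₁ × A₂) × B) A₁ ℂ)
    (RA : Matrix.unitaryGroup (A₁ × A₂) ℂ) (RB : Matrix.unitaryGroup B ℂ) : Prop :=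
  ∀ (RA' : Matrix.unitaryGroup (A₁ × A₂) ℂ) (RB' : Matrix.unitaryGroup B ℂ),
    coherentInformation V RA' RB' ≤ coherentInformation V RA RB

/-- The proto-area entropy `S(ρ_A) - S(σ_{A₁})` of the region `A`, computed with the recovery
`RA`, `RB`. With an optimal recovery this is the proto-area entropy of the code. -/
def protoArea (V : Matrix ((A₁ × A₂) × B) A₁ ℂ)
    (RA : Matrix.unitaryGroup (A₁ × A₂) ℂ) (RB : Matrix.unitaryGroup B ℂ)
    (σ : Matrix A₁ A₁ ℂ) : ℝ :=
  entropy (traceRight (V * σ * V.conjTranspose)) - entropy (recoveredBulk V RA RB σ)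

/-- The correction `S_corr = S(χ) - S_PA`. -/
def correction (χ : A₂ × B → ℂ) (V : Matrix ((A₁ × A₂) × B) A₁ ℂ)
    (RA : Matrix.unitaryGroup (A₁ × A₂) ℂ) (RB : Matrix.unitaryGroup B ℂ)
    (σ : Matrix A₁ A₁ ℂ) : ℝ :=
  entropy (traceRight (pureState χ)) - protoArea V RA RB σ

/-- The bulk state rotated by a bulk unitary. -/
def rotate (σ : Matrix A₁ A₁ ℂ) (U : Matrix.unitaryGroup A₁ ℂ) : Matrix A₁ A₁ ℂ :=
  U.1 * σ * U.1.conjTranspose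

/-- `⟨S_corr⟩`: the correction averaged over Haar-random bulk unitaries. -/
def averagedCorrection (χ : A₂ × B → ℂ) (V : Matrix ((A₁ × A₂) × B) A₁ ℂ)
    (RA : Matrix.unitaryGroup (A₁ × A₂) ℂ) (RB : Matrix.unitaryGroup B ℂ)
    (σ : Matrix A₁ A₁ ℂ) : ℝ :=
  ∫ U, correction χ V RA RB (rotate σ U) ∂(haarUnitary A₁)

/-! ### The coefficients -/

/-- The operator `1_{A₁} ⊗ |χ⟩⟨χ|_{A₂ B}`. -/
def chiOp (χ : A₂ × B → ℂ) : Matrix ((A₁ × A₂) × B) ((A₁ × A₂) × B) ℂ :=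
  Matrix.of fun x x' =>
    if x.1.1 = x'.1.1 then pureState χ (x.1.2, x.2) (x'.1.2, x'.2) else 0

/-- `J = d_χ Tr_B {WR, χ}`, an operator on `A₁ ⊗ A₂`. -/
def opJ (χ : A₂ × B → ℂ) (WR : Matrix ((A₁ × A₂) × B) ((A₁ × A₂) × B) ℂ) :
    Matrix (A₁ × A₂) (A₁ × A₂) ℂ :=
  (Fintype.card A₂ : ℂ) • traceRight (WR * chiOp χ + chiOp χ * WR)

/-- `D = i d_χ Tr_B [WR, χ]`, an operator on `A₁ ⊗ A₂`. -/
def opD (χ : A₂ × B → ℂ) (WR : Matrix ((A₁ × A₂) × B) ((A₁ × A₂) × B) ℂ) :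
    Matrix (A₁ × A₂) (A₁ × A₂) ℂ :=
  (Complex.I * (Fintype.card A₂ : ℂ)) • traceRight (WR * chiOp χ - chiOp χ * WR)

/-- The coefficient of `f₁`. -/
def coeff₁ (χ : A₂ × B → ℂ) (WR : Matrix ((A₁ × A₂) × B) ((A₁ × A₂) × B) ℂ) : ℝ :=
  let d : ℝ := Fintype.card A₁
  let dχ : ℝ := Fintype.card A₂
  let J := opJ χ WR
  d / (2 * dχ * (d ^ 2 - 1)) *
    ((J ^ 2).trace.re - 1 / d * ((traceLeft J) ^ 2).trace.re
      - 1 / dχ * ((traceRight J) ^ 2).trace.re + 1 / (d * dχ) * (J.trace ^ 2).re)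

/-- The coefficient of `f₂`. -/
def coeff₂ (χ : A₂ × B → ℂ) (WR : Matrix ((A₁ × A₂) × B) ((A₁ × A₂) × B) ℂ) : ℝ :=
  let d : ℝ := Fintype.card A₁
  let dχ : ℝ := Fintype.card A₂
  let D := opD χ WR
  d / (2 * dχ * (d ^ 2 - 1)) * ((D ^ 2).trace.re - 1 / d * ((traceLeft D) ^ 2).trace.re)

/-- The state-independent coefficient. -/
def coeff₃ (χ : A₂ × B → ℂ) (WR : Matrix ((A₁ × A₂) × B) ((A₁ × A₂) × B) ℂ) : ℝ :=
  let d : ℝ := Fintype.card A₁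
  let dχ : ℝ := Fintype.card A₂
  let D := opD χ WR
  1 / (dχ * (d ^ 2 - 1)) * (((traceLeft D) ^ 2).trace.re - 1 / d * (D ^ 2).trace.re)
    + 2 * coeff₂ χ WR

end Codes

/-! ### The functions of the bulk spectrum -/

section Spectrum

variable {X : Type*} [Fintype X] [DecidableEq X]

/-- `(log a - log b) / (a - b)`, continued by `1 / a` to `a = b`. -/
def logSlope (a b : ℝ) : ℝ :=
  if a = b then 1 / a else (Real.log a - Real.log b) / (a - b)

/-- `f₁(λ) = (1 / 2d) ∑_{i ≠ j} (λ_i - λ_j) log (λ_i / λ_j)`. -/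
def f₁ (lam : X → ℝ) : ℝ :=
  1 / (2 * (Fintype.card X : ℝ)) *
    ∑ i, ∑ j, if i = j then 0 else (lam i - lam j) * Real.log (lam i / lam j)

/-- `f₂(λ) = 2 / d + (1 / 2d) ∑_{i ≠ j} (λ_i + λ_j)² log (λ_i / λ_j) / (λ_i - λ_j) - 2`. -/
def f₂ (lam : X → ℝ) : ℝ :=
  2 / (Fintype.card X : ℝ) + 1 / (2 * (Fintype.card X : ℝ)) *
    (∑ i, ∑ j, if i = j then 0 else (lam i + lam j) ^ 2 * logSlope (lam i) (lam j)) - 2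

end Spectrum

/-! ### Bell-like bulk states on a register of `n` qubits -/

/-- The basis labels of `n` qubits. -/
abbrev Qubits (n : ℕ) : Type := Fin n → Fin 2

/-- The Schmidt weights `p`, `1 - p` of one Bell-like pair. -/
def weight (p : ℝ) (i : Fin 2) : ℝ := if i = 0 then p else 1 - p

/-- The product of Bell-like pairs `⨂_k (√p_k |0⟩|0⟩ + √(1-p_k) |1⟩|1⟩)` between the bulk qubits
and the reference qubits, in local bases given by the columns of `u k` and `v k`. -/
def bellPairs {n : ℕ} (p : Fin n → ℝ) (u v : Fin n → Matrix.unitaryGroup (Fin 2) ℂ) :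
    Qubits n × Qubits n → ℂ :=
  fun x => ∏ k, ∑ i, ((Real.sqrt (weight (p k) i) : ℝ) : ℂ) * (u k).1 (x.1 k) i * (v k).1 (x.2 k) i

/-- The mixed bulk state purified by `bellPairs`. -/
def bulkState {n : ℕ} (p : Fin n → ℝ) (u v : Fin n → Matrix.unitaryGroup (Fin 2) ℂ) :
    Matrix (Qubits n) (Qubits n) ℂ :=
  traceRight (pureState (bellPairs p u v))

/-- The eigenvalues `λ_b = ∏_k p_k^{1-b_k} (1-p_k)^{b_k}` of the bulk state. -/
def bulkSpectrum {n : ℕ} (p : Fin n → ℝ) : Qubits n → ℝ :=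
  fun b => ∏ k, weight (p k) (b k)

/-- All Schmidt weights are positive, so that the bulk state has full rank. -/
def FullRank {n : ℕ} (p : Fin n → ℝ) : Prop := ∀ k, 0 < p k ∧ p k < 1

/-- `F` does not increase when no Bell-like pair loses entanglement entropy. -/
def DecreasesWithEntropy {n : ℕ} (F : (Fin n → ℝ) → ℝ) : Prop :=
  ∀ p q : Fin n → ℝ, FullRank p → FullRank q →
    (∀ k, Real.binEntropy (p k) ≤ Real.binEntropy (q k)) → F q ≤ F p

/-- `F` strictly decreases when no Bell-like pair loses, and at least one pair gains,
entanglement entropy. -/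
def StrictlyDecreasesWithEntropy {n : ℕ} (F : (Fin n → ℝ) → ℝ) : Prop :=
  ∀ p q : Fin n → ℝ, FullRank p → FullRank q →
    (∀ k, Real.binEntropy (p k) ≤ Real.binEntropy (q k)) →
    (∃ k, Real.binEntropy (p k) < Real.binEntropy (q k)) → F q < F p

/-- `2 ε⁻²` times the second-order term of `⟨S_corr⟩`: `c₁ f₁ + c₂ f₂ + c₃`. -/
def leading {n : ℕ} {A₂ B : Type*} [Fintype A₂] [Fintype B] [DecidableEq A₂] [DecidableEq B]
    (χ : A₂ × B → ℂ) (WR : Matrix ((Qubits n × A₂) × B) ((Qubits n × A₂) × B) ℂ)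
    (p : Fin n → ℝ) : ℝ :=
  coeff₁ χ WR * f₁ (bulkSpectrum p) + coeff₂ χ WR * f₂ (bulkSpectrum p) + coeff₃ χ WR

end SkewedCode

end

open SkewedCode

namespace SkewedCode

/-! ### Entropy -/

section Entropy

variable {X : Type*} [Fintype X] [DecidableEq X]

/-! The recovery is local, so it changes no entropy of A; together with the exact code it leaves
only exp(iεW_R) acting on the bulk state tensored with χ. Bulk rotations commute with χ and can be
moved onto the generator, W_R ↦ U†W_R U (`expI_attach_conj`, `correction_eq`). The bulk state may
thus be taken as diag(λ), and the correction is log d_χ − S(A) + S(A₁) for a small rotation of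
diag(λ) ⊗ χ.

Both entropies are expanded about a diagonal matrix (`entropy_taylor`). Since χ is flat, the
unperturbed spectrum on A is λ_i / d_χ: the zeroth-order terms cancel against log d_χ, and the
linear terms cancel exactly because the trace is preserved. What remains is ε²/2 times a difference
of two sums of squares, weighted by divided differences of the logarithm
(`exists_correction_expansion`). The first-order change of the state has entries proportional to i J
(λ_j − λ_i) + D (λ_i + λ_j), with Tr_{A₂} D = 0 (`firstOrder_apply`, `traceRight_opD`). The Haar
average therefore needs only second moments of the entries of U†MU (`haar_moments`): the J terms sum
to f₁, the D terms to f₂ and a constant, and the cross terms vanish, being a symmetric moment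
against an antisymmetric weight (`integral_quadCoeff`). The error constants depend on λ, χ, K and
the dimensions only, whence the uniformity.

For monotonicity, f₁ and f₂ are, up to affine normalization, sums over all pairs of eigenvalues of
(a ∓ b)² (log a − log b)/(a − b). This function is an integral of squares of linear forms divided by
positive linear forms, hence jointly convex (`pairFn_convex`). The spectrum is affine in each p_k,
and p_k ↦ 1 − p_k merely permutes it. A pair with more entropy has its weight between p_k and 1 −
p_k, so convexity lowers the sum (`pairSum_update_le`), one pair at a time. Non-negativity of f₂
follows because it vanishes at the maximally mixed state.

The coefficients are squared Hilbert–Schmidt norms in disguise: c₃ is Tr D² / (d d_χ), c₂ measures D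
without its part 1 ⊗ Tr_{A₁} D / d, and c₁ measures J with the parts supported on a single factor
removed. -/

theorem entropy_eq_sum_eigenvalues {A : Matrix X X ℂ} (hA : A.IsHermitian) :
    entropy A = ∑ i, Real.negMulLog (hA.eigenvalues i) := by
  have hB : (cfc Real.negMulLog A).IsHermitian := cfc_predicate _ _
  rw [entropy, Matrix.trace_eq_sum_roots_charpoly_of_splits hB.splits_charpoly,
    hA.charpoly_cfc_eq, Polynomial.roots_prod _ _
      (Finset.prod_ne_zero_iff.2 fun i _ => Polynomial.X_sub_C_ne_zero _)]
  simp

theorem isHermitian_conj_diagonal (V : Matrix X X ℂ) (b : X → ℝ) :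
    (V * Matrix.diagonal (fun i => (b i : ℂ)) * V.conjTranspose).IsHermitian := by
  apply Matrix.isHermitian_mul_mul_conjTranspose
  rw [Matrix.isHermitian_diagonal_iff]
  intro i
  simp [IsSelfAdjoint]

theorem charpoly_conj_unitary {V : Matrix X X ℂ} (hV : V ∈ Matrix.unitaryGroup X ℂ)
    (A : Matrix X X ℂ) : (V * A * V.conjTranspose).charpoly = A.charpoly := by
  rw [Matrix.charpoly_mul_comm, ← mul_assoc, ← Matrix.star_eq_conjTranspose,
    Matrix.mem_unitaryGroup_iff'.1 hV, one_mul]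

/-- The entropy of a diagonalized Hermitian matrix. -/
theorem entropy_conj_diagonal {V : Matrix X X ℂ} (hV : V ∈ Matrix.unitaryGroup X ℂ) (b : X → ℝ) :
    entropy (V * Matrix.diagonal (fun i => (b i : ℂ)) * V.conjTranspose) =
      ∑ i, Real.negMulLog (b i) := by
  have hA := isHermitian_conj_diagonal V b
  rw [entropy_eq_sum_eigenvalues hA]
  -- The numbers `b` and the chosen eigenvalues may be ordered differently, so they are compared as
  -- multisets of roots of one characteristic polynomial.
  have h := hA.roots_charpoly_eq_eigenvalues
  rw [charpoly_conj_unitary hV, Matrix.charpoly_diagonal, Polynomial.roots_prod _ _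
      (Finset.prod_ne_zero_iff.2 fun i _ => Polynomial.X_sub_C_ne_zero _)] at h
  have h2 := congrArg (fun s => (s.map fun z : ℂ => Real.negMulLog z.re).sum) h
  simpa [Multiset.map_map, Function.comp_def] using h2.symm

theorem exists_unitary_diagonal {A : Matrix X X ℂ} (hA : A.IsHermitian) :
    ∃ V ∈ Matrix.unitaryGroup X ℂ, ∃ b : X → ℝ,
      A = V * Matrix.diagonal (fun i => (b i : ℂ)) * V.conjTranspose :=
  ⟨hA.eigenvectorUnitary.1, hA.eigenvectorUnitary.2, hA.eigenvalues, by
    conv_lhs => rw [hA.spectral_theorem]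
    rfl⟩

theorem entropy_conj_unitary {U : Matrix X X ℂ} (hU : U ∈ Matrix.unitaryGroup X ℂ)
    {A : Matrix X X ℂ} (hA : A.IsHermitian) :
    entropy (U * A * U.conjTranspose) = entropy A := by
  obtain ⟨V, hV, b, rfl⟩ := exists_unitary_diagonal hA
  rw [entropy_conj_diagonal hV, ← entropy_conj_diagonal (mul_mem hU hV) b,
    Matrix.conjTranspose_mul]
  simp only [mul_assoc]

theorem entropy_diagonal (b : X → ℝ) :
    entropy (Matrix.diagonal fun i => (b i : ℂ)) = ∑ i, Real.negMulLog (b i) := by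
  simpa using entropy_conj_diagonal (one_mem (Matrix.unitaryGroup X ℂ)) b

open scoped Matrix.Norms.L2Operator in
-- Serves to make the correction a continuous, hence integrable, function on the compact unitary
-- group.
theorem continuous_entropy_comp {T : Type*} [TopologicalSpace T] {A : T → Matrix X X ℂ}
    (hc : Continuous A) (hA : ∀ t, (A t).IsHermitian) : Continuous fun t => entropy (A t) := by
  have h : Continuous fun t => cfc Real.negMulLog (A t) :=
    Continuous.cfc_of_mem_nhdsSet (s := Set.univ) Real.negMulLog Filter.univ_mem hc
      (fun t => hA t) Real.continuous_negMulLog.continuousOn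
  exact Complex.continuous_re.comp h.matrix_trace

end Entropy

/-! ### Haar averages -/

section Haar

variable {X : Type*} [Fintype X] [DecidableEq X]

instance isProbabilityMeasure_haarUnitary : IsProbabilityMeasure (haarUnitary X) :=
  ⟨Measure.haarMeasure_self⟩

instance isHaarMeasure_haarUnitary : (haarUnitary X).IsHaarMeasure := by
  unfold haarUnitary; infer_instance

/-- A compact group is unimodular: a right translate of the Haar probability measure is again one,
and there is only one. -/
instance isMulRightInvariant_haarUnitary : (haarUnitary X).IsMulRightInvariant := by
  refine ⟨fun g => ?_⟩
  have : IsProbabilityMeasure (Measure.map (· * g) (haarUnitary X)) :=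
    Measure.isProbabilityMeasure_map (by fun_prop)
  have : (Measure.map (· * g) (haarUnitary X)).IsHaarMeasure :=
    Measure.isHaarMeasure_map_mul_right (haarUnitary X) g
  exact Measure.isHaarMeasure_eq_of_isProbabilityMeasure _ _

theorem integrable_of_continuous {f : Matrix.unitaryGroup X ℂ → ℝ} (hf : Continuous f) :
    Integrable f (haarUnitary X) :=
  hf.integrable_of_hasCompactSupport (HasCompactSupport.of_compactSpace f)

theorem integral_comp_mul_right {E : Type*} [NormedAddCommGroup E] [NormedSpace ℝ E]
    (f : Matrix X X ℂ → E) (V : Matrix.unitaryGroup X ℂ) :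
    ∫ U, f (U.1 * V.1) ∂(haarUnitary X) = ∫ U, f U.1 ∂(haarUnitary X) :=
  integral_mul_right_eq_self (fun U : Matrix.unitaryGroup X ℂ => f U.1) V

end Haar

/-! ### Second-order expansion of the entropy -/

section Taylor

/-- The divided difference `f[a, a, x]` of `f = -x log x`. -/
noncomputable def entropySecondDiff (a x : ℝ) : ℝ :=
  -∫ t in (0 : ℝ)..1, (1 - t) / (a + t * (x - a))

theorem segment_ge {m a x t : ℝ} (ha : m ≤ a) (hx : m ≤ x) (ht : t ∈ Set.Icc (0 : ℝ) 1) :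
    m ≤ a + t * (x - a) := by
  nlinarith [ht.1, ht.2, mul_nonneg ht.1 (sub_nonneg.2 hx),
    mul_nonneg (sub_nonneg.2 ht.2) (sub_nonneg.2 ha)]

theorem continuousOn_entropySecondDiff_integrand {a x : ℝ} (ha : 0 < a) (hx : 0 < x) :
    ContinuousOn (fun t : ℝ => (1 - t) / (a + t * (x - a))) (Set.uIcc 0 1) := by
  refine ContinuousOn.div (by fun_prop) (by fun_prop) fun t ht => ?_
  rw [Set.uIcc_of_le zero_le_one] at ht
  exact ((lt_min ha hx).trans_le (segment_ge (min_le_left _ _) (min_le_right _ _) ht)).ne'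

theorem negMulLog_taylor {a x : ℝ} (ha : 0 < a) (hx : 0 < x) :
    Real.negMulLog x = Real.negMulLog a + (-Real.log a - 1) * (x - a)
      + entropySecondDiff a x * (x - a) ^ 2 := by
  have hpos : ∀ t ∈ Set.uIcc (0 : ℝ) 1, 0 < a + t * (x - a) := fun t ht => by
    rw [Set.uIcc_of_le zero_le_one] at ht
    exact (lt_min ha hx).trans_le (segment_ge (min_le_left _ _) (min_le_right _ _) ht)
  -- With f = −x log x and c(t) = a + t(x − a), the primitive f(c) + f′(c)(1 − t)(x − a) equals f(x)
  -- at t = 1 and the first-order Taylor polynomial at t = 0; in its derivative the f′ terms cancel.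
  have hd : ∀ t ∈ Set.uIcc (0 : ℝ) 1, HasDerivAt
      (fun t => Real.negMulLog (a + t * (x - a))
        + (-Real.log (a + t * (x - a)) - 1) * ((1 - t) * (x - a)))
      (-(x - a) ^ 2 * ((1 - t) / (a + t * (x - a)))) t := fun t ht => by
    have h0 := hpos t ht
    have hc : HasDerivAt (fun t => a + t * (x - a)) (x - a) t := by
      simpa using ((hasDerivAt_id t).mul_const (x - a)).const_add a
    have h1 := (Real.hasDerivAt_negMulLog h0.ne').comp t hc
    have h2 := ((Real.hasDerivAt_log h0.ne').comp t hc).neg.sub_const 1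
    have h3 : HasDerivAt (fun t => (1 - t) * (x - a)) (-(x - a)) t := by
      simpa using ((hasDerivAt_id t).const_sub 1).mul_const (x - a)
    convert! h1.add (h2.mul h3) using 1
    simp only [Function.comp_apply, Pi.neg_apply]
    field_simp
    ring
  have h := intervalIntegral.integral_eq_sub_of_hasDerivAt hd
    (ContinuousOn.intervalIntegrable
      ((continuousOn_entropySecondDiff_integrand ha hx).const_mul _))
  rw [intervalIntegral.integral_const_mul] at h
  simp only [one_mul, zero_mul, sub_self, mul_zero, add_zero, sub_zero,
    add_sub_cancel] at h
  unfold entropySecondDiff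
  linarith

/-- The difference of the integrands is t(1 − t)(x − y) over a product of two denominators, each at
least m. -/
theorem entropySecondDiff_lipschitz {m a x y : ℝ} (hm : 0 < m) (ha : m ≤ a) (hx : m ≤ x)
    (hy : m ≤ y) :
    |entropySecondDiff a x - entropySecondDiff a y| ≤ |x - y| / m ^ 2 := by
  have hi : ∀ {z : ℝ}, m ≤ z → IntervalIntegrable
      (fun t : ℝ => (1 - t) / (a + t * (z - a))) volume 0 1 := fun hz =>
    (continuousOn_entropySecondDiff_integrand (hm.trans_le ha)
      (hm.trans_le hz)).intervalIntegrable
  have h : entropySecondDiff a x - entropySecondDiff a y = ∫ t in (0 : ℝ)..1,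
      ((1 - t) / (a + t * (y - a)) - (1 - t) / (a + t * (x - a))) := by
    rw [intervalIntegral.integral_sub (hi hy) (hi hx)]
    unfold entropySecondDiff
    ring
  rw [h, ← Real.norm_eq_abs]
  refine (intervalIntegral.norm_integral_le_of_norm_le_const (C := |x - y| / m ^ 2)
    fun t ht => ?_).trans (by simp)
  rw [Set.uIoc_of_le zero_le_one] at ht
  have ht' : t ∈ Set.Icc (0 : ℝ) 1 := ⟨ht.1.le, ht.2⟩
  have h1 := segment_ge ha hx ht'
  have h2 := segment_ge ha hy ht'
  set u := a + t * (x - a) with hu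
  set v := a + t * (y - a) with hv
  have hu0 : 0 < u := hm.trans_le h1
  have hv0 : 0 < v := hm.trans_le h2
  have e : (1 - t) / v - (1 - t) / u = (1 - t) * t * (x - y) / (v * u) := by
    field_simp
    rw [hu, hv]; ring
  rw [e, Real.norm_eq_abs, abs_div, abs_mul, abs_of_pos (mul_pos hv0 hu0), sq]
  gcongr
  rw [abs_of_nonneg (mul_nonneg (sub_nonneg.2 ht'.2) ht'.1)]
  have : (1 - t) * t ≤ 1 := by nlinarith [ht'.1, ht'.2]
  exact mul_le_of_le_one_left (abs_nonneg _) this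

/-- In divided differences, f[a,a,c] + f[a,c,c] = (f′(c) − f′(a))/(c − a), where f′ = −log − 1. Off
the diagonal this is the sum of the two Taylor formulas, one about each point. -/
theorem entropySecondDiff_add_swap {a c : ℝ} (ha : 0 < a) (hc : 0 < c) :
    entropySecondDiff a c + entropySecondDiff c a = -logSlope a c := by
  by_cases h : a = c
  · subst h
    have : entropySecondDiff a a = -(1 / (2 * a)) := by
      unfold entropySecondDiff
      simp only [sub_self, mul_zero, add_zero]
      have h1 : ∫ t in (0 : ℝ)..1, (1 - t) = 1 / 2 := by
        rw [intervalIntegral.integral_sub intervalIntegrable_const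
          (continuous_id'.intervalIntegrable 0 1), integral_id]
        norm_num
      rw [intervalIntegral.integral_div, h1]
      field_simp
    rw [this, logSlope, if_pos rfl]
    field_simp
    norm_num
  · have h1 := negMulLog_taylor ha hc
    have h2 := negMulLog_taylor hc ha
    rw [logSlope, if_neg h]
    have h0 : a - c ≠ 0 := sub_ne_zero.2 h
    field_simp
    apply mul_right_cancel₀ h0
    linear_combination (-1) * h1 - h2

theorem logSlope_comm (a b : ℝ) : logSlope a b = logSlope b a := by
  unfold logSlope
  by_cases h : a = b
  · subst h; rfl
  · rw [if_neg h, if_neg (Ne.symm h), ← neg_sub (Real.log b), ← neg_sub b, neg_div_neg_eq]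

variable {X : Type*} [Fintype X] [DecidableEq X]

theorem sum_norm_sq_row {V : Matrix X X ℂ} (hV : V ∈ Matrix.unitaryGroup X ℂ) (i : X) :
    ∑ j, ‖V i j‖ ^ 2 = 1 := by
  have h := congrFun (congrFun (Matrix.mem_unitaryGroup_iff.1 hV) i) i
  rw [Matrix.mul_apply, Matrix.one_apply_eq] at h
  have : ((∑ j, ‖V i j‖ ^ 2 : ℝ) : ℂ) = 1 := by
    rw [← h]
    push_cast
    exact Finset.sum_congr rfl fun j _ => by
      rw [Matrix.star_apply, Complex.star_def, Complex.mul_conj']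
  exact_mod_cast this

theorem sum_norm_sq_col {V : Matrix X X ℂ} (hV : V ∈ Matrix.unitaryGroup X ℂ) (j : X) :
    ∑ i, ‖V i j‖ ^ 2 = 1 := by
  have h := sum_norm_sq_row (Unitary.star_mem hV) j
  simpa [Matrix.star_apply] using h

/-- Second-order expansion of the entropy about a positive diagonal matrix, with a cubic bound
on the remainder. -/
theorem entropy_taylor {m : ℝ} (hm : 0 < m) {a : X → ℝ} (ha : ∀ i, m ≤ a i)
    {Δ : Matrix X X ℂ} (hΔ : Δ.IsHermitian) {δ : ℝ} (hδ : 0 ≤ δ) (hbd : ∀ i j, ‖Δ i j‖ ≤ δ)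
    (hsmall : 2 * (Fintype.card X : ℝ) ^ 2 * δ ≤ m) :
    |entropy (Matrix.diagonal (fun i => (a i : ℂ)) + Δ)
      - (∑ i, Real.negMulLog (a i) + ∑ i, (-Real.log (a i) - 1) * (Δ i i).re
        - 1 / 2 * ∑ i, ∑ j, logSlope (a i) (a j) * ‖Δ i j‖ ^ 2)|
      ≤ 4 * (Fintype.card X : ℝ) ^ 5 / m ^ 2 * δ ^ 3 := by
  set N : ℝ := (Fintype.card X : ℝ) with hN
  have hN0 : 0 ≤ N := Nat.cast_nonneg _
  have hB : (Matrix.diagonal (fun i => (a i : ℂ)) + Δ).IsHermitian := by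
    refine Matrix.IsHermitian.add ?_ hΔ
    rw [Matrix.isHermitian_diagonal_iff]
    intro i
    simp [IsSelfAdjoint]
  obtain ⟨V, hV, b, hVb⟩ := exists_unitary_diagonal hB
  rw [hVb, entropy_conj_diagonal hV]
  have hVV : V * V.conjTranspose = 1 := Matrix.mem_unitaryGroup_iff.1 hV
  have hVV' : V.conjTranspose * V = 1 := Matrix.mem_unitaryGroup_iff'.1 hV
  -- entries of `Δ V` in terms of the two spectra
  have hΔV : ∀ i j, (Δ * V) i j = ((b j - a i : ℝ) : ℂ) * V i j := fun i j => by
    have h1 : Δ * V = V * Matrix.diagonal (fun i => (b i : ℂ))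
        - Matrix.diagonal (fun i => (a i : ℂ)) * V := by
      rw [eq_sub_iff_add_eq', ← add_mul, hVb, mul_assoc, hVV', mul_one]
    rw [h1, Matrix.sub_apply, Matrix.mul_diagonal, Matrix.diagonal_mul]
    push_cast; ring
  have hV1 : ∀ i j, ‖V i j‖ ≤ 1 := fun i j => entry_norm_bound_of_unitary hV i j
  have hΔVbd : ∀ i j, ‖(Δ * V) i j‖ ≤ N * δ := fun i j => by
    rw [Matrix.mul_apply]
    refine (norm_sum_le _ _).trans ((Finset.sum_le_card_nsmul _ _ δ fun k _ => ?_).trans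
      (by simp [hN, nsmul_eq_mul]))
    rw [norm_mul]
    exact (mul_le_mul (hbd i k) (hV1 k j) (norm_nonneg _) hδ).trans (mul_one δ).le
  have hnsq : ∀ i j, ‖(Δ * V) i j‖ ^ 2 = (b j - a i) ^ 2 * ‖V i j‖ ^ 2 := fun i j => by
    rw [hΔV, norm_mul, mul_pow, Complex.norm_real, Real.norm_eq_abs, sq_abs]
  -- the perturbed spectrum stays positive
  have hb : ∀ j, m / 2 ≤ b j := fun j => by
    by_contra! hlt
    have hN1 : 1 ≤ N := by
      rw [hN]; exact_mod_cast Fintype.card_pos_iff.2 ⟨j⟩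
    -- If b_j < m/2, every factor |b_j − a_i| exceeds m/2, so column j of ΔV, with V having unit
    -- columns, is longer than m/2; the entry bound Nδ together with 2N²δ ≤ m forbids this.
    have h1 : ∑ i, (m / 2) ^ 2 * ‖V i j‖ ^ 2 < ∑ i, ‖(Δ * V) i j‖ ^ 2 := by
      have hle : ∀ i, (m / 2) ^ 2 * ‖V i j‖ ^ 2 ≤ ‖(Δ * V) i j‖ ^ 2 := fun i => by
        rw [hnsq]
        have := ha i
        gcongr ?_ * _
        nlinarith
      refine Finset.sum_lt_sum (fun i _ => hle i) ?_
      by_contra! hall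
      have h0 : ∀ i, ‖V i j‖ ^ 2 = 0 := fun i => by
        by_contra hne
        have hp : 0 < ‖V i j‖ ^ 2 := lt_of_le_of_ne (by positivity) (Ne.symm hne)
        have h2 := hall i (Finset.mem_univ i)
        rw [hnsq] at h2
        have := ha i
        have h3 := le_of_mul_le_mul_right h2 hp
        nlinarith
      have := sum_norm_sq_col hV j
      simp [h0] at this
    rw [← Finset.mul_sum, sum_norm_sq_col hV, mul_one] at h1
    have h2 : ∑ i, ‖(Δ * V) i j‖ ^ 2 ≤ N * (N * δ) ^ 2 :=
      (Finset.sum_le_card_nsmul _ _ ((N * δ) ^ 2) fun i _ =>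
        pow_le_pow_left₀ (norm_nonneg _) (hΔVbd i j) 2).trans (by simp [hN, nsmul_eq_mul])
    have h3 : (N ^ 2 * δ) ^ 2 ≤ (m / 2) ^ 2 :=
      pow_le_pow_left₀ (by positivity) (by linarith) 2
    nlinarith [sq_nonneg (N * δ), mul_nonneg (mul_nonneg hN0 (sub_nonneg.2 hN1))
      (mul_nonneg hN0 (sq_nonneg (N*δ))), mul_nonneg (mul_nonneg hN0 (sub_nonneg.2 hN1))
      (sq_nonneg (N*δ)), mul_nonneg (sub_nonneg.2 hN1) (sq_nonneg (N*δ))]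
  have ha0 : ∀ i, 0 < a i := fun i => hm.trans_le (ha i)
  have hb0 : ∀ j, 0 < b j := fun j => (half_pos hm).trans_le (hb j)
  -- exact expansion in the pair of eigenbases
  have hdiag : ∀ i, ∑ j, ‖V i j‖ ^ 2 * (b j - a i) = (Δ i i).re := fun i => by
    have h1 : Δ = (Δ * V) * V.conjTranspose := by rw [mul_assoc, hVV, mul_one]
    conv_rhs => rw [h1, Matrix.mul_apply, Complex.re_sum]
    refine Finset.sum_congr rfl fun j _ => ?_
    rw [hΔV, Matrix.conjTranspose_apply, Complex.star_def, mul_assoc, Complex.mul_conj',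
      ← Complex.ofReal_pow, ← Complex.ofReal_mul, Complex.ofReal_re, mul_comm]
  -- The matrix |V_ij|² is doubly stochastic. The scalar expansion of f(b_j) about a_i is averaged
  -- with these weights, and (b_j − a_i)² |V_ij|² is the squared entry of ΔV.
  have hexact : ∑ j, Real.negMulLog (b j) = ∑ i, Real.negMulLog (a i)
      + ∑ i, (-Real.log (a i) - 1) * (Δ i i).re
      + ∑ i, ∑ j, entropySecondDiff (a i) (b j) * ‖(Δ * V) i j‖ ^ 2 := by
    have h1 : ∑ j, Real.negMulLog (b j) = ∑ i, ∑ j, ‖V i j‖ ^ 2 * Real.negMulLog (b j) := by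
      rw [Finset.sum_comm]
      exact Finset.sum_congr rfl fun j _ => by
        rw [← Finset.sum_mul, sum_norm_sq_col hV, one_mul]
    rw [h1, ← Finset.sum_add_distrib, ← Finset.sum_add_distrib]
    refine Finset.sum_congr rfl fun i _ => ?_
    rw [← hdiag, Finset.mul_sum]
    have h2 : Real.negMulLog (a i) = ∑ j, ‖V i j‖ ^ 2 * Real.negMulLog (a i) := by
      rw [← Finset.sum_mul, sum_norm_sq_row hV, one_mul]
    rw [h2, ← Finset.sum_add_distrib, ← Finset.sum_add_distrib]
    refine Finset.sum_congr rfl fun j _ => ?_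
    rw [hnsq, negMulLog_taylor (ha0 i) (hb0 j)]
    ring
  -- As |Δ_ij|² is symmetric, only the symmetric part of f[a_i,a_i,a_j] counts, and that is minus
  -- half the logarithmic slope.
  have hsym : ∑ i, ∑ j, entropySecondDiff (a i) (a j) * ‖Δ i j‖ ^ 2
      = -(1 / 2) * ∑ i, ∑ j, logSlope (a i) (a j) * ‖Δ i j‖ ^ 2 := by
    have h1 : ∑ i, ∑ j, entropySecondDiff (a i) (a j) * ‖Δ i j‖ ^ 2
        = ∑ i, ∑ j, entropySecondDiff (a j) (a i) * ‖Δ i j‖ ^ 2 := by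
      rw [Finset.sum_comm]
      refine Finset.sum_congr rfl fun i _ => Finset.sum_congr rfl fun j _ => ?_
      rw [← hΔ.apply i j, norm_star]
    have h2 : ∑ i, ∑ j, entropySecondDiff (a i) (a j) * ‖Δ i j‖ ^ 2
        + ∑ i, ∑ j, entropySecondDiff (a j) (a i) * ‖Δ i j‖ ^ 2
        = -∑ i, ∑ j, logSlope (a i) (a j) * ‖Δ i j‖ ^ 2 := by
      simp only [← Finset.sum_add_distrib, ← Finset.sum_neg_distrib]
      refine Finset.sum_congr rfl fun i _ => Finset.sum_congr rfl fun j _ => ?_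
      rw [← add_mul, entropySecondDiff_add_swap (ha0 i) (ha0 j), neg_mul]
    linarith
  have hrem : ∀ i, |∑ j, entropySecondDiff (a i) (b j) * ‖(Δ * V) i j‖ ^ 2
      - ∑ j, entropySecondDiff (a i) (a j) * ‖Δ i j‖ ^ 2| ≤ 4 * N ^ 4 / m ^ 2 * δ ^ 3 :=
      fun i => by
    -- Both sums are spread over pairs (k, j) with the same weight Δ_ik V_kj conj((ΔV)_ij): summing
    -- it over k gives |(ΔV)_ij|², summing over j gives |Δ_ik|². Only a difference of the two
    -- coefficients is left to estimate.
    have h1 : ((∑ j, entropySecondDiff (a i) (b j) * ‖(Δ * V) i j‖ ^ 2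
        - ∑ j, entropySecondDiff (a i) (a j) * ‖Δ i j‖ ^ 2 : ℝ) : ℂ)
        = ∑ k, ∑ j, Δ i k * V k j * star ((Δ * V) i j)
          * ((entropySecondDiff (a i) (b j) - entropySecondDiff (a i) (a k) : ℝ) : ℂ) := by
      have e1 : ∀ j, ((‖(Δ * V) i j‖ ^ 2 : ℝ) : ℂ)
          = ∑ k, Δ i k * V k j * star ((Δ * V) i j) := fun j => by
        rw [← Finset.sum_mul, ← Matrix.mul_apply, Complex.star_def, Complex.mul_conj']
        push_cast; rfl
      have e2 : ∀ k, ((‖Δ i k‖ ^ 2 : ℝ) : ℂ)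
          = ∑ j, Δ i k * V k j * star ((Δ * V) i j) := fun k => by
        have h1 : Δ = (Δ * V) * V.conjTranspose := by rw [mul_assoc, hVV, mul_one]
        have h2 : star (Δ i k) = ∑ j, V k j * star ((Δ * V) i j) := by
          conv_lhs => rw [h1, Matrix.mul_apply, star_sum]
          refine Finset.sum_congr rfl fun j _ => ?_
          rw [Matrix.conjTranspose_apply, StarMul.star_mul, star_star]
        simp only [mul_assoc]
        rw [← Finset.mul_sum, ← h2, Complex.star_def, Complex.mul_conj']
        push_cast; rfl
      simp only [Complex.ofReal_sub, Complex.ofReal_sum, Complex.ofReal_mul, e1, e2, mul_sub,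
        Finset.sum_sub_distrib, Finset.mul_sum]
      congr 1
      · rw [Finset.sum_comm]
        exact Finset.sum_congr rfl fun k _ => Finset.sum_congr rfl fun j _ => mul_comm _ _
      · exact Finset.sum_congr rfl fun k _ => Finset.sum_congr rfl fun j _ => mul_comm _ _
    rw [← Real.norm_eq_abs, ← Complex.norm_real, h1]
    have hterm : ∀ k j, ‖Δ i k * V k j * star ((Δ * V) i j)
        * ((entropySecondDiff (a i) (b j) - entropySecondDiff (a i) (a k) : ℝ) : ℂ)‖
        ≤ 4 * N ^ 2 / m ^ 2 * δ ^ 3 := fun k j => by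
      -- All points lie above m/2, hence the 4/m². The factor |b_j − a_k| from the Lipschitz bound
      -- joins V_kj to form an entry of ΔV, which supplies the third power of δ without any matching
      -- of the two spectra.
      have hl := entropySecondDiff_lipschitz (half_pos hm)
        ((half_le_self hm.le).trans (ha i)) (hb j) ((half_le_self hm.le).trans (ha k))
      have e : ‖V k j‖ * |b j - a k| = ‖(Δ * V) k j‖ := by
        rw [hΔV, norm_mul, Complex.norm_real, Real.norm_eq_abs, mul_comm]
      rw [norm_mul, norm_mul, norm_mul, norm_star, Complex.norm_real, Real.norm_eq_abs]
      calc ‖Δ i k‖ * ‖V k j‖ * ‖(Δ * V) i j‖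
            * |entropySecondDiff (a i) (b j) - entropySecondDiff (a i) (a k)|
          ≤ ‖Δ i k‖ * ‖V k j‖ * ‖(Δ * V) i j‖ * (|b j - a k| / (m / 2) ^ 2) := by gcongr
        _ = ‖Δ i k‖ * ‖(Δ * V) k j‖ * ‖(Δ * V) i j‖ * (4 / m ^ 2) := by
            rw [← e]; field_simp; norm_num
        _ ≤ δ * (N * δ) * (N * δ) * (4 / m ^ 2) := by
            gcongr
            · exact hbd i k
            · exact hΔVbd k j
            · exact hΔVbd i j
        _ = 4 * N ^ 2 / m ^ 2 * δ ^ 3 := by ring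
    calc ‖∑ k, ∑ j, Δ i k * V k j * star ((Δ * V) i j)
          * ((entropySecondDiff (a i) (b j) - entropySecondDiff (a i) (a k) : ℝ) : ℂ)‖
        ≤ ∑ _k : X, ∑ _j : X, 4 * N ^ 2 / m ^ 2 * δ ^ 3 :=
          (norm_sum_le _ _).trans (Finset.sum_le_sum fun k _ =>
            (norm_sum_le _ _).trans (Finset.sum_le_sum fun j _ => hterm k j))
      _ = 4 * N ^ 4 / m ^ 2 * δ ^ 3 := by
          simp only [Finset.sum_const, Finset.card_univ, nsmul_eq_mul, ← hN]; ring
  rw [hexact]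
  have hfin : ∑ i, Real.negMulLog (a i) + ∑ i, (-Real.log (a i) - 1) * (Δ i i).re
      + ∑ i, ∑ j, entropySecondDiff (a i) (b j) * ‖(Δ * V) i j‖ ^ 2
      - (∑ i, Real.negMulLog (a i) + ∑ i, (-Real.log (a i) - 1) * (Δ i i).re
        - 1 / 2 * ∑ i, ∑ j, logSlope (a i) (a j) * ‖Δ i j‖ ^ 2)
      = ∑ i, (∑ j, entropySecondDiff (a i) (b j) * ‖(Δ * V) i j‖ ^ 2
        - ∑ j, entropySecondDiff (a i) (a j) * ‖Δ i j‖ ^ 2) := by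
    rw [Finset.sum_sub_distrib, hsym]; ring
  rw [hfin]
  calc |∑ i, (∑ j, entropySecondDiff (a i) (b j) * ‖(Δ * V) i j‖ ^ 2
        - ∑ j, entropySecondDiff (a i) (a j) * ‖Δ i j‖ ^ 2)|
      ≤ ∑ _i : X, 4 * N ^ 4 / m ^ 2 * δ ^ 3 :=
        (Finset.abs_sum_le_sum_abs _ _).trans (Finset.sum_le_sum fun i _ => hrem i)
    _ = 4 * N ^ 5 / m ^ 2 * δ ^ 3 := by
        simp only [Finset.sum_const, Finset.card_univ, nsmul_eq_mul, ← hN]; ring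

end Taylor

/-! ### Monotonicity of the functions of the bulk spectrum -/

section PairFunctions

/-- An average of reciprocals of linear forms in (a, b); this form makes the joint convexity visible
and treats a = b without a separate case later on. -/
theorem logSlope_eq_integral {a b : ℝ} (ha : 0 < a) (hb : 0 < b) :
    logSlope a b = ∫ t in (0 : ℝ)..1, 1 / (b + t * (a - b)) := by
  unfold logSlope
  by_cases h : a = b
  · subst h; simp
  · rw [if_neg h]
    have h0 : a - b ≠ 0 := sub_ne_zero.2 h
    have hd : ∀ t ∈ Set.uIcc (0 : ℝ) 1, HasDerivAt
        (fun t => Real.log (b + t * (a - b)) / (a - b)) (1 / (b + t * (a - b))) t :=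
        fun t ht => by
      rw [Set.uIcc_of_le zero_le_one] at ht
      have hp := (lt_min hb ha).trans_le (segment_ge (min_le_left _ _) (min_le_right _ _) ht)
      have hc : HasDerivAt (fun t => b + t * (a - b)) (a - b) t := by
        simpa using ((hasDerivAt_id t).mul_const (a - b)).const_add b
      convert! ((Real.hasDerivAt_log hp.ne').comp t hc).div_const (a - b) using 1
      field_simp
    have hc : ContinuousOn (fun t : ℝ => 1 / (b + t * (a - b))) (Set.uIcc 0 1) := by
      refine ContinuousOn.div (by fun_prop) (by fun_prop) fun t ht => ?_
      rw [Set.uIcc_of_le zero_le_one] at ht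
      exact ((lt_min hb ha).trans_le
        (segment_ge (min_le_left _ _) (min_le_right _ _) ht)).ne'
    rw [intervalIntegral.integral_eq_sub_of_hasDerivAt hd hc.intervalIntegrable]
    simp [sub_div]

theorem logSlope_pos {a b : ℝ} (ha : 0 < a) (hb : 0 < b) : 0 < logSlope a b := by
  unfold logSlope
  split_ifs with h
  · positivity
  · rcases lt_or_gt_of_ne h with h | h
    · exact div_pos_of_neg_of_neg (sub_neg.2 (Real.log_lt_log ha h)) (sub_neg.2 h)
    · exact div_pos (sub_pos.2 (Real.log_lt_log hb h)) (sub_pos.2 h)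

/-- Homogeneity of degree −1, used to take the factor 1/d_χ out of the flat spectrum on A. -/
theorem logSlope_mul {c a b : ℝ} (hc : 0 < c) (ha : 0 < a) (hb : 0 < b) :
    c * logSlope (c * a) (c * b) = logSlope a b := by
  unfold logSlope
  by_cases h : a = b
  · subst h
    simp only [if_true]
    field_simp
  · have h0 : a - b ≠ 0 := sub_ne_zero.2 h
    rw [if_neg h, if_neg (fun h' => h (mul_left_cancel₀ hc.ne' h')),
      Real.log_mul hc.ne' ha.ne', Real.log_mul hc.ne' hb.ne', ← mul_sub]
    field_simp
    ring

/-- `(a + s b)² (log a - log b) / (a - b)`. -/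
noncomputable def pairFn (s a b : ℝ) : ℝ := (a + s * b) ^ 2 * logSlope a b

/-- An exact formula for the convexity defect of u²/v. The defect is a square, and for 0 < θ < 1 it
vanishes only when (u, v) and (u′, v′) are proportional. -/
theorem sq_div_convex {u u' v v' θ : ℝ} (hv : 0 < v) (hv' : 0 < v') (h0 : 0 ≤ θ) (h1 : θ ≤ 1) :
    (θ * u + (1 - θ) * u') ^ 2 / (θ * v + (1 - θ) * v')
      = θ * (u ^ 2 / v) + (1 - θ) * (u' ^ 2 / v')
        - θ * (1 - θ) * (u * v' - u' * v) ^ 2 / (v * v' * (θ * v + (1 - θ) * v')) := by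
  have : θ * v + (1 - θ) * v' ≠ 0 := by
    rcases h0.eq_or_lt with rfl | h
    · simpa using hv'.ne'
    · have := mul_pos h hv
      have := mul_nonneg (sub_nonneg.2 h1) hv'.le
      positivity
  field_simp
  ring

variable {s a b a' b' θ : ℝ}

theorem pairFn_integrand_continuousOn (ha : 0 < a) (hb : 0 < b) :
    ContinuousOn (fun t : ℝ => (a + s * b) ^ 2 / (b + t * (a - b))) (Set.Icc 0 1) := by
  refine ContinuousOn.div (by fun_prop) (by fun_prop) fun t ht => ?_
  exact ((lt_min hb ha).trans_le (segment_ge (min_le_left _ _) (min_le_right _ _) ht)).ne'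

theorem pairFn_eq_integral (ha : 0 < a) (hb : 0 < b) :
    pairFn s a b = ∫ t in (0 : ℝ)..1, (a + s * b) ^ 2 / (b + t * (a - b)) := by
  rw [pairFn, logSlope_eq_integral ha hb, ← intervalIntegral.integral_const_mul]
  simp only [mul_one_div]

theorem pairFn_combo_eq_integral (ha : 0 < a) (hb : 0 < b) (ha' : 0 < a') (hb' : 0 < b') :
    θ * pairFn s a b + (1 - θ) * pairFn s a' b' = ∫ t in (0 : ℝ)..1,
      (θ * ((a + s * b) ^ 2 / (b + t * (a - b)))
        + (1 - θ) * ((a' + s * b') ^ 2 / (b' + t * (a' - b')))) := by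
  have hi : ∀ {x y : ℝ}, 0 < x → 0 < y → IntervalIntegrable
      (fun t : ℝ => (x + s * y) ^ 2 / (y + t * (x - y))) volume 0 1 := fun hx hy =>
    ContinuousOn.intervalIntegrable (by
      rw [Set.uIcc_of_le zero_le_one]; exact pairFn_integrand_continuousOn hx hy)
  rw [intervalIntegral.integral_add ((hi ha hb).const_mul _) ((hi ha' hb').const_mul _),
    intervalIntegral.integral_const_mul, intervalIntegral.integral_const_mul,
    pairFn_eq_integral ha hb, pairFn_eq_integral ha' hb']

theorem combo_pos (ha : 0 < a) (ha' : 0 < a') (h0 : 0 ≤ θ) (h1 : θ ≤ 1) :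
    0 < θ * a + (1 - θ) * a' := by
  rcases h0.eq_or_lt with rfl | h
  · simpa using ha'
  · have := mul_pos h ha
    have := mul_nonneg (sub_nonneg.2 h1) ha'.le
    positivity

theorem pairFn_integrand_combo (ha : 0 < a) (hb : 0 < b) (ha' : 0 < a') (hb' : 0 < b')
    (h0 : 0 ≤ θ) (h1 : θ ≤ 1) {t : ℝ} (ht : t ∈ Set.Icc (0 : ℝ) 1) :
    (θ * a + (1 - θ) * a' + s * (θ * b + (1 - θ) * b')) ^ 2
        / ((θ * b + (1 - θ) * b')
          + t * ((θ * a + (1 - θ) * a') - (θ * b + (1 - θ) * b')))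
      ≤ θ * ((a + s * b) ^ 2 / (b + t * (a - b)))
        + (1 - θ) * ((a' + s * b') ^ 2 / (b' + t * (a' - b'))) := by
  have hv := (lt_min hb ha).trans_le (segment_ge (min_le_left _ _) (min_le_right _ _) ht)
  have hv' := (lt_min hb' ha').trans_le (segment_ge (min_le_left _ _) (min_le_right _ _) ht)
  have h := sq_div_convex (u := a + s * b) (u' := a' + s * b') hv hv' h0 h1
  have h2 : 0 ≤ θ * (1 - θ) * ((a + s * b) * (b' + t * (a' - b'))
      - (a' + s * b') * (b + t * (a - b))) ^ 2 / ((b + t * (a - b)) * (b' + t * (a' - b'))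
        * (θ * (b + t * (a - b)) + (1 - θ) * (b' + t * (a' - b')))) := by
    have := combo_pos hv hv' h0 h1
    have := sub_nonneg.2 h1
    positivity
  calc _ = (θ * (a + s * b) + (1 - θ) * (a' + s * b')) ^ 2
        / (θ * (b + t * (a - b)) + (1 - θ) * (b' + t * (a' - b'))) := by congr 1 <;> ring
    _ ≤ _ := by rw [h]; linarith

/-- Joint convexity of `pairFn`. -/
theorem pairFn_convex (ha : 0 < a) (hb : 0 < b) (ha' : 0 < a') (hb' : 0 < b')
    (h0 : 0 ≤ θ) (h1 : θ ≤ 1) :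
    pairFn s (θ * a + (1 - θ) * a') (θ * b + (1 - θ) * b')
      ≤ θ * pairFn s a b + (1 - θ) * pairFn s a' b' := by
  rw [pairFn_combo_eq_integral ha hb ha' hb',
    pairFn_eq_integral (combo_pos ha ha' h0 h1) (combo_pos hb hb' h0 h1)]
  have hc := pairFn_integrand_continuousOn (s := s) (combo_pos ha ha' h0 h1)
    (combo_pos hb hb' h0 h1)
  have hc' := ((pairFn_integrand_continuousOn (s := s) ha hb).const_smul θ).add
    ((pairFn_integrand_continuousOn (s := s) ha' hb').const_smul (1 - θ))
  rw [← Set.uIcc_of_le zero_le_one] at hc hc'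
  exact intervalIntegral.integral_mono_on zero_le_one hc.intervalIntegrable
    hc'.intervalIntegrable fun t ht => pairFn_integrand_combo ha hb ha' hb' h0 h1 ht

/-- Since `pairFn` is homogeneous of degree one, strictness needs non-proportional pairs. By
continuity of the integrands a strict inequality at the single point t = 0 suffices; there the
defect involves a b′ − a′ b, whatever the value of s. -/
theorem pairFn_convex_strict (ha : 0 < a) (hb : 0 < b) (ha' : 0 < a') (hb' : 0 < b')
    (h0 : 0 < θ) (h1 : θ < 1) (hne : a * b' ≠ a' * b) :
    pairFn s (θ * a + (1 - θ) * a') (θ * b + (1 - θ) * b')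
      < θ * pairFn s a b + (1 - θ) * pairFn s a' b' := by
  rw [pairFn_combo_eq_integral ha hb ha' hb',
    pairFn_eq_integral (combo_pos ha ha' h0.le h1.le) (combo_pos hb hb' h0.le h1.le)]
  have hc := pairFn_integrand_continuousOn (s := s) (combo_pos ha ha' h0.le h1.le)
    (combo_pos hb hb' h0.le h1.le)
  have hc' := ((pairFn_integrand_continuousOn (s := s) ha hb).const_smul θ).add
    ((pairFn_integrand_continuousOn (s := s) ha' hb').const_smul (1 - θ))
  refine intervalIntegral.integral_lt_integral_of_continuousOn_of_le_of_exists_lt zero_lt_one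
    hc hc' (fun t ht => pairFn_integrand_combo ha hb ha' hb' h0.le h1.le ⟨ht.1.le, ht.2⟩)
    ⟨0, by simp, ?_⟩
  simp only [zero_mul, add_zero]
  have h := sq_div_convex (u := a + s * b) (u' := a' + s * b') hb hb' h0.le h1.le
  have h2 : 0 < θ * (1 - θ) * ((a + s * b) * b' - (a' + s * b') * b) ^ 2
      / (b * b' * (θ * b + (1 - θ) * b')) := by
    have := combo_pos hb hb' h0.le h1.le
    have := sub_pos.2 h1
    have : (a + s * b) * b' - (a' + s * b') * b ≠ 0 := by
      intro h; apply hne; linarith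
    positivity
  have e : θ * a + (1 - θ) * a' + s * (θ * b + (1 - θ) * b')
      = θ * (a + s * b) + (1 - θ) * (a' + s * b') := by ring
  rw [e, h]
  linarith

/-- The sum of `pairFn` over all pairs of eigenvalues. -/
noncomputable def pairSum {X : Type*} [Fintype X] (s : ℝ) (lam : X → ℝ) : ℝ :=
  ∑ i, ∑ j, pairFn s (lam i) (lam j)

variable {X : Type*} [Fintype X] [DecidableEq X] {lam : X → ℝ}

theorem f₁_eq_pairSum (h : ∀ i, 0 < lam i) :
    f₁ lam = 1 / (2 * (Fintype.card X : ℝ)) * pairSum (-1) lam := by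
  unfold f₁ pairSum
  congr 1
  refine Finset.sum_congr rfl fun i _ => Finset.sum_congr rfl fun j _ => ?_
  unfold pairFn logSlope
  by_cases hij : lam i = lam j
  · simp [hij]
  · have h0 : lam i - lam j ≠ 0 := sub_ne_zero.2 hij
    have : i ≠ j := fun h => hij (h ▸ rfl)
    rw [if_neg hij, if_neg this, Real.log_div (h i).ne' (h j).ne']
    field_simp
    ring

theorem f₂_eq_pairSum (h : ∀ i, 0 < lam i) (hsum : ∑ i, lam i = 1) :
    f₂ lam = 1 / (2 * (Fintype.card X : ℝ)) * pairSum 1 lam - 2 := by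
  -- A diagonal pair contributes (2λ_i)²/λ_i = 4λ_i, in total 4; divided by 2d this is the summand
  -- 2/d in f₂.
  have h1 : pairSum 1 lam = 4 + ∑ i, ∑ j, if i = j then 0 else
      (lam i + lam j) ^ 2 * logSlope (lam i) (lam j) := by
    have : (4 : ℝ) = ∑ i, ∑ j, if i = j then 4 * lam i else 0 := by
      simp [← Finset.mul_sum, hsum]
    rw [this, ← Finset.sum_add_distrib]
    refine Finset.sum_congr rfl fun i _ => ?_
    rw [← Finset.sum_add_distrib]
    refine Finset.sum_congr rfl fun j _ => ?_
    unfold pairFn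
    by_cases hij : i = j
    · subst hij
      have := (h i).ne'
      simp only [if_true, logSlope]
      field_simp
      ring
    · simp [hij]
  unfold f₂
  rw [h1]
  ring

end PairFunctions

/-! ### Product spectra of Bell-like pairs and their dependence on the Schmidt weights -/

section BulkSpectrum

variable {n : ℕ}

theorem weight_pos {x : ℝ} (h : 0 < x ∧ x < 1) (i : Fin 2) : 0 < weight x i := by
  unfold weight
  split_ifs
  · exact h.1
  · linarith [h.2]

theorem weight_one_sub (x : ℝ) (i : Fin 2) : weight (1 - x) i = weight x (Equiv.swap 0 1 i) := by
  fin_cases i <;> simp [weight]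

theorem bulkSpectrum_pos {p : Fin n → ℝ} (h : FullRank p) (b : Qubits n) :
    0 < bulkSpectrum p b :=
  Finset.prod_pos fun k _ => weight_pos (h k) (b k)

theorem sum_weight (x : ℝ) : ∑ i, weight x i = 1 := by
  simp [weight]

theorem sum_bulkSpectrum (p : Fin n → ℝ) : ∑ b, bulkSpectrum p b = 1 := by
  unfold bulkSpectrum
  rw [← Fintype.piFinset_univ, ← Finset.prod_univ_sum]
  simp only [sum_weight, Finset.prod_const_one]

theorem bulkSpectrum_update (p : Fin n → ℝ) (k : Fin n) (x : ℝ) (b : Qubits n) :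
    bulkSpectrum (Function.update p k x) b
      = weight x (b k) * ∏ j ∈ Finset.univ.erase k, weight (p j) (b j) := by
  unfold bulkSpectrum
  rw [← Finset.mul_prod_erase _ _ (Finset.mem_univ k), Function.update_self]
  congr 1
  exact Finset.prod_congr rfl fun j hj => by
    rw [Function.update_of_ne (Finset.ne_of_mem_erase hj)]

theorem FullRank.update {p : Fin n → ℝ} (h : FullRank p) (k : Fin n) {x : ℝ}
    (hx : 0 < x ∧ x < 1) : FullRank (Function.update p k x) := fun j => by
  by_cases hj : j = k
  · subst hj; simpa using hx
  · simpa [hj] using h j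

theorem bulkSpectrum_update_combo (p : Fin n → ℝ) (k : Fin n) (x y θ : ℝ) (b : Qubits n) :
    bulkSpectrum (Function.update p k (θ * x + (1 - θ) * y)) b
      = θ * bulkSpectrum (Function.update p k x) b
        + (1 - θ) * bulkSpectrum (Function.update p k y) b := by
  have : weight (θ * x + (1 - θ) * y) (b k) = θ * weight x (b k) + (1 - θ) * weight y (b k) := by
    unfold weight
    split_ifs <;> ring
  rw [bulkSpectrum_update, bulkSpectrum_update, bulkSpectrum_update, this]
  ring

/-- Flip the `k`-th qubit label. -/
def flipQubit (k : Fin n) : Equiv.Perm (Qubits n) :=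
  Equiv.piCongrRight fun j => if j = k then Equiv.swap 0 1 else Equiv.refl _

theorem bulkSpectrum_update_one_sub (p : Fin n → ℝ) (k : Fin n) (x : ℝ) (b : Qubits n) :
    bulkSpectrum (Function.update p k (1 - x)) b
      = bulkSpectrum (Function.update p k x) (flipQubit k b) := by
  rw [bulkSpectrum_update, bulkSpectrum_update, weight_one_sub]
  congr 1
  · simp [flipQubit]
  · exact Finset.prod_congr rfl fun j hj => by
      simp [flipQubit, Finset.ne_of_mem_erase hj]

/-- Exchanging the two Schmidt weights of a pair permutes the spectrum by a bit flip, and the sum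
runs over all pairs of eigenvalues. -/
theorem pairSum_update_one_sub (s : ℝ) (p : Fin n → ℝ) (k : Fin n) (x : ℝ) :
    pairSum s (bulkSpectrum (Function.update p k (1 - x)))
      = pairSum s (bulkSpectrum (Function.update p k x)) := by
  unfold pairSum
  simp only [bulkSpectrum_update_one_sub]
  rw [Equiv.sum_comp (flipQubit k) fun b => ∑ b', pairFn s
    (bulkSpectrum (Function.update p k x) b)
    (bulkSpectrum (Function.update p k x) (flipQubit k b'))]
  exact Finset.sum_congr rfl fun b _ => Equiv.sum_comp (flipQubit k) fun b' => pairFn s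
    (bulkSpectrum (Function.update p k x) b) (bulkSpectrum (Function.update p k x) b')

/-- A number between `x` and `1 - x` is a convex combination of the two. -/
theorem exists_combo_one_sub {x y : ℝ} (hx : x ≠ 1 / 2) (h : |2 * y - 1| ≤ |2 * x - 1|) :
    ∃ θ : ℝ, 0 ≤ θ ∧ θ ≤ 1 ∧ y = θ * x + (1 - θ) * (1 - x) ∧
      (|2 * y - 1| < |2 * x - 1| → 0 < θ ∧ θ < 1) := by
  have h0 : 2 * x - 1 ≠ 0 := fun h => hx (by linarith)
  -- In the centred coordinate 2x − 1 the endpoints are opposite, so the ratio r ∈ [−1, 1]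
  -- determines the weight θ = (1 + r)/2.
  set r := (2 * y - 1) / (2 * x - 1) with hr
  have hry : 2 * y - 1 = r * (2 * x - 1) := by rw [hr]; field_simp
  have hra : |2 * y - 1| = |r| * |2 * x - 1| := by rw [hry, abs_mul]
  have hx0 := abs_pos.2 h0
  have hr1 : |r| ≤ 1 := by
    rw [hra] at h
    exact le_of_mul_le_mul_right (by linarith) hx0
  refine ⟨(1 + r) / 2, ?_, ?_, ?_, fun hlt => ?_⟩
  · linarith [(abs_le.1 hr1).1]
  · linarith [(abs_le.1 hr1).2]
  · linarith
  · have hr2 : |r| < 1 := by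
      rw [hra] at hlt
      exact lt_of_mul_lt_mul_right (by linarith) hx0.le
    constructor
    · linarith [(abs_lt.1 hr2).1]
    · linarith [(abs_lt.1 hr2).2]

/-- The sum has the same value at x and at 1 − x, the spectrum is affine in the weight, and each
summand is jointly convex; an intermediate weight therefore gives at most that value. -/
theorem pairSum_update_le (s : ℝ) {p : Fin n → ℝ} (hp : FullRank p) (k : Fin n) {x y : ℝ}
    (hx : 0 < x ∧ x < 1) (h : |2 * y - 1| ≤ |2 * x - 1|) :
    pairSum s (bulkSpectrum (Function.update p k y))
      ≤ pairSum s (bulkSpectrum (Function.update p k x)) := by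
  by_cases hx2 : x = 1 / 2
  · subst hx2
    have : y = 1 / 2 := by
      have : |2 * y - 1| ≤ 0 := by simpa using h
      linarith [abs_nonpos_iff.1 this]
    rw [this]
  · obtain ⟨θ, h0, h1, rfl, -⟩ := exists_combo_one_sub hx2 h
    have hx' : 0 < 1 - x ∧ 1 - x < 1 := ⟨by linarith [hx.2], by linarith [hx.1]⟩
    have e : pairSum s (bulkSpectrum (Function.update p k x))
        = θ * pairSum s (bulkSpectrum (Function.update p k x))
          + (1 - θ) * pairSum s (bulkSpectrum (Function.update p k (1 - x))) := by
      rw [pairSum_update_one_sub]; ring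
    rw [e]
    unfold pairSum
    simp only [Finset.mul_sum, ← Finset.sum_add_distrib, bulkSpectrum_update_combo]
    exact Finset.sum_le_sum fun b _ => Finset.sum_le_sum fun b' _ =>
      pairFn_convex (bulkSpectrum_pos (hp.update k hx) _) (bulkSpectrum_pos (hp.update k hx) _)
        (bulkSpectrum_pos (hp.update k hx') _) (bulkSpectrum_pos (hp.update k hx') _) h0 h1

theorem pairSum_update_lt (s : ℝ) {p : Fin n → ℝ} (hp : FullRank p) (k : Fin n) {x y : ℝ}
    (hx : 0 < x ∧ x < 1) (h : |2 * y - 1| < |2 * x - 1|) :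
    pairSum s (bulkSpectrum (Function.update p k y))
      < pairSum s (bulkSpectrum (Function.update p k x)) := by
  have hx2 : x ≠ 1 / 2 := by
    rintro rfl
    norm_num at h
    exact absurd h (not_lt.2 (abs_nonneg _))
  obtain ⟨θ, h0, h1, rfl, hθ⟩ := exists_combo_one_sub hx2 h.le
  have hx' : 0 < 1 - x ∧ 1 - x < 1 := ⟨by linarith [hx.2], by linarith [hx.1]⟩
  have e : pairSum s (bulkSpectrum (Function.update p k x))
      = θ * pairSum s (bulkSpectrum (Function.update p k x))
        + (1 - θ) * pairSum s (bulkSpectrum (Function.update p k (1 - x))) := by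
    rw [pairSum_update_one_sub]; ring
  rw [e]
  unfold pairSum
  simp only [Finset.mul_sum, ← Finset.sum_add_distrib, bulkSpectrum_update_combo]
  have hle : ∀ b b', pairFn s _ _ ≤ _ := fun b b' =>
    pairFn_convex (s := s) (bulkSpectrum_pos (hp.update k hx) b)
      (bulkSpectrum_pos (hp.update k hx) b') (bulkSpectrum_pos (hp.update k hx') b)
      (bulkSpectrum_pos (hp.update k hx') b') h0 h1
  -- One strict summand is enough: the all-zero label and its flip at k. There the two pairs of
  -- eigenvalues are (xμ, (1−x)μ) and its reversal, whose determinant is (2x − 1)μ² ≠ 0.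
  refine Finset.sum_lt_sum (fun b _ => Finset.sum_le_sum fun b' _ => hle b b')
    ⟨fun _ => 0, Finset.mem_univ _, Finset.sum_lt_sum (fun b' _ => hle _ b')
      ⟨flipQubit k fun _ => 0, Finset.mem_univ _, ?_⟩⟩
  refine pairFn_convex_strict (bulkSpectrum_pos (hp.update k hx) _)
    (bulkSpectrum_pos (hp.update k hx) _) (bulkSpectrum_pos (hp.update k hx') _)
    (bulkSpectrum_pos (hp.update k hx') _) (hθ h).1 (hθ h).2 ?_
  have e1 : flipQubit k (flipQubit k fun _ => 0) = fun _ => 0 := by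
    funext j
    by_cases hj : j = k <;> simp [flipQubit, hj]
  rw [bulkSpectrum_update_one_sub, bulkSpectrum_update_one_sub, e1]
  have hμ : 0 < ∏ j ∈ Finset.univ.erase k, weight (p j) 0 :=
    Finset.prod_pos fun j _ => weight_pos (hp j) 0
  have e2 : bulkSpectrum (Function.update p k x) (fun _ => 0)
      = x * ∏ j ∈ Finset.univ.erase k, weight (p j) 0 := by
    rw [bulkSpectrum_update]; simp [weight]
  have e3 : bulkSpectrum (Function.update p k x) (flipQubit k fun _ => 0)
      = (1 - x) * ∏ j ∈ Finset.univ.erase k, weight (p j) 0 := by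
    rw [← bulkSpectrum_update_one_sub, bulkSpectrum_update]; simp [weight]
  rw [e2, e3]
  intro h
  have h3 : (2 * x - 1) * (∏ j ∈ Finset.univ.erase k, weight (p j) 0) ^ 2 = 0 := by
    linear_combination h
  rcases mul_eq_zero.1 h3 with h4 | h4
  · exact hx2 (by linarith)
  · exact hμ.ne' (pow_eq_zero_iff two_ne_zero |>.1 h4)

theorem pairSum_bulkSpectrum_le (s : ℝ) {p q : Fin n → ℝ} (hp : FullRank p) (hq : FullRank q)
    (h : ∀ k, |2 * q k - 1| ≤ |2 * p k - 1|) :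
    pairSum s (bulkSpectrum q) ≤ pairSum s (bulkSpectrum p) := by
  -- The pairs are exchanged one by one; S is the set of indices whose weight is already that of q.
  have key : ∀ S : Finset (Fin n),
      pairSum s (bulkSpectrum (S.piecewise q p)) ≤ pairSum s (bulkSpectrum p) := fun S => by
    induction S using Finset.induction_on with
    | empty => simp
    | insert k S hk ih =>
      refine le_trans ?_ ih
      rw [Finset.piecewise_insert]
      have hr : FullRank (S.piecewise q p) := fun j => by
        by_cases hj : j ∈ S
        · simpa [hj] using hq j
        · simpa [hj] using hp j
      have := pairSum_update_le s hr k (hp k) (h k)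
      have e : Function.update (S.piecewise q p) k (p k) = S.piecewise q p := by
        have : p k = S.piecewise q p k := by simp [hk]
        rw [this, Function.update_eq_self]
      rwa [e] at this
  simpa using key Finset.univ

theorem pairSum_bulkSpectrum_lt (s : ℝ) {p q : Fin n → ℝ} (hp : FullRank p) (hq : FullRank q)
    (h : ∀ k, |2 * q k - 1| ≤ |2 * p k - 1|) (hlt : ∃ k, |2 * q k - 1| < |2 * p k - 1|) :
    pairSum s (bulkSpectrum q) < pairSum s (bulkSpectrum p) := by
  obtain ⟨k, hk⟩ := hlt
  have h1 := pairSum_update_lt s hp k (hp k) hk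
  rw [Function.update_eq_self] at h1
  -- The strictly improving pair is changed first, the others afterwards by the weak inequality.
  refine lt_of_le_of_lt (pairSum_bulkSpectrum_le s (hp.update k (hq k)) hq fun j => ?_) h1
  by_cases hj : j = k
  · subst hj; simp
  · simpa [hj] using h j

/-- The symmetry x ↦ 1 − x folds the interval onto [0, 1/2], where the binary entropy is strictly
increasing; comparing entropies thus means comparing distances from 1/2 in reverse. -/
theorem binEntropy_eq_half_sub (x : ℝ) :
    Real.binEntropy x = Real.binEntropy (2⁻¹ - |2 * x - 1| / 2) := by
  rcases abs_cases (2 * x - 1) with ⟨h, -⟩ | ⟨h, -⟩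
  · rw [h, ← Real.binEntropy_one_sub]
    congr 1; ring
  · rw [h]
    congr 1; ring

theorem binEntropy_le_iff {x y : ℝ} (hx : 0 < x ∧ x < 1) (hy : 0 < y ∧ y < 1) :
    Real.binEntropy x ≤ Real.binEntropy y ↔ |2 * y - 1| ≤ |2 * x - 1| := by
  have hmem : ∀ {z : ℝ}, 0 < z ∧ z < 1 → 2⁻¹ - |2 * z - 1| / 2 ∈ Set.Icc (0 : ℝ) 2⁻¹ :=
    fun {z} hz => by
      have : |2 * z - 1| ≤ 1 := abs_le.2 ⟨by linarith [hz.1], by linarith [hz.2]⟩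
      constructor
      · linarith
      · linarith [abs_nonneg (2 * z - 1)]
  rw [binEntropy_eq_half_sub x, binEntropy_eq_half_sub y,
    Real.binEntropy_strictMonoOn.le_iff_le (hmem hx) (hmem hy)]
  constructor <;> intro h <;> linarith

theorem binEntropy_lt_iff {x y : ℝ} (hx : 0 < x ∧ x < 1) (hy : 0 < y ∧ y < 1) :
    Real.binEntropy x < Real.binEntropy y ↔ |2 * y - 1| < |2 * x - 1| := by
  rw [← not_le, ← not_le, binEntropy_le_iff hy hx]

theorem f₁_decreases : DecreasesWithEntropy (fun p : Fin n → ℝ => f₁ (bulkSpectrum p)) := by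
  intro p q hp hq h
  simp only
  rw [f₁_eq_pairSum (bulkSpectrum_pos hp), f₁_eq_pairSum (bulkSpectrum_pos hq)]
  gcongr
  exact pairSum_bulkSpectrum_le _ hp hq fun k => (binEntropy_le_iff (hp k) (hq k)).1 (h k)

theorem f₁_strictly_decreases :
    StrictlyDecreasesWithEntropy (fun p : Fin n → ℝ => f₁ (bulkSpectrum p)) := by
  intro p q hp hq h ⟨k, hk⟩
  simp only
  rw [f₁_eq_pairSum (bulkSpectrum_pos hp), f₁_eq_pairSum (bulkSpectrum_pos hq)]
  have : 0 < Fintype.card (Qubits n) := Fintype.card_pos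
  gcongr
  exact pairSum_bulkSpectrum_lt _ hp hq (fun k => (binEntropy_le_iff (hp k) (hq k)).1 (h k))
    ⟨k, (binEntropy_lt_iff (hp k) (hq k)).1 hk⟩

theorem f₂_decreases : DecreasesWithEntropy (fun p : Fin n → ℝ => f₂ (bulkSpectrum p)) := by
  intro p q hp hq h
  simp only
  rw [f₂_eq_pairSum (bulkSpectrum_pos hp) (sum_bulkSpectrum p),
    f₂_eq_pairSum (bulkSpectrum_pos hq) (sum_bulkSpectrum q)]
  gcongr
  exact pairSum_bulkSpectrum_le _ hp hq fun k => (binEntropy_le_iff (hp k) (hq k)).1 (h k)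

theorem f₂_strictly_decreases :
    StrictlyDecreasesWithEntropy (fun p : Fin n → ℝ => f₂ (bulkSpectrum p)) := by
  intro p q hp hq h ⟨k, hk⟩
  simp only
  rw [f₂_eq_pairSum (bulkSpectrum_pos hp) (sum_bulkSpectrum p),
    f₂_eq_pairSum (bulkSpectrum_pos hq) (sum_bulkSpectrum q)]
  have : 0 < Fintype.card (Qubits n) := Fintype.card_pos
  gcongr
  exact pairSum_bulkSpectrum_lt _ hp hq (fun k => (binEntropy_le_iff (hp k) (hq k)).1 (h k))
    ⟨k, (binEntropy_lt_iff (hp k) (hq k)).1 hk⟩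

theorem f₁_nonneg {p : Fin n → ℝ} (hp : FullRank p) : 0 ≤ f₁ (bulkSpectrum p) := by
  rw [f₁_eq_pairSum (bulkSpectrum_pos hp)]
  refine mul_nonneg (by positivity) (Finset.sum_nonneg fun i _ => Finset.sum_nonneg fun j _ => ?_)
  exact mul_nonneg (sq_nonneg _)
    (logSlope_pos (bulkSpectrum_pos hp i) (bulkSpectrum_pos hp j)).le

/-- The subtracted 2 hides the sign. It is recovered from monotonicity: the maximally mixed spectrum
has the largest entropies, and f₂ is zero there. -/
theorem f₂_nonneg {p : Fin n → ℝ} (hp : FullRank p) : 0 ≤ f₂ (bulkSpectrum p) := by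
  have hh : FullRank fun _ : Fin n => (1 / 2 : ℝ) := fun _ => by norm_num
  have h0 : f₂ (bulkSpectrum fun _ : Fin n => (1 / 2 : ℝ)) = 0 := by
    rw [f₂_eq_pairSum (bulkSpectrum_pos hh) (sum_bulkSpectrum _)]
    have h1 : ∀ b : Qubits n, bulkSpectrum (fun _ : Fin n => (1 / 2 : ℝ)) b = (1 / 2) ^ n :=
      fun b => by
        have : ∀ i, weight (1 / 2) i = 1 / 2 := fun i => by
          unfold weight; split_ifs <;> norm_num
        simp only [bulkSpectrum, this, Finset.prod_const, Finset.card_univ, Fintype.card_fin]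
    simp only [pairSum, h1, pairFn, logSlope, if_true, Finset.sum_const, Finset.card_univ,
      Fintype.card_pi, Fintype.card_fin, Finset.prod_const, nsmul_eq_mul]
    push_cast
    have : (2 : ℝ) ^ n ≠ 0 := by positivity
    rw [one_div_pow]
    field_simp
    norm_num
  rw [← h0]
  refine f₂_decreases p _ hp hh fun k => (binEntropy_le_iff (hp k) (hh k)).2 ?_
  norm_num

end BulkSpectrum

/-! ### Second moments of the Haar measure -/

section HaarMoments

variable {X : Type*} [Fintype X] [DecidableEq X]

/-- The operator `U† M U`. -/
def corotate (M : Matrix X X ℂ) (U : Matrix X X ℂ) : Matrix X X ℂ := U.conjTranspose * M * U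

omit [DecidableEq X] in
theorem corotate_mul (M U V : Matrix X X ℂ) :
    corotate M (U * V) = corotate (corotate M U) V := by
  simp only [corotate, Matrix.conjTranspose_mul, mul_assoc]

theorem continuous_corotate_apply (M : Matrix X X ℂ) (i j : X) :
    Continuous fun U : Matrix.unitaryGroup X ℂ => corotate M U.1 i j := by
  have h : Continuous fun U : Matrix.unitaryGroup X ℂ => corotate M U.1 :=
    ((continuous_subtype_val.matrix_conjTranspose).matrix_mul continuous_const).matrix_mul
      continuous_subtype_val
  exact h.matrix_elem i j

theorem trace_corotate (M : Matrix X X ℂ) (U : Matrix.unitaryGroup X ℂ) :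
    (corotate M U.1).trace = M.trace := by
  rw [corotate, Matrix.trace_mul_comm, ← mul_assoc, ← Matrix.star_eq_conjTranspose,
    Matrix.mem_unitaryGroup_iff.1 U.2, one_mul]

omit [DecidableEq X] in
theorem sum_norm_sq_eq_trace {Y : Type*} [Fintype Y] (M : Matrix X Y ℂ) :
    ((∑ i, ∑ j, ‖M i j‖ ^ 2 : ℝ) : ℂ) = (M * M.conjTranspose).trace := by
  simp only [Matrix.trace, Matrix.diag, Matrix.mul_apply, Matrix.conjTranspose_apply,
    Complex.star_def, Complex.mul_conj']
  push_cast
  rfl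

theorem sum_norm_sq_corotate (M : Matrix X X ℂ) (U : Matrix.unitaryGroup X ℂ) :
    ∑ i, ∑ j, ‖corotate M U.1 i j‖ ^ 2 = ∑ i, ∑ j, ‖M i j‖ ^ 2 := by
  have hU : U.1 * U.1.conjTranspose = 1 := Matrix.mem_unitaryGroup_iff.1 U.2
  apply Complex.ofReal_injective
  rw [sum_norm_sq_eq_trace, sum_norm_sq_eq_trace]
  have : corotate M U.1 * (corotate M U.1).conjTranspose
      = U.1.conjTranspose * (M * M.conjTranspose * U.1) := by
    simp only [corotate, Matrix.conjTranspose_mul, Matrix.conjTranspose_conjTranspose]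
    calc _ = U.1.conjTranspose * M * (U.1 * U.1.conjTranspose) * M.conjTranspose * U.1 := by
          simp only [mul_assoc]
      _ = _ := by rw [hU, mul_one]; simp only [mul_assoc]
  rw [this, Matrix.trace_mul_comm, mul_assoc, hU, mul_one]

/-- Permutation matrices as elements of the unitary group. -/
def permUnitary (π : Equiv.Perm X) : Matrix.unitaryGroup X ℂ :=
  ⟨Matrix.of fun k l => if k = π l then 1 else 0, by
    rw [Matrix.mem_unitaryGroup_iff']
    ext k l
    simp [Matrix.mul_apply, Matrix.one_apply, Matrix.star_apply, eq_comm]⟩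

theorem corotate_perm (M : Matrix X X ℂ) (π : Equiv.Perm X) (i j : X) :
    corotate M (permUnitary π).1 i j = M (π i) (π j) := by
  simp [corotate, permUnitary, Matrix.mul_apply]

/-- Haar averages of `U† M U` are invariant under a further rotation. -/
theorem integral_corotate_corotate {E : Type*} [NormedAddCommGroup E] [NormedSpace ℝ E]
    (g : Matrix X X ℂ → E) (M : Matrix X X ℂ) (V : Matrix.unitaryGroup X ℂ) :
    ∫ U, g (corotate (corotate M U.1) V.1) ∂(haarUnitary X) =
      ∫ U, g (corotate M U.1) ∂(haarUnitary X) := by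
  simpa only [corotate_mul] using integral_comp_mul_right (fun W => g (corotate M W)) V

omit [Fintype X] in
-- Double transitivity of the symmetric group: through permutation matrices, off-diagonal moments do
-- not depend on the chosen pair of indices.
theorem exists_perm_pair {i j i' j' : X} (h : i ≠ j) (h' : i' ≠ j') :
    ∃ π : Equiv.Perm X, π i = i' ∧ π j = j' := by
  refine ⟨Equiv.swap (Equiv.swap i i' j) j' * Equiv.swap i i', ?_, ?_⟩
  · rw [Equiv.Perm.mul_apply, Equiv.swap_apply_left]
    refine Equiv.swap_apply_of_ne_of_ne (fun h1 => h ?_) h'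
    have := congrArg (Equiv.swap i i') h1
    simpa using this
  · simp

theorem integral_norm_sq_offdiag_eq (M : Matrix X X ℂ) {i j i' j' : X} (h : i ≠ j)
    (h' : i' ≠ j') :
    ∫ U, ‖corotate M U.1 i j‖ ^ 2 ∂(haarUnitary X)
      = ∫ U, ‖corotate M U.1 i' j'‖ ^ 2 ∂(haarUnitary X) := by
  obtain ⟨π, h1, h2⟩ := exists_perm_pair h h'
  rw [← integral_corotate_corotate (fun R => ‖R i j‖ ^ 2) M (permUnitary π)]
  simp only [corotate_perm, h1, h2]

theorem integral_norm_sq_diag_eq (M : Matrix X X ℂ) (i i' : X) :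
    ∫ U, ‖corotate M U.1 i i‖ ^ 2 ∂(haarUnitary X)
      = ∫ U, ‖corotate M U.1 i' i'‖ ^ 2 ∂(haarUnitary X) := by
  rw [← integral_corotate_corotate (fun R => ‖R i i‖ ^ 2) M (permUnitary (Equiv.swap i i'))]
  simp only [corotate_perm, Equiv.swap_apply_left]

theorem integral_diag_mul_eq (M : Matrix X X ℂ) {i j i' j' : X} (h : i ≠ j) (h' : i' ≠ j') :
    ∫ U, (corotate M U.1 i i * star (corotate M U.1 j j)).re ∂(haarUnitary X)
      = ∫ U, (corotate M U.1 i' i' * star (corotate M U.1 j' j')).re ∂(haarUnitary X) := by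
  obtain ⟨π, h1, h2⟩ := exists_perm_pair h h'
  rw [← integral_corotate_corotate (fun R => (R i i * star (R j j)).re) M (permUnitary π)]
  simp only [corotate_perm, h1, h2]

/-- Mixed second moments are symmetric under exchange of the matrix indices. -/
theorem integral_mixed_swap (M M' : Matrix X X ℂ) (c : ℂ) (i j : X) :
    ∫ U, (c * corotate M U.1 i j * star (corotate M' U.1 i j)).re ∂(haarUnitary X)
      = ∫ U, (c * corotate M U.1 j i * star (corotate M' U.1 j i)).re ∂(haarUnitary X) := by
  rw [← integral_comp_mul_right
    (fun W => (c * corotate M W i j * star (corotate M' W i j)).re) (permUnitary (Equiv.swap i j))]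
  simp only [corotate_mul, corotate_perm, Equiv.swap_apply_left, Equiv.swap_apply_right]

/-- A unitary (a reflection) with `i`-th column `3/5 eᵢ + 4/5 t eⱼ`. -/
theorem exists_unitary_column {i j : X} (h : i ≠ j) {t : ℂ} (ht : t * star t = 1) :
    ∃ V : Matrix.unitaryGroup X ℂ, ∀ k,
      V.1 k i = (if k = i then 3 / 5 else 0) + if k = j then 4 / 5 * t else 0 := by
  -- This is eᵢ minus the wanted column. Both are unit vectors with real inner product, so the
  -- reflection in w exchanges them; ‖w‖² = 4/5 gives the factor 5/2. The Pythagorean pair 3/5, 4/5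
  -- avoids square roots.
  set w : X → ℂ := Pi.single i (2 / 5) - Pi.single j (4 / 5 * t) with hw
  have hwi : w i = 2 / 5 := by simp [hw, h]
  have hwj : w j = -(4 / 5 * t) := by simp [hw, h.symm]
  have hww : star w ⬝ᵥ w = 4 / 5 := by
    have h1 : star w ⬝ᵥ w = star w ⬝ᵥ Pi.single i (2 / 5)
        - star w ⬝ᵥ Pi.single j (4 / 5 * t) := by
      conv_lhs => arg 2; rw [hw]
      rw [dotProduct_sub]
    rw [h1, dotProduct_single, dotProduct_single, Pi.star_apply, Pi.star_apply, hwi, hwj]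
    simp only [star_neg, star_mul', star_div₀, star_ofNat]
    linear_combination (16 / 25) * ht
  set R : Matrix X X ℂ := 1 - (5 / 2 : ℂ) • Matrix.vecMulVec w (star w) with hR
  have hRs : star R = R := by
    rw [hR, star_sub, star_one, star_smul, Matrix.star_eq_conjTranspose,
      Matrix.conjTranspose_vecMulVec, star_star]
    simp
  have hRR : R * R = 1 := by
    have h1 : Matrix.vecMulVec w (star w) * Matrix.vecMulVec w (star w)
        = (4 / 5 : ℂ) • Matrix.vecMulVec w (star w) := by
      rw [Matrix.vecMulVec_mul_vecMulVec, hww, Matrix.vecMulVec_smul]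
    rw [hR, sub_mul, mul_sub, one_mul, one_mul, mul_sub, mul_one, smul_mul_smul_comm, h1, smul_smul]
    norm_num
    abel_nf
    rw [← sub_eq_zero]
    module
  refine ⟨⟨R, by rw [Matrix.mem_unitaryGroup_iff, hRs, hRR]⟩, fun k => ?_⟩
  simp only [hR, Matrix.sub_apply, Matrix.smul_apply, Matrix.vecMulVec_apply, Pi.star_apply, hwi,
    Matrix.one_apply, smul_eq_mul, star_div₀, star_ofNat]
  by_cases hki : k = i
  · subst hki; simp [hwi, h]; norm_num
  · by_cases hkj : k = j
    · subst hkj; simp [hwj, hki]; ring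
    · simp [hw, hki, hkj]

theorem corotate_column (M V : Matrix X X ℂ) {i j : X} {t : ℂ}
    (hV : ∀ k, V k i = (if k = i then 3 / 5 else 0) + if k = j then 4 / 5 * t else 0) :
    corotate M V i i = 9 / 25 * M i i + 12 / 25 * t * M i j + 12 / 25 * star t * M j i
      + 16 / 25 * (t * star t) * M j j := by
  simp only [corotate, Matrix.mul_apply, Matrix.conjTranspose_apply, hV, star_add, mul_add,
    add_mul, Finset.sum_add_distrib, apply_ite star, star_mul', star_div₀, star_ofNat, star_zero,
    ite_mul, mul_ite, zero_mul, mul_zero, Finset.sum_ite_eq', Finset.mem_univ, if_true]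
  ring

/-- Averaging a phase over the fourth roots of unity removes all cross terms, including that of b
and c, which carries t² and would survive the signs ±1 alone. -/
theorem norm_sq_fourth_roots (a b c : ℂ) :
    ‖a + 1 * b + star 1 * c‖ ^ 2 + ‖a + (-1) * b + star (-1) * c‖ ^ 2
      + ‖a + Complex.I * b + star Complex.I * c‖ ^ 2
      + ‖a + (-Complex.I) * b + star (-Complex.I) * c‖ ^ 2
      = 4 * (‖a‖ ^ 2 + ‖b‖ ^ 2 + ‖c‖ ^ 2) := by
  simp only [← Complex.normSq_eq_norm_sq, Complex.normSq_apply]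
  simp
  ring

theorem integral_add_four {T : Type*} [MeasurableSpace T] {μ : Measure T} {f g h k : T → ℝ}
    (hf : Integrable f μ) (hg : Integrable g μ) (hh : Integrable h μ) (hk : Integrable k μ) :
    ∫ x, (f x + g x + h x + k x) ∂μ = ∫ x, f x ∂μ + ∫ x, g x ∂μ + ∫ x, h x ∂μ + ∫ x, k x ∂μ := by
  have h1 := integral_add ((hf.add hg).add hh) hk
  have h2 := integral_add (hf.add hg) hh
  have h3 := integral_add hf hg
  simp only [Pi.add_apply] at h1 h2 h3
  rw [h1, h2, h3]

/-- Invariance under rotations in a coordinate plane relates the diagonal moments to the others. -/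
theorem integral_diag_eq_add (M : Matrix X X ℂ) {i j : X} (h : i ≠ j) :
    ∫ U, ‖corotate M U.1 i i‖ ^ 2 ∂(haarUnitary X)
      = ∫ U, ‖corotate M U.1 i j‖ ^ 2 ∂(haarUnitary X)
        + ∫ U, (corotate M U.1 i i * star (corotate M U.1 j j)).re ∂(haarUnitary X) := by
  have hc := continuous_corotate_apply M
  have hint : ∀ k l, Integrable (fun U : Matrix.unitaryGroup X ℂ => ‖corotate M U.1 k l‖ ^ 2)
      (haarUnitary X) := fun k l => integrable_of_continuous ((hc k l).norm.pow 2)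
  have hint2 : Integrable (fun U : Matrix.unitaryGroup X ℂ =>
      (corotate M U.1 i i * star (corotate M U.1 j j)).re) (haarUnitary X) :=
    integrable_of_continuous (Complex.continuous_re.comp ((hc i i).mul (hc j j).star))
  -- Right invariance under the reflection with phase t rewrites the diagonal moment; the equality
  -- for t = ±1, ±i is then averaged.
  have key : ∀ t : ℂ, t * star t = 1 →
      ∫ U, ‖corotate M U.1 i i‖ ^ 2 ∂(haarUnitary X)
        = ∫ U, ‖(9 / 25 * corotate M U.1 i i + 16 / 25 * corotate M U.1 j j)
          + t * (12 / 25 * corotate M U.1 i j) + star t * (12 / 25 * corotate M U.1 j i)‖ ^ 2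
            ∂(haarUnitary X) := fun t ht => by
    obtain ⟨V, hV⟩ := exists_unitary_column h ht
    rw [← integral_corotate_corotate (fun R => ‖R i i‖ ^ 2) M V]
    refine integral_congr_ae (Eventually.of_forall fun U => ?_)
    simp only
    rw [corotate_column _ _ hV, ht]
    congr 2
    ring
  have hit : ∀ t : ℂ, Integrable (fun U : Matrix.unitaryGroup X ℂ =>
      ‖(9 / 25 * corotate M U.1 i i + 16 / 25 * corotate M U.1 j j)
          + t * (12 / 25 * corotate M U.1 i j) + star t * (12 / 25 * corotate M U.1 j i)‖ ^ 2)
      (haarUnitary X) := fun t => integrable_of_continuous (by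
    have h1 := hc i i
    have h2 := hc i j
    have h3 := hc j i
    have h4 := hc j j
    fun_prop)
  have h4 : 4 * ∫ U, ‖corotate M U.1 i i‖ ^ 2 ∂(haarUnitary X)
      = ∫ U, 4 * (‖9 / 25 * corotate M U.1 i i + 16 / 25 * corotate M U.1 j j‖ ^ 2
        + ‖12 / 25 * corotate M U.1 i j‖ ^ 2 + ‖12 / 25 * corotate M U.1 j i‖ ^ 2)
          ∂(haarUnitary X) := by
    simp only [← norm_sq_fourth_roots]
    rw [integral_add_four (hit 1) (hit (-1)) (hit Complex.I) (hit (-Complex.I)),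
      ← key 1 (by simp), ← key (-1) (by simp), ← key Complex.I (by simp),
      ← key (-Complex.I) (by simp)]
    ring
  have h5 : ∀ U : Matrix.unitaryGroup X ℂ,
      4 * (‖9 / 25 * corotate M U.1 i i + 16 / 25 * corotate M U.1 j j‖ ^ 2
        + ‖12 / 25 * corotate M U.1 i j‖ ^ 2 + ‖12 / 25 * corotate M U.1 j i‖ ^ 2)
      = 324 / 625 * ‖corotate M U.1 i i‖ ^ 2 + 1024 / 625 * ‖corotate M U.1 j j‖ ^ 2
        + 1152 / 625 * (corotate M U.1 i i * star (corotate M U.1 j j)).re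
        + 576 / 625 * (‖corotate M U.1 i j‖ ^ 2 + ‖corotate M U.1 j i‖ ^ 2) :=
      fun U => by
    generalize corotate M U.1 i i = a
    generalize corotate M U.1 j j = b
    simp only [norm_mul, mul_pow]
    have : ‖9 / 25 * a + 16 / 25 * b‖ ^ 2 = 81 / 625 * ‖a‖ ^ 2 + 256 / 625 * ‖b‖ ^ 2
        + 288 / 625 * (a * star b).re := by
      simp only [← Complex.normSq_eq_norm_sq, Complex.normSq_apply]
      simp
      ring
    rw [this]
    norm_num
    ring
  simp only [h5] at h4
  have hint3 : Integrable (fun U : Matrix.unitaryGroup X ℂ =>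
      ‖corotate M U.1 i j‖ ^ 2 + ‖corotate M U.1 j i‖ ^ 2) (haarUnitary X) :=
    (hint i j).add (hint j i)
  rw [integral_add_four ((hint i i).const_mul _) ((hint j j).const_mul _) (hint2.const_mul _)
    (hint3.const_mul _)] at h4
  simp only [integral_const_mul] at h4
  rw [integral_add (hint i j) (hint j i)] at h4
  -- With β the diagonal moment, α the off-diagonal one and γ the mixed diagonal one, the relation
  -- becomes 4β = (1348/625) β + (1152/625)(α + γ), and 4 − 1348/625 = 1152/625.
  rw [integral_norm_sq_diag_eq M j i, integral_norm_sq_offdiag_eq M h.symm h] at h4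
  linarith

theorem sum_offdiag_eq {c r : ℝ} {F : X → X → ℝ} (hd : ∀ i, F i i = c)
    (ho : ∀ i j, i ≠ j → F i j = r) :
    ∑ i, ∑ j, F i j = (Fintype.card X : ℝ) * c
      + (Fintype.card X : ℝ) * ((Fintype.card X : ℝ) - 1) * r := by
  have h : ∀ i j, F i j = r + if i = j then c - r else 0 := fun i j => by
    by_cases hij : i = j
    · subst hij; simp [hd]
    · simp [hij, ho i j hij]
  simp only [h, Finset.sum_add_distrib, Finset.sum_ite_eq, Finset.mem_univ, if_true,
    Finset.sum_const, Finset.card_univ, nsmul_eq_mul]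
  ring

/-- Permutations leave three unknown moments. The conserved Hilbert–Schmidt norm and the conserved
trace give two linear equations, and the rotation in a coordinate plane gives β = α + γ as the
third. -/
theorem haar_moments (M : Matrix X X ℂ) {i j : X} (h : i ≠ j) :
    (∫ U, ‖corotate M U.1 i j‖ ^ 2 ∂(haarUnitary X)
      = (∑ k, ∑ l, ‖M k l‖ ^ 2 - ‖M.trace‖ ^ 2 / (Fintype.card X : ℝ))
        / ((Fintype.card X : ℝ) ^ 2 - 1)) ∧
    (∫ U, ‖corotate M U.1 i i‖ ^ 2 ∂(haarUnitary X)
      = (∑ k, ∑ l, ‖M k l‖ ^ 2 + ‖M.trace‖ ^ 2)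
        / ((Fintype.card X : ℝ) * ((Fintype.card X : ℝ) + 1))) := by
  have hc := continuous_corotate_apply M
  have hint : ∀ k l, Integrable (fun U : Matrix.unitaryGroup X ℂ => ‖corotate M U.1 k l‖ ^ 2)
      (haarUnitary X) := fun k l => integrable_of_continuous ((hc k l).norm.pow 2)
  have hint2 : ∀ k l, Integrable (fun U : Matrix.unitaryGroup X ℂ =>
      (corotate M U.1 k k * star (corotate M U.1 l l)).re) (haarUnitary X) := fun k l =>
    integrable_of_continuous (Complex.continuous_re.comp ((hc k k).mul (hc l l).star))
  have hβ := integral_diag_eq_add M h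
  set α := ∫ U, ‖corotate M U.1 i j‖ ^ 2 ∂(haarUnitary X) with hα
  set β := ∫ U, ‖corotate M U.1 i i‖ ^ 2 ∂(haarUnitary X) with hβ'
  set γ := ∫ U, (corotate M U.1 i i * star (corotate M U.1 j j)).re ∂(haarUnitary X) with hγ
  set d : ℝ := (Fintype.card X : ℝ) with hd
  have hd2 : 2 ≤ d := by
    have : 1 < Fintype.card X := Fintype.one_lt_card_iff.2 ⟨i, j, h⟩
    rw [hd]; exact_mod_cast this
  have e1 : ∑ k, ∑ l, ‖M k l‖ ^ 2 = d * β + d * (d - 1) * α := by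
    rw [← sum_offdiag_eq (F := fun k l => ∫ U, ‖corotate M U.1 k l‖ ^ 2 ∂(haarUnitary X))
      (fun k => integral_norm_sq_diag_eq M k i)
      (fun k l hkl => integral_norm_sq_offdiag_eq M hkl h)]
    simp_rw [← integral_finsetSum Finset.univ fun l _ => hint _ l]
    rw [← integral_finsetSum Finset.univ fun k _ => integrable_finsetSum _ fun l _ => hint k l]
    simp only [sum_norm_sq_corotate]
    simp
  have e2 : ‖M.trace‖ ^ 2 = d * β + d * (d - 1) * γ := by
    rw [← sum_offdiag_eq (F := fun k l =>
        ∫ U, (corotate M U.1 k k * star (corotate M U.1 l l)).re ∂(haarUnitary X))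
      (fun k => ?_) (fun k l hkl => integral_diag_mul_eq M hkl h)]
    · simp_rw [← integral_finsetSum Finset.univ fun l _ => hint2 _ l]
      rw [← integral_finsetSum Finset.univ fun k _ => integrable_finsetSum _ fun l _ => hint2 k l]
      have : ∀ U : Matrix.unitaryGroup X ℂ,
          ∑ k, ∑ l, (corotate M U.1 k k * star (corotate M U.1 l l)).re = ‖M.trace‖ ^ 2 :=
          fun U => by
        rw [← trace_corotate M U]
        simp only [← Complex.re_sum, ← Finset.mul_sum, ← star_sum]
        rw [← Finset.sum_mul, Complex.star_def]
        change ((corotate M U.1).trace * (starRingEnd ℂ) (corotate M U.1).trace).re = _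
        rw [Complex.mul_conj', ← Complex.ofReal_pow, Complex.ofReal_re]
      simp only [this]
      simp
    · rw [hβ', ← integral_norm_sq_diag_eq M k i]
      refine integral_congr_ae (Eventually.of_forall fun U => ?_)
      simp only
      rw [Complex.star_def, Complex.mul_conj', ← Complex.ofReal_pow, Complex.ofReal_re]
  have h0 : d ≠ 0 := by linarith
  have h1 : d + 1 ≠ 0 := by linarith
  have h2 : d ^ 2 - 1 ≠ 0 := by nlinarith
  constructor
  · rw [e1, e2, eq_div_iff h2, hβ]
    field_simp
    ring
  · rw [e1, e2, eq_div_iff (mul_ne_zero h0 h1), hβ]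
    ring

end HaarMoments

/-! ### Partial traces -/

section PartialTrace

variable {X Y : Type*} [Fintype X] [Fintype Y] [DecidableEq X] [DecidableEq Y]

omit [DecidableEq X] in
theorem traceRight_kronecker_one_mul (M : Matrix X X ℂ) (P : Matrix (X × Y) (X × Y) ℂ) :
    traceRight ((M ⊗ₖ (1 : Matrix Y Y ℂ)) * P) = M * traceRight P := by
  ext x x'
  simp only [traceRight, Matrix.of_apply, Matrix.mul_apply, Fintype.sum_prod_type,
    Matrix.kronecker_apply, Matrix.one_apply, mul_ite, mul_one, mul_zero, ite_mul, zero_mul,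
    Finset.sum_ite_eq, Finset.mem_univ, if_true, Finset.mul_sum]
  rw [Finset.sum_comm]

omit [DecidableEq X] in
theorem traceRight_mul_kronecker_one (M : Matrix X X ℂ) (P : Matrix (X × Y) (X × Y) ℂ) :
    traceRight (P * (M ⊗ₖ (1 : Matrix Y Y ℂ))) = traceRight P * M := by
  ext x x'
  simp only [traceRight, Matrix.of_apply, Matrix.mul_apply, Fintype.sum_prod_type,
    Matrix.kronecker_apply, Matrix.one_apply, mul_ite, mul_one, mul_zero,
    Finset.sum_ite_eq', Finset.mem_univ, if_true, Finset.sum_mul]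
  rw [Finset.sum_comm]

omit [DecidableEq Y] in
theorem traceRight_one_kronecker_comm (M : Matrix Y Y ℂ) (P : Matrix (X × Y) (X × Y) ℂ) :
    traceRight (((1 : Matrix X X ℂ) ⊗ₖ M) * P) = traceRight (P * ((1 : Matrix X X ℂ) ⊗ₖ M)) := by
  ext x x'
  simp only [traceRight, Matrix.of_apply, Matrix.mul_apply, Fintype.sum_prod_type,
    Matrix.kronecker_apply, Matrix.one_apply, ite_mul, one_mul, zero_mul, mul_ite, mul_zero]
  simp only [Finset.sum_ite_irrel, Finset.sum_const_zero, Finset.sum_ite_eq, Finset.sum_ite_eq',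
    Finset.mem_univ, if_true]
  rw [Finset.sum_comm]
  simp only [mul_comm]

/-- An operator on the kept factor can be pulled out of the partial trace. On the traced factor the
partial trace is cyclic, so a unitary there cancels its adjoint. -/
theorem traceRight_conj (M : Matrix X X ℂ) {V : Matrix Y Y ℂ} (hV : V ∈ Matrix.unitaryGroup Y ℂ)
    (P : Matrix (X × Y) (X × Y) ℂ) :
    traceRight ((M ⊗ₖ V) * P * (M ⊗ₖ V).conjTranspose) = M * traceRight P * M.conjTranspose := by
  have e1 : M ⊗ₖ V = (M ⊗ₖ (1 : Matrix Y Y ℂ)) * ((1 : Matrix X X ℂ) ⊗ₖ V) := by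
    rw [← Matrix.mul_kronecker_mul, mul_one, one_mul]
  have e2 : (M ⊗ₖ V).conjTranspose
      = ((1 : Matrix X X ℂ) ⊗ₖ V.conjTranspose) * (M.conjTranspose ⊗ₖ (1 : Matrix Y Y ℂ)) := by
    rw [Matrix.conjTranspose_kronecker, ← Matrix.mul_kronecker_mul, mul_one, one_mul]
  rw [e2, e1, mul_assoc, mul_assoc, traceRight_kronecker_one_mul, ← mul_assoc, ← mul_assoc,
    traceRight_mul_kronecker_one, ← traceRight_one_kronecker_comm, ← mul_assoc,
    ← mul_assoc ((1 : Matrix X X ℂ) ⊗ₖ V.conjTranspose) _ P,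
    ← Matrix.mul_kronecker_mul, ← Matrix.star_eq_conjTranspose V,
    Matrix.mem_unitaryGroup_iff'.1 hV, one_mul, Matrix.one_kronecker_one, one_mul]

omit [Fintype X] [DecidableEq X] [DecidableEq Y] in
theorem traceRight_add (P Q : Matrix (X × Y) (X × Y) ℂ) :
    traceRight (P + Q) = traceRight P + traceRight Q := by
  ext; simp [traceRight, Finset.sum_add_distrib]

omit [Fintype X] [DecidableEq X] [DecidableEq Y] in
theorem traceRight_sub (P Q : Matrix (X × Y) (X × Y) ℂ) :
    traceRight (P - Q) = traceRight P - traceRight Q := by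
  ext; simp [traceRight, Finset.sum_sub_distrib]

omit [Fintype X] [DecidableEq X] [DecidableEq Y] in
theorem traceRight_smul (c : ℂ) (P : Matrix (X × Y) (X × Y) ℂ) :
    traceRight (c • P) = c • traceRight P := by
  ext; simp [traceRight, Finset.mul_sum]

omit [DecidableEq X] [DecidableEq Y] in
theorem trace_traceRight (P : Matrix (X × Y) (X × Y) ℂ) : (traceRight P).trace = P.trace := by
  simp [traceRight, Matrix.trace, Fintype.sum_prod_type]

omit [Fintype X] [DecidableEq X] [DecidableEq Y] in
theorem isHermitian_traceRight {P : Matrix (X × Y) (X × Y) ℂ} (h : P.IsHermitian) :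
    (traceRight P).IsHermitian := by
  ext x x'
  simp only [traceRight, Matrix.conjTranspose_apply, Matrix.of_apply, star_sum]
  exact Finset.sum_congr rfl fun y _ => h.apply _ _

omit [Fintype X] [DecidableEq X] [DecidableEq Y] in
theorem norm_traceRight_le {P : Matrix (X × Y) (X × Y) ℂ} {c : ℝ} (h : ∀ i j, ‖P i j‖ ≤ c)
    (x x' : X) : ‖traceRight P x x'‖ ≤ Fintype.card Y * c :=
  (norm_sum_le _ _).trans ((Finset.sum_le_card_nsmul _ _ c fun _ _ => h _ _).trans
    (by simp [nsmul_eq_mul]))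

theorem kronecker_mem_unitaryGroup {M : Matrix X X ℂ} {V : Matrix Y Y ℂ}
    (hM : M ∈ Matrix.unitaryGroup X ℂ) (hV : V ∈ Matrix.unitaryGroup Y ℂ) :
    M ⊗ₖ V ∈ Matrix.unitaryGroup (X × Y) ℂ := by
  rw [Matrix.mem_unitaryGroup_iff', Matrix.star_eq_conjTranspose, Matrix.conjTranspose_kronecker,
    ← Matrix.mul_kronecker_mul, ← Matrix.star_eq_conjTranspose, ← Matrix.star_eq_conjTranspose,
    Matrix.mem_unitaryGroup_iff'.1 hM, Matrix.mem_unitaryGroup_iff'.1 hV,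
    Matrix.one_kronecker_one]

end PartialTrace

/-! ### Expansion of the exponential -/

section ExpI

variable {X : Type*} [Fintype X] [DecidableEq X]

theorem expI_conjTranspose {W : Matrix X X ℂ} (hW : W.IsHermitian) (ε : ℝ) :
    (expI ε W).conjTranspose = expI (-ε) W := by
  rw [expI, ← Matrix.exp_conjTranspose, Matrix.conjTranspose_smul, hW.eq, expI]
  simp

theorem expI_mem_unitaryGroup {W : Matrix X X ℂ} (hW : W.IsHermitian) (ε : ℝ) :
    expI ε W ∈ Matrix.unitaryGroup X ℂ := by
  rw [Matrix.mem_unitaryGroup_iff, Matrix.star_eq_conjTranspose, expI_conjTranspose hW, expI, expI,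
    ← Matrix.exp_add_of_commute]
  · rw [← add_smul]
    simp
  · exact ((Commute.refl W).smul_left _).smul_right _

theorem expI_conj (U : Matrix.unitaryGroup X ℂ) (W : Matrix X X ℂ) (ε : ℝ) :
    expI ε (U.1.conjTranspose * W * U.1) = U.1.conjTranspose * expI ε W * U.1 := by
  have hU : U.1⁻¹ = U.1.conjTranspose :=
    Matrix.inv_eq_left_inv (Matrix.mem_unitaryGroup_iff'.1 U.2)
  have hu : IsUnit U.1 := (Unitary.toUnits U).isUnit
  rw [expI, expI, ← hU, ← Matrix.exp_conj' _ _ hu]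
  simp only [Matrix.mul_smul, Matrix.smul_mul]

/-- The tail of the series from degree two is compared termwise with ‖x‖² exp ‖x‖, using (n + 2)! ≥
n!. -/
theorem norm_exp_sub_one_sub_le {R : Type*} [NormedRing R] [NormedAlgebra ℂ R] [CompleteSpace R]
    (x : R) : ‖NormedSpace.exp x - 1 - x‖ ≤ ‖x‖ ^ 2 * Real.exp ‖x‖ := by
  let _ : NormedAlgebra ℚ R := NormedAlgebra.restrictScalars ℚ ℂ R
  have h := (NormedSpace.exp_series_hasSum_exp' (𝕂 := ℂ) x)
  have h2 := (hasSum_nat_add_iff' 2).2 h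
  simp only [Finset.sum_range_succ, Finset.sum_range_zero, zero_add, Nat.factorial_zero,
    Nat.cast_one, inv_one, pow_zero, one_smul, Nat.factorial_one, pow_one, ← sub_sub] at h2
  have h3 := (NormedSpace.exp_series_hasSum_exp' (𝕂 := ℝ) ‖x‖).mul_left (‖x‖ ^ 2)
  rw [← Real.exp_eq_exp_ℝ] at h3
  rw [← h2.tsum_eq]
  refine tsum_of_norm_bounded h3 fun n => ?_
  rw [norm_smul, norm_inv, Complex.norm_natCast, smul_eq_mul]
  calc ((n + 2).factorial : ℝ)⁻¹ * ‖x ^ (n + 2)‖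
      ≤ (n.factorial : ℝ)⁻¹ * ‖x‖ ^ (n + 2) := by
        gcongr
        · omega
        · exact norm_pow_le' x (by omega)
    _ = ‖x‖ ^ 2 * ((n.factorial : ℝ)⁻¹ * ‖x‖ ^ n) := by ring

open scoped Matrix.Norms.Frobenius in
-- Turns the trace bound on the generator into a bound in a submultiplicative norm that also
-- dominates every entry.
theorem frobenius_norm_sq (M : Matrix X X ℂ) :
    ‖M‖ ^ 2 = (M.conjTranspose * M).trace.re := by
  have h : ((∑ i, ∑ j, ‖M i j‖ ^ 2 : ℝ) : ℂ) = (M.conjTranspose * M).trace := by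
    rw [sum_norm_sq_eq_trace, Matrix.trace_mul_comm]
  rw [← h, Complex.ofReal_re, Matrix.frobenius_norm_def, ← Real.sqrt_eq_rpow]
  have : ∀ i j, ‖M i j‖ ^ (2 : ℝ) = ‖M i j‖ ^ 2 := fun i j => by norm_cast
  simp only [this]
  exact Real.sq_sqrt (by positivity)

open scoped Matrix.Norms.Frobenius in
theorem norm_entry_le_frobenius (M : Matrix X X ℂ) (i j : X) : ‖M i j‖ ≤ ‖M‖ := by
  refine le_of_sq_le_sq ?_ (norm_nonneg _)
  have h : ((∑ i, ∑ j, ‖M i j‖ ^ 2 : ℝ) : ℂ) = (M.conjTranspose * M).trace := by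
    rw [sum_norm_sq_eq_trace, Matrix.trace_mul_comm]
  rw [frobenius_norm_sq, ← h, Complex.ofReal_re]
  exact (Finset.single_le_sum (f := fun j => ‖M i j‖ ^ 2) (fun _ _ => by positivity)
    (Finset.mem_univ j)).trans (Finset.single_le_sum (f := fun i => ∑ j, ‖M i j‖ ^ 2)
      (fun _ _ => by positivity) (Finset.mem_univ i))

open scoped Matrix.Norms.Frobenius in
/-- First-order expansion of `exp (iεW) P exp (-iεW)`, uniform for bounded `W`. -/
theorem exists_conj_expI_bound (P : Matrix X X ℂ) (K : ℝ) :
    ∃ C : ℝ, 0 ≤ C ∧ ∀ ε : ℝ, |ε| ≤ 1 → ∀ W : Matrix X X ℂ, W.IsHermitian →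
      (W.conjTranspose * W).trace.re ≤ K ^ 2 →
      (∀ i j, ‖(Complex.I • (W * P - P * W)) i j‖ ≤ C) ∧
      ∀ i j, ‖(expI ε W * P * (expI ε W).conjTranspose - P
        - (ε : ℂ) • (Complex.I • (W * P - P * W))) i j‖ ≤ C * ε ^ 2 := by
  -- K enters only through its square, so it may be negative.
  set L := |K| with hL
  have hL0 : 0 ≤ L := abs_nonneg K
  set c := L ^ 2 * Real.exp L with hc
  have hc0 : 0 ≤ c := by positivity
  -- The first summand bounds the commutator; the other two bound the quadratic remainder.
  refine ⟨2 * L * ‖P‖ + 2 * c * ‖P‖ + (L + c) * ‖P‖ * (L + c), by positivity,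
    fun ε hε W hW hK => ?_⟩
  have hWL : ‖W‖ ≤ L := by
    refine le_of_sq_le_sq ?_ hL0
    rw [frobenius_norm_sq, hL, sq_abs]
    exact hK
  have hP := norm_nonneg P
  have hε2 : ε ^ 2 ≤ 1 := by rw [← sq_abs]; exact pow_le_one₀ (abs_nonneg _) hε
  set Z : Matrix X X ℂ := (Complex.I * (ε : ℂ)) • W with hZ
  have hZn : ‖Z‖ ≤ |ε| * L := by
    rw [hZ, norm_smul, norm_mul, Complex.norm_I, one_mul, Complex.norm_real, Real.norm_eq_abs]
    gcongr
  have hZL : ‖Z‖ ≤ L := hZn.trans (mul_le_of_le_one_left hL0 hε)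
  set Y : Matrix X X ℂ := expI ε W - 1 - Z with hY
  have hYn : ‖Y‖ ≤ c * ε ^ 2 := by
    refine (norm_exp_sub_one_sub_le Z).trans ?_
    calc ‖Z‖ ^ 2 * Real.exp ‖Z‖ ≤ (|ε| * L) ^ 2 * Real.exp L := by gcongr
      _ = c * ε ^ 2 := by rw [mul_pow, sq_abs, hc]; ring
  have hE : expI ε W = 1 + (Z + Y) := by rw [hY]; abel
  have hZs : Z.conjTranspose = -Z := by
    rw [hZ, Matrix.conjTranspose_smul, hW.eq]
    simp
  have hZY : ‖Z + Y‖ ≤ (L + c) * |ε| := by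
    refine (norm_add_le _ _).trans ((add_le_add hZn hYn).trans ?_)
    have : ε ^ 2 ≤ |ε| := by
      rw [← sq_abs, sq]; exact mul_le_of_le_one_left (abs_nonneg _) hε
    nlinarith [mul_le_mul_of_nonneg_left this hc0]
  constructor
  · intro i j
    refine (norm_entry_le_frobenius _ i j).trans ?_
    rw [norm_smul, Complex.norm_I, one_mul]
    have h1 : ‖W * P - P * W‖ ≤ L * ‖P‖ + ‖P‖ * L :=
      (norm_sub_le _ _).trans (add_le_add
        ((norm_mul_le _ _).trans (by gcongr)) ((norm_mul_le _ _).trans (by gcongr)))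
    have h2 : 0 ≤ 2 * c * ‖P‖ + (L + c) * ‖P‖ * (L + c) := by positivity
    linarith
  · intro i j
    refine (norm_entry_le_frobenius _ i j).trans ?_
    -- Write exp(iεW) = 1 + Z + Y with Z anti-Hermitian of order ε and Y of order ε². The linear
    -- part ZP − PZ is the subtracted commutator, and every other term is of second order.
    have e : expI ε W * P * (expI ε W).conjTranspose - P
        - (ε : ℂ) • (Complex.I • (W * P - P * W))
        = Y * P + P * Y.conjTranspose + (Z + Y) * P * (Z + Y).conjTranspose := by
      have h1 : (ε : ℂ) • (Complex.I • (W * P - P * W)) = Z * P - P * Z := by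
        rw [hZ, smul_smul, mul_comm, smul_sub, Matrix.smul_mul, Matrix.mul_smul]
      rw [h1, hE]
      simp only [Matrix.conjTranspose_add, Matrix.conjTranspose_one, hZs]
      noncomm_ring
    rw [e]
    calc ‖Y * P + P * Y.conjTranspose + (Z + Y) * P * (Z + Y).conjTranspose‖
        ≤ (c * ε ^ 2) * ‖P‖ + ‖P‖ * (c * ε ^ 2)
          + ((L + c) * |ε|) * ‖P‖ * ((L + c) * |ε|) := by
          refine (norm_add_le _ _).trans (add_le_add ((norm_add_le _ _).trans (add_le_add
            ((norm_mul_le _ _).trans (by gcongr)) ((norm_mul_le _ _).trans ?_))) ?_)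
          · rw [Matrix.frobenius_norm_conjTranspose]
            gcongr
          · refine (norm_mul_le _ _).trans ?_
            rw [Matrix.frobenius_norm_conjTranspose]
            gcongr
            exact (norm_mul_le _ _).trans (by gcongr)
      _ = (2 * c * ‖P‖ + (L + c) * ‖P‖ * (L + c)) * ε ^ 2 := by
          rw [← sq_abs ε]; ring
      _ ≤ _ := by
          gcongr
          have : 0 ≤ 2 * L * ‖P‖ := by positivity
          linarith

end ExpI

/-! ### Second-order expansion of the correction -/

section Expansion

variable {X : Type*} [Fintype X] [DecidableEq X]

/-- Second-order expansion of the entropy along a perturbation `ε δ + O(ε²)`. -/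
theorem exists_entropy_expansion {a : X → ℝ} (ha : ∀ i, 0 < a i) {C : ℝ} (hC : 0 ≤ C) :
    ∃ C' : ℝ, 0 ≤ C' ∧ ∃ ε₀ > 0, ∀ ε : ℝ, |ε| ≤ 1 → |ε| < ε₀ → ∀ Δ δ : Matrix X X ℂ,
      Δ.IsHermitian → (∀ i j, ‖δ i j‖ ≤ C) → (∀ i j, ‖(Δ - (ε : ℂ) • δ) i j‖ ≤ C * ε ^ 2) →
      |entropy (Matrix.diagonal (fun i => (a i : ℂ)) + Δ)
        - (∑ i, Real.negMulLog (a i) + ∑ i, (-Real.log (a i) - 1) * (Δ i i).re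
          - ε ^ 2 / 2 * ∑ i, ∑ j, logSlope (a i) (a j) * ‖δ i j‖ ^ 2)| ≤ C' * |ε| ^ 3 := by
  -- The least eigenvalue serves as m; over an empty index type any positive number does.
  obtain ⟨m, hm, hma⟩ : ∃ m : ℝ, 0 < m ∧ ∀ i, m ≤ a i := by
    rcases isEmpty_or_nonempty X with h | h
    · exact ⟨1, one_pos, fun i => (h.false i).elim⟩
    · obtain ⟨i₀, hi₀⟩ := Finite.exists_min a
      exact ⟨a i₀, ha i₀, hi₀⟩
  set N : ℝ := (Fintype.card X : ℝ) with hN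
  have hN0 : 0 ≤ N := Nat.cast_nonneg _
  set T : ℝ := ∑ i, ∑ j, |logSlope (a i) (a j)| with hT
  have hT0 : 0 ≤ T := Finset.sum_nonneg fun _ _ => Finset.sum_nonneg fun _ _ => abs_nonneg _
  -- The entries of Δ are at most 2C|ε|. This yields the cubic remainder and, through ε₀, the
  -- smallness condition of `entropy_taylor`; the 1 in the denominator of ε₀ guards against C = 0.
  -- The last summand of the constant pays for replacing Δ by εδ in the quadratic term.
  refine ⟨4 * N ^ 5 / m ^ 2 * (2 * C) ^ 3 + 1 / 2 * (T * (3 * C ^ 2)), by positivity,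
    m / (2 * N ^ 2 * (2 * C) + 1), by positivity, fun ε hε1 hε Δ δ hΔ hδ hΔδ => ?_⟩
  have hε2 : ε ^ 2 ≤ |ε| := by
    rw [← sq_abs, sq]; exact mul_le_of_le_one_left (abs_nonneg _) hε1
  have hεδ : ∀ i j, ‖((ε : ℂ) • δ) i j‖ ≤ C * |ε| := fun i j => by
    rw [Matrix.smul_apply, smul_eq_mul, norm_mul, Complex.norm_real, Real.norm_eq_abs, mul_comm]
    gcongr
    exact hδ i j
  have hbd : ∀ i j, ‖Δ i j‖ ≤ 2 * C * |ε| := fun i j => by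
    have e : Δ i j = (Δ - (ε : ℂ) • δ) i j + ((ε : ℂ) • δ) i j := by simp
    rw [e]
    refine (norm_add_le _ _).trans ((add_le_add (hΔδ i j) (hεδ i j)).trans ?_)
    nlinarith [mul_le_mul_of_nonneg_left hε2 hC]
  have hsmall : 2 * N ^ 2 * (2 * C * |ε|) ≤ m := by
    rw [lt_div_iff₀ (by positivity)] at hε
    nlinarith [abs_nonneg ε]
  have h1 := entropy_taylor hm hma hΔ (by positivity) hbd hsmall
  have h2 : |∑ i, ∑ j, logSlope (a i) (a j) * ‖Δ i j‖ ^ 2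
      - ε ^ 2 * ∑ i, ∑ j, logSlope (a i) (a j) * ‖δ i j‖ ^ 2| ≤ T * (3 * C ^ 2) * |ε| ^ 3 := by
    rw [Finset.mul_sum, ← Finset.sum_sub_distrib, hT, Finset.sum_mul, Finset.sum_mul]
    refine (Finset.abs_sum_le_sum_abs _ _).trans (Finset.sum_le_sum fun i _ => ?_)
    rw [Finset.mul_sum, ← Finset.sum_sub_distrib, Finset.sum_mul, Finset.sum_mul]
    refine (Finset.abs_sum_le_sum_abs _ _).trans (Finset.sum_le_sum fun j _ => ?_)
    have e : logSlope (a i) (a j) * ‖Δ i j‖ ^ 2 - ε ^ 2 * (logSlope (a i) (a j) * ‖δ i j‖ ^ 2)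
        = logSlope (a i) (a j)
          * ((‖Δ i j‖ - ‖((ε : ℂ) • δ) i j‖) * (‖Δ i j‖ + ‖((ε : ℂ) • δ) i j‖)) := by
      rw [Matrix.smul_apply, smul_eq_mul, norm_mul, Complex.norm_real, Real.norm_eq_abs,
        ← sq_abs ε]
      ring
    rw [e, abs_mul, mul_assoc]
    gcongr
    rw [abs_mul]
    have h3 : |‖Δ i j‖ - ‖((ε : ℂ) • δ) i j‖| ≤ C * ε ^ 2 :=
      (abs_norm_sub_norm_le _ _).trans (hΔδ i j)
    have h4 : |‖Δ i j‖ + ‖((ε : ℂ) • δ) i j‖| ≤ 3 * C * |ε| := by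
      rw [abs_of_nonneg (by positivity)]
      linarith [hbd i j, hεδ i j]
    calc _ ≤ (C * ε ^ 2) * (3 * C * |ε|) := by gcongr
      _ = 3 * C ^ 2 * |ε| ^ 3 := by rw [← sq_abs ε]; ring
  have e : entropy (Matrix.diagonal (fun i => (a i : ℂ)) + Δ)
        - (∑ i, Real.negMulLog (a i) + ∑ i, (-Real.log (a i) - 1) * (Δ i i).re
          - ε ^ 2 / 2 * ∑ i, ∑ j, logSlope (a i) (a j) * ‖δ i j‖ ^ 2)
      = (entropy (Matrix.diagonal (fun i => (a i : ℂ)) + Δ)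
        - (∑ i, Real.negMulLog (a i) + ∑ i, (-Real.log (a i) - 1) * (Δ i i).re
          - 1 / 2 * ∑ i, ∑ j, logSlope (a i) (a j) * ‖Δ i j‖ ^ 2))
        - 1 / 2 * (∑ i, ∑ j, logSlope (a i) (a j) * ‖Δ i j‖ ^ 2
          - ε ^ 2 * ∑ i, ∑ j, logSlope (a i) (a j) * ‖δ i j‖ ^ 2) := by ring
  rw [e]
  refine (abs_sub _ _).trans ?_
  rw [abs_mul, abs_of_pos (by norm_num : (0 : ℝ) < 1 / 2)]
  calc _ ≤ 4 * N ^ 5 / m ^ 2 * (2 * C * |ε|) ^ 3 + 1 / 2 * (T * (3 * C ^ 2) * |ε| ^ 3) := by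
        gcongr
    _ = _ := by ring

variable {A₁ A₂ B : Type*} [Fintype A₁] [Fintype A₂] [Fintype B]
  [DecidableEq A₁] [DecidableEq A₂] [DecidableEq B]

/-- The state `diag(λ) ⊗ |χ⟩⟨χ|`. -/
noncomputable def productState (χ : A₂ × B → ℂ) (lam : A₁ → ℝ) :
    Matrix ((A₁ × A₂) × B) ((A₁ × A₂) × B) ℂ :=
  let V : Matrix ((A₁ × A₂) × B) A₁ ℂ := attach χ
  V * Matrix.diagonal (fun i => (lam i : ℂ)) * V.conjTranspose

/-- The reduced state on `A` after evolution with `exp (iεW)`. -/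
noncomputable def evolved (χ : A₂ × B → ℂ) (lam : A₁ → ℝ) (ε : ℝ)
    (W : Matrix ((A₁ × A₂) × B) ((A₁ × A₂) × B) ℂ) : Matrix (A₁ × A₂) (A₁ × A₂) ℂ :=
  traceRight (expI ε W * productState χ lam * (expI ε W).conjTranspose)

/-- The first-order change of the reduced state on `A`. -/
noncomputable def firstOrder (χ : A₂ × B → ℂ) (lam : A₁ → ℝ)
    (W : Matrix ((A₁ × A₂) × B) ((A₁ × A₂) × B) ℂ) : Matrix (A₁ × A₂) (A₁ × A₂) ℂ :=
  traceRight (Complex.I • (W * productState χ lam - productState χ lam * W))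

/-- Twice the second-order coefficient of the correction in the eigenbasis of the bulk state. -/
noncomputable def quadCoeff (χ : A₂ × B → ℂ) (lam : A₁ → ℝ)
    (W : Matrix ((A₁ × A₂) × B) ((A₁ × A₂) × B) ℂ) : ℝ :=
  ∑ x, ∑ y, (Fintype.card A₂ : ℝ) * logSlope (lam x.1) (lam y.1) * ‖firstOrder χ lam W x y‖ ^ 2
    - ∑ i, ∑ j, logSlope (lam i) (lam j) * ‖traceRight (firstOrder χ lam W) i j‖ ^ 2

omit [Fintype A₂] [Fintype B] [DecidableEq A₂] [DecidableEq B] in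
theorem productState_apply (χ : A₂ × B → ℂ) (lam : A₁ → ℝ) (x y : (A₁ × A₂) × B) :
    productState χ lam x y
      = if x.1.1 = y.1.1 then (lam x.1.1 : ℂ) * (χ (x.1.2, x.2) * star (χ (y.1.2, y.2))) else 0 := by
  simp only [productState, attach, Matrix.mul_apply, Matrix.conjTranspose_apply, Matrix.of_apply,
    ite_mul, zero_mul, Finset.sum_ite_eq, Finset.mem_univ, if_true,
    apply_ite star, star_zero, mul_ite, mul_zero]
  by_cases h : x.1.1 = y.1.1
  · simp only [h, if_true, Matrix.diagonal_apply_eq]; ring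
  · simp [h]

omit [Fintype A₂] [Fintype B] [DecidableEq A₂] [DecidableEq B] in
theorem isHermitian_productState (χ : A₂ × B → ℂ) (lam : A₁ → ℝ) :
    (productState χ lam).IsHermitian := by
  apply Matrix.isHermitian_mul_mul_conjTranspose
  rw [Matrix.isHermitian_diagonal_iff]
  intro i
  simp [IsSelfAdjoint]

variable {χ : A₂ × B → ℂ}

omit [DecidableEq B] in
theorem IsFlat.sum_mul_star (hχ : IsFlat χ) (a a' : A₂) :
    ∑ b, χ (a, b) * star (χ (a', b)) = if a = a' then (Fintype.card A₂ : ℂ)⁻¹ else 0 := by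
  have h := congrFun (congrFun hχ a) a'
  simpa [traceRight, pureState, Matrix.vecMulVec_apply, Matrix.one_apply] using h

omit [DecidableEq B] in
-- By flatness the reduced state on A is already diagonal and positive in the given basis, as the
-- entropy expansion requires, and its spectrum depends on the A₁ label only.
theorem traceRight_productState (hχ : IsFlat χ) (lam : A₁ → ℝ) :
    traceRight (productState χ lam)
      = Matrix.diagonal fun x : A₁ × A₂ => ((lam x.1 / Fintype.card A₂ : ℝ) : ℂ) := by
  ext x y
  simp only [traceRight, Matrix.of_apply, productState_apply, Matrix.diagonal_apply]
  by_cases h : x.1 = y.1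
  · simp only [h, if_true]
    rw [← Finset.mul_sum, hχ.sum_mul_star]
    by_cases h2 : x.2 = y.2
    · have : x = y := Prod.ext h h2
      simp [this, div_eq_mul_inv]
    · have : x ≠ y := fun h' => h2 (h' ▸ rfl)
      simp [h2, this]
  · have : x ≠ y := fun h' => h (h' ▸ rfl)
    simp [h, this]

omit [DecidableEq B] in
theorem traceRight_traceRight_productState [Nonempty A₂] (hχ : IsFlat χ) (lam : A₁ → ℝ) :
    traceRight (traceRight (productState χ lam)) = Matrix.diagonal fun i => (lam i : ℂ) := by
  rw [traceRight_productState hχ]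
  ext i j
  simp only [traceRight, Matrix.of_apply, Matrix.diagonal_apply, Prod.mk.injEq, and_true]
  have h0 : (Fintype.card A₂ : ℂ) ≠ 0 := Nat.cast_ne_zero.2 Fintype.card_ne_zero
  by_cases h : i = j
  · simp [h]
    field_simp
  · simp [h]

omit [DecidableEq B] in
theorem entropy_flat [Nonempty A₂] (hχ : IsFlat χ) :
    entropy (traceRight (pureState χ)) = Real.log (Fintype.card A₂) := by
  have h0 : (Fintype.card A₂ : ℝ) ≠ 0 := Nat.cast_ne_zero.2 Fintype.card_ne_zero
  have e : traceRight (pureState χ)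
      = Matrix.diagonal fun _ => (((Fintype.card A₂ : ℝ)⁻¹ : ℝ) : ℂ) := by
    rw [hχ, Matrix.smul_one_eq_diagonal]
    push_cast
    rfl
  rw [e, entropy_diagonal]
  simp only [Real.negMulLog, Finset.sum_const, Finset.card_univ, nsmul_eq_mul, Real.log_inv]
  field_simp

theorem isHermitian_evolved (χ : A₂ × B → ℂ) (lam : A₁ → ℝ) (ε : ℝ)
    (W : Matrix ((A₁ × A₂) × B) ((A₁ × A₂) × B) ℂ) : (evolved χ lam ε W).IsHermitian :=
  isHermitian_traceRight
    (Matrix.isHermitian_mul_mul_conjTranspose _ (isHermitian_productState χ lam))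

/-- Second-order expansion of the correction, uniform for bounded generators. -/
theorem exists_correction_expansion [Nonempty A₂] (hχ : IsFlat χ) {lam : A₁ → ℝ}
    (hlam : ∀ i, 0 < lam i) (hsum : ∑ i, lam i = 1) (K : ℝ) :
    ∃ C > 0, ∃ ε₀ > 0, ∀ ε : ℝ, |ε| < ε₀ →
      ∀ W : Matrix ((A₁ × A₂) × B) ((A₁ × A₂) × B) ℂ, W.IsHermitian →
        (W.conjTranspose * W).trace.re ≤ K ^ 2 →
        |Real.log (Fintype.card A₂) - entropy (evolved χ lam ε W)
          + entropy (traceRight (evolved χ lam ε W)) - ε ^ 2 / 2 * quadCoeff χ lam W|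
        ≤ C * |ε| ^ 3 := by
  set D : ℝ := (Fintype.card A₂ : ℝ) with hD
  have hD0 : 0 < D := by rw [hD]; exact_mod_cast Fintype.card_pos
  obtain ⟨C, hC, hbound⟩ := exists_conj_expI_bound (productState χ lam) K
  -- Each partial trace multiplies an entry bound by the dimension traced out: first B, then A₂.
  set C₁ : ℝ := Fintype.card B * C with hC₁
  have hC₁0 : 0 ≤ C₁ := by positivity
  set C₂ : ℝ := D * C₁ with hC₂
  have hC₂0 : 0 ≤ C₂ := by positivity
  have ha : ∀ x : A₁ × A₂, 0 < lam x.1 / D := fun x => div_pos (hlam x.1) hD0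
  obtain ⟨R₁, hR₁, ε₁, hε₁, hexp₁⟩ := exists_entropy_expansion ha hC₁0
  obtain ⟨R₂, hR₂, ε₂, hε₂, hexp₂⟩ := exists_entropy_expansion hlam hC₂0
  refine ⟨R₁ + R₂ + 1, by positivity, min 1 (min ε₁ ε₂), by positivity,
    fun ε hε W hW hK => ?_⟩
  have hε1 : |ε| ≤ 1 := (hε.trans_le (min_le_left _ _)).le
  have hεa : |ε| < ε₁ := hε.trans_le ((min_le_right _ _).trans (min_le_left _ _))
  have hεb : |ε| < ε₂ := hε.trans_le ((min_le_right _ _).trans (min_le_right _ _))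
  obtain ⟨hb1, hb2⟩ := hbound ε hε1 W hW hK
  set M := evolved χ lam ε W with hM
  set δ := firstOrder χ lam W with hδ
  set Δ := M - traceRight (productState χ lam) with hΔ
  have hMΔ : M = Matrix.diagonal (fun x : A₁ × A₂ => ((lam x.1 / D : ℝ) : ℂ)) + Δ := by
    rw [hΔ, traceRight_productState hχ]; abel
  have hNΔ : traceRight M = Matrix.diagonal (fun i => (lam i : ℂ)) + traceRight Δ := by
    rw [hΔ, traceRight_sub, traceRight_traceRight_productState hχ]; abel
  have hΔH : Δ.IsHermitian := (isHermitian_evolved χ lam ε W).sub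
    (isHermitian_traceRight (isHermitian_productState χ lam))
  have hΔδ : Δ - (ε : ℂ) • δ = traceRight (expI ε W * productState χ lam
      * (expI ε W).conjTranspose - productState χ lam
      - (ε : ℂ) • (Complex.I • (W * productState χ lam - productState χ lam * W))) := by
    rw [traceRight_sub, traceRight_sub, traceRight_smul]; rfl
  have hd1 : ∀ i j, ‖δ i j‖ ≤ C₁ := norm_traceRight_le hb1
  have hd2 : ∀ i j, ‖(Δ - (ε : ℂ) • δ) i j‖ ≤ C₁ * ε ^ 2 := fun i j => by
    rw [hΔδ]
    exact (norm_traceRight_le hb2 i j).trans_eq (by rw [hC₁]; ring)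
  have h1 := hexp₁ ε hε1 hεa Δ δ hΔH hd1 hd2
  have h2 := hexp₂ ε hε1 hεb (traceRight Δ) (traceRight δ) (isHermitian_traceRight hΔH)
    (norm_traceRight_le hd1) (fun i j => by
      rw [← traceRight_smul, ← traceRight_sub]
      exact (norm_traceRight_le hd2 i j).trans_eq (by rw [hC₂]; ring))
  rw [← hMΔ] at h1
  rw [← hNΔ] at h2
  -- the zeroth-order terms
  have e0 : ∑ x : A₁ × A₂, Real.negMulLog (lam x.1 / D)
      = ∑ i, Real.negMulLog (lam i) + Real.log D := by
    have : ∀ i, D * Real.negMulLog (lam i / D) = Real.negMulLog (lam i) + lam i * Real.log D :=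
      fun i => by
        rw [Real.negMulLog, Real.log_div (hlam i).ne' hD0.ne', Real.negMulLog]
        field_simp
        ring
    simp only [Fintype.sum_prod_type, Finset.sum_const, Finset.card_univ, nsmul_eq_mul, ← hD, this,
      Finset.sum_add_distrib, ← Finset.sum_mul, hsum, one_mul]
  -- the first-order terms
  have htr : ∑ i, (traceRight Δ i i).re = 0 := by
    have hEE : (expI ε W).conjTranspose * expI ε W = 1 :=
      Matrix.mem_unitaryGroup_iff'.1 (expI_mem_unitaryGroup hW ε)
    have : (traceRight Δ).trace = 0 := by
      rw [trace_traceRight, hΔ, hM, evolved, Matrix.trace_sub, trace_traceRight, trace_traceRight,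
        Matrix.trace_mul_comm, ← mul_assoc, hEE, one_mul, sub_self]
    rw [← Complex.re_sum]
    change (traceRight Δ).trace.re = 0
    rw [this, Complex.zero_re]
  -- The logarithm of λ_i/d_χ splits into a function of the A₁ label, which sees only Tr_{A₂} Δ, and
  -- a constant, which multiplies the trace of Δ, namely zero. The linear terms thus agree exactly,
  -- so the second-order part of Δ is never needed.
  have e1 : ∑ x : A₁ × A₂, (-Real.log (lam x.1 / D) - 1) * (Δ x x).re
      = ∑ i, (-Real.log (lam i) - 1) * (traceRight Δ i i).re := by
    have : ∀ i, (-Real.log (lam i) - 1) * (traceRight Δ i i).re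
        + Real.log D * (traceRight Δ i i).re
        = ∑ a, (-Real.log (lam i / D) - 1) * (Δ (i, a) (i, a)).re := fun i => by
      rw [Real.log_div (hlam i).ne' hD0.ne', ← Finset.mul_sum, ← Complex.re_sum]
      change _ = _ * (traceRight Δ i i).re
      ring
    rw [Fintype.sum_prod_type, ← Finset.sum_congr rfl fun i _ => this i, Finset.sum_add_distrib,
      ← Finset.mul_sum Finset.univ _ (Real.log D), htr, mul_zero, add_zero]
  -- the second-order terms
  have e2 : ∀ x y : A₁ × A₂, logSlope (lam x.1 / D) (lam y.1 / D)
      = D * logSlope (lam x.1) (lam y.1) := fun x y => by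
    rw [← logSlope_mul (inv_pos.2 hD0) (hlam x.1) (hlam y.1), inv_mul_eq_div, inv_mul_eq_div]
    field_simp
  rw [e0, e1] at h1
  simp only [e2] at h1
  have e3 : Real.log D - entropy M + entropy (traceRight M) - ε ^ 2 / 2 * quadCoeff χ lam W
      = (entropy (traceRight M) - (∑ i, Real.negMulLog (lam i)
          + ∑ i, (-Real.log (lam i) - 1) * (traceRight Δ i i).re
          - ε ^ 2 / 2 * ∑ i, ∑ j, logSlope (lam i) (lam j) * ‖traceRight δ i j‖ ^ 2))
        - (entropy M - (∑ i, Real.negMulLog (lam i) + Real.log D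
          + ∑ i, (-Real.log (lam i) - 1) * (traceRight Δ i i).re
          - ε ^ 2 / 2 * ∑ x, ∑ y, D * logSlope (lam x.1) (lam y.1) * ‖δ x y‖ ^ 2)) := by
    rw [quadCoeff]; ring
  rw [e3]
  refine (abs_sub _ _).trans ((add_le_add h2 h1).trans ?_)
  have : 0 ≤ |ε| ^ 3 := by positivity
  linarith

end Expansion

/-! ### The Haar average of the second-order coefficient -/

section Average

variable {A₁ A₂ B : Type*} [Fintype A₁] [Fintype A₂] [Fintype B]
  [DecidableEq A₁] [DecidableEq A₂] [DecidableEq B]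

/-- A bulk unitary acting on the boundary as `U ⊗ 1 ⊗ 1`. -/
def bulkUnitary (A₂ B : Type*) [Fintype A₂] [Fintype B] [DecidableEq A₂] [DecidableEq B]
    (U : Matrix.unitaryGroup A₁ ℂ) : Matrix.unitaryGroup ((A₁ × A₂) × B) ℂ :=
  ⟨(U.1 ⊗ₖ (1 : Matrix A₂ A₂ ℂ)) ⊗ₖ (1 : Matrix B B ℂ),
    kronecker_mem_unitaryGroup (kronecker_mem_unitaryGroup U.2 (one_mem _)) (one_mem _)⟩

/-- The block of an operator on `A₁ ⊗ A₂` between two basis vectors of `A₂`. -/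
def block (M : Matrix (A₁ × A₂) (A₁ × A₂) ℂ) (a b : A₂) : Matrix A₁ A₁ ℂ :=
  Matrix.of fun i j => M (i, a) (j, b)

theorem traceRight_corotate (U : Matrix.unitaryGroup A₁ ℂ)
    (P : Matrix ((A₁ × A₂) × B) ((A₁ × A₂) × B) ℂ) :
    traceRight (corotate P (bulkUnitary A₂ B U).1)
      = corotate (traceRight P) (U.1 ⊗ₖ (1 : Matrix A₂ A₂ ℂ)) := by
  have h := traceRight_conj (U.1 ⊗ₖ (1 : Matrix A₂ A₂ ℂ)).conjTranspose
    (one_mem (Matrix.unitaryGroup B ℂ)) P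
  rw [Matrix.conjTranspose_conjTranspose] at h
  rw [corotate, corotate, ← h]
  simp only [bulkUnitary, Matrix.conjTranspose_kronecker, Matrix.conjTranspose_one,
    Matrix.conjTranspose_conjTranspose]

theorem traceRight_corotate_kronecker (U : Matrix.unitaryGroup A₁ ℂ)
    (M : Matrix (A₁ × A₂) (A₁ × A₂) ℂ) :
    traceRight (corotate M (U.1 ⊗ₖ (1 : Matrix A₂ A₂ ℂ))) = corotate (traceRight M) U.1 := by
  have h := traceRight_conj U.1.conjTranspose (one_mem (Matrix.unitaryGroup A₂ ℂ)) M
  rw [Matrix.conjTranspose_conjTranspose] at h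
  rw [corotate, corotate, ← h]
  simp only [Matrix.conjTranspose_kronecker, Matrix.conjTranspose_one,
    Matrix.conjTranspose_conjTranspose]

omit [DecidableEq A₁] in
theorem corotate_kronecker_apply (U : Matrix A₁ A₁ ℂ)
    (M : Matrix (A₁ × A₂) (A₁ × A₂) ℂ) (i j : A₁) (a b : A₂) :
    corotate M (U ⊗ₖ (1 : Matrix A₂ A₂ ℂ)) (i, a) (j, b) = corotate (block M a b) U i j := by
  simp only [corotate, block, Matrix.mul_apply, Matrix.conjTranspose_apply, Matrix.of_apply,
    Fintype.sum_prod_type, Matrix.kronecker_apply, Matrix.one_apply, mul_ite, mul_one, mul_zero,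
    apply_ite star, star_zero, ite_mul, zero_mul, Finset.sum_ite_eq', Finset.mem_univ, if_true]

variable (χ : A₂ × B → ℂ) (W : Matrix ((A₁ × A₂) × B) ((A₁ × A₂) × B) ℂ)

theorem kronecker_mul_attach (M : Matrix A₁ A₁ ℂ) :
    ((M ⊗ₖ (1 : Matrix A₂ A₂ ℂ)) ⊗ₖ (1 : Matrix B B ℂ)) * attach (A₁ := A₁) χ
      = attach (A₁ := A₁) χ * M := by
  ext ⟨⟨i, a⟩, b⟩ k
  rw [Matrix.mul_apply, Matrix.mul_apply, Fintype.sum_prod_type, Finset.sum_comm,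
    Finset.sum_eq_single b (fun b' _ hb => Finset.sum_eq_zero fun x _ => by
      simp [Matrix.one_apply_ne (Ne.symm hb)]) (by simp),
    Fintype.sum_prod_type, Finset.sum_comm,
    Finset.sum_eq_single a (fun a' _ ha => Finset.sum_eq_zero fun x _ => by
      simp [Matrix.one_apply_ne (Ne.symm ha)]) (by simp)]
  simp [attach, mul_comm]

omit [Fintype A₂] [Fintype B] [DecidableEq A₂] [DecidableEq B] in
theorem chiOp_eq_attach_mul :
    chiOp χ = attach (A₁ := A₁) χ * (attach (A₁ := A₁) χ).conjTranspose := by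
  ext x y
  simp only [chiOp, attach, pureState, Matrix.mul_apply, Matrix.conjTranspose_apply,
    Matrix.of_apply, Matrix.vecMulVec_apply, Pi.star_apply, ite_mul, zero_mul, Finset.sum_ite_eq,
    Finset.mem_univ, if_true, apply_ite star, star_zero, mul_ite, mul_zero]

/-- Follows from the intertwining relation for `attach` and its adjoint. It is the reason why J and
D rotate covariantly with the bulk. -/
theorem chiOp_kronecker_comm (M : Matrix A₁ A₁ ℂ) :
    ((M ⊗ₖ (1 : Matrix A₂ A₂ ℂ)) ⊗ₖ (1 : Matrix B B ℂ)) * chiOp χ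
      = chiOp χ * ((M ⊗ₖ (1 : Matrix A₂ A₂ ℂ)) ⊗ₖ (1 : Matrix B B ℂ)) := by
  have h := congrArg Matrix.conjTranspose (kronecker_mul_attach χ M.conjTranspose)
  simp only [Matrix.conjTranspose_mul, Matrix.conjTranspose_kronecker, Matrix.conjTranspose_one,
    Matrix.conjTranspose_conjTranspose] at h
  rw [chiOp_eq_attach_mul, ← Matrix.mul_assoc, kronecker_mul_attach, Matrix.mul_assoc,
    Matrix.mul_assoc, h]

theorem corotate_chiOp (U : Matrix.unitaryGroup A₁ ℂ) :
    corotate (chiOp χ) (bulkUnitary A₂ B U).1 = chiOp χ := by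
  rw [corotate, mul_assoc]
  have h : chiOp χ * (bulkUnitary A₂ B U).1 = (bulkUnitary A₂ B U).1 * chiOp χ :=
    (chiOp_kronecker_comm χ U.1).symm
  rw [h, ← mul_assoc, ← Matrix.star_eq_conjTranspose,
    Matrix.mem_unitaryGroup_iff'.1 (bulkUnitary A₂ B U).2, one_mul]

theorem corotate_mul_corotate {X : Type*} [Fintype X] [DecidableEq X] (M M' : Matrix X X ℂ)
    (U : Matrix.unitaryGroup X ℂ) :
    corotate M U.1 * corotate M' U.1 = corotate (M * M') U.1 := by
  simp only [corotate]
  calc _ = U.1.conjTranspose * M * (U.1 * U.1.conjTranspose) * M' * U.1 := by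
        simp only [mul_assoc]
    _ = _ := by
        rw [← Matrix.star_eq_conjTranspose, Matrix.mem_unitaryGroup_iff.1 U.2, mul_one]
        simp only [mul_assoc]

theorem corotate_add {X : Type*} [Fintype X] (M M' U : Matrix X X ℂ) :
    corotate (M + M') U = corotate M U + corotate M' U := by
  simp only [corotate, mul_add, add_mul]

theorem corotate_sub {X : Type*} [Fintype X] (M M' U : Matrix X X ℂ) :
    corotate (M - M') U = corotate M U - corotate M' U := by
  simp only [corotate, mul_sub, sub_mul]

theorem corotate_smul {X : Type*} [Fintype X] (c : ℂ) (M U : Matrix X X ℂ) :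
    corotate (c • M) U = c • corotate M U := by
  simp only [corotate, Matrix.mul_smul, Matrix.smul_mul]

theorem opJ_corotate (U : Matrix.unitaryGroup A₁ ℂ) :
    opJ χ (corotate W (bulkUnitary A₂ B U).1)
      = corotate (opJ χ W) (U.1 ⊗ₖ (1 : Matrix A₂ A₂ ℂ)) := by
  have h := corotate_chiOp χ U
  conv_lhs => rw [opJ, ← h, corotate_mul_corotate, corotate_mul_corotate, ← corotate_add,
    traceRight_corotate, ← corotate_smul]
  rfl

theorem opD_corotate (U : Matrix.unitaryGroup A₁ ℂ) :
    opD χ (corotate W (bulkUnitary A₂ B U).1)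
      = corotate (opD χ W) (U.1 ⊗ₖ (1 : Matrix A₂ A₂ ℂ)) := by
  have h := corotate_chiOp χ U
  conv_lhs => rw [opD, ← h, corotate_mul_corotate, corotate_mul_corotate, ← corotate_sub,
    traceRight_corotate, ← corotate_smul]
  rfl

omit [DecidableEq A₂] [DecidableEq B] in
/-- `Tr_{A₂} D = 0`. -/
theorem traceRight_opD : traceRight (opD χ W) = 0 := by
  rw [opD, traceRight_smul, traceRight_sub, traceRight_sub]
  -- Cyclicity of the trace over A₂ ⊗ B, as an exchange of the two summation labels.
  have key : ∀ F : A₂ × B → A₂ × B → ℂ, ∑ a, ∑ b, ∑ a', ∑ b', F (a, b) (a', b')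
      = ∑ a, ∑ b, ∑ a', ∑ b', F (a', b') (a, b) := fun F => by
    calc _ = ∑ p, ∑ q, F p q := by simp only [Fintype.sum_prod_type]
      _ = ∑ p, ∑ q, F q p := Finset.sum_comm
      _ = _ := by simp only [Fintype.sum_prod_type]
  have : traceRight (traceRight (W * chiOp χ)) = traceRight (traceRight (chiOp χ * W)) := by
    ext i j
    simp only [traceRight, chiOp, Matrix.mul_apply, Matrix.of_apply, Fintype.sum_prod_type,
      mul_ite, mul_zero, ite_mul, zero_mul, Finset.sum_ite_irrel, Finset.sum_const_zero,
      Finset.sum_ite_eq, Finset.sum_ite_eq', Finset.mem_univ, if_true]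
    rw [key fun p q => W ((i, p.1), p.2) ((j, q.1), q.2) * pureState χ q p]
    simp only [mul_comm]
  rw [this, sub_self, smul_zero]

/-- The diagonal factor acts trivially on B, so the eigenvalues can be pulled out of the trace over
B on the right here, and on the left in the companion below. -/
theorem productState_eq_chiOp_mul (lam : A₁ → ℝ) :
    productState χ lam = chiOp χ
      * ((Matrix.diagonal fun x : A₁ × A₂ => (lam x.1 : ℂ)) ⊗ₖ (1 : Matrix B B ℂ)) := by
  ext x y
  rw [← Matrix.diagonal_one, Matrix.diagonal_kronecker_diagonal, Matrix.mul_diagonal,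
    productState_apply, chiOp, Matrix.of_apply, pureState, Matrix.vecMulVec_apply, Pi.star_apply]
  by_cases h : x.1.1 = y.1.1
  · simp only [h, if_true]; ring
  · simp [h]

theorem productState_eq_mul_chiOp (lam : A₁ → ℝ) :
    productState χ lam = ((Matrix.diagonal fun x : A₁ × A₂ => (lam x.1 : ℂ)) ⊗ₖ (1 : Matrix B B ℂ))
      * chiOp χ := by
  ext x y
  rw [← Matrix.diagonal_one, Matrix.diagonal_kronecker_diagonal, Matrix.diagonal_mul,
    productState_apply, chiOp, Matrix.of_apply, pureState, Matrix.vecMulVec_apply, Pi.star_apply]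
  by_cases h : x.1.1 = y.1.1
  · simp only [h, if_true]; ring
  · simp [h]

/-- The two halves of the commutator carry λ_y and λ_x respectively; resolving Wχ and χW into
anticommutator and commutator separates the difference of eigenvalues from their sum. -/
theorem firstOrder_apply [Nonempty A₂] (lam : A₁ → ℝ) (x y : A₁ × A₂) :
    firstOrder χ lam W x y = (2 * (Fintype.card A₂ : ℂ))⁻¹ *
      (Complex.I * opJ χ W x y * (lam y.1 - lam x.1) + opD χ W x y * (lam x.1 + lam y.1)) := by
  have h0 : (Fintype.card A₂ : ℂ) ≠ 0 := Nat.cast_ne_zero.2 Fintype.card_ne_zero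
  have h1 : traceRight (W * productState χ lam) x y = traceRight (W * chiOp χ) x y * lam y.1 := by
    rw [productState_eq_chiOp_mul, ← mul_assoc, traceRight_mul_kronecker_one,
      Matrix.mul_diagonal]
  have h2 : traceRight (productState χ lam * W) x y = lam x.1 * traceRight (chiOp χ * W) x y := by
    rw [productState_eq_mul_chiOp, mul_assoc, traceRight_kronecker_one_mul,
      Matrix.diagonal_mul]
  rw [firstOrder, traceRight_smul, traceRight_sub, Matrix.smul_apply, Matrix.sub_apply, h1, h2,
    opJ, opD, traceRight_add, traceRight_sub]
  simp only [Matrix.smul_apply, Matrix.add_apply, Matrix.sub_apply, smul_eq_mul]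
  field_simp
  ring

theorem norm_sq_combination (u v : ℂ) (r s : ℝ) :
    ‖Complex.I * u * (r : ℂ) + v * (s : ℂ)‖ ^ 2
      = r ^ 2 * ‖u‖ ^ 2 + s ^ 2 * ‖v‖ ^ 2 + 2 * (r * s) * (Complex.I * u * star v).re := by
  simp only [← Complex.normSq_eq_norm_sq, Complex.normSq_apply]
  simp
  ring

theorem norm_sq_firstOrder [Nonempty A₂] (lam : A₁ → ℝ) (x y : A₁ × A₂) :
    (Fintype.card A₂ : ℝ) ^ 2 * ‖firstOrder χ lam W x y‖ ^ 2 = 1 / 4 *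
      ((lam y.1 - lam x.1) ^ 2 * ‖opJ χ W x y‖ ^ 2 + (lam x.1 + lam y.1) ^ 2 * ‖opD χ W x y‖ ^ 2
        + 2 * ((lam y.1 - lam x.1) * (lam x.1 + lam y.1))
          * (Complex.I * opJ χ W x y * star (opD χ W x y)).re) := by
  have h0 : (Fintype.card A₂ : ℝ) ≠ 0 := Nat.cast_ne_zero.2 Fintype.card_ne_zero
  have h := norm_sq_combination (opJ χ W x y) (opD χ W x y) (lam y.1 - lam x.1)
    (lam x.1 + lam y.1)
  push_cast at h
  rw [firstOrder_apply, norm_mul, mul_pow, h, norm_inv, norm_mul, Complex.norm_natCast,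
    Complex.norm_ofNat]
  field_simp
  norm_num
  ring

/-- Only J appears, since Tr_{A₂} D = 0; this is why the subtracted A₁ entropy affects c₁ alone. -/
theorem norm_sq_traceRight_firstOrder [Nonempty A₂] (lam : A₁ → ℝ) (i j : A₁) :
    (Fintype.card A₂ : ℝ) ^ 2 * ‖traceRight (firstOrder χ lam W) i j‖ ^ 2 = 1 / 4 *
      ((lam j - lam i) ^ 2 * ‖traceRight (opJ χ W) i j‖ ^ 2) := by
  have h0 : (Fintype.card A₂ : ℝ) ≠ 0 := Nat.cast_ne_zero.2 Fintype.card_ne_zero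
  have hD : ∑ a, opD χ W (i, a) (j, a) = 0 := congrFun (congrFun (traceRight_opD χ W) i) j
  have h : traceRight (firstOrder χ lam W) i j = (2 * (Fintype.card A₂ : ℂ))⁻¹ *
      (Complex.I * traceRight (opJ χ W) i j * ((lam j - lam i : ℝ) : ℂ)) := by
    simp only [traceRight, Matrix.of_apply, firstOrder_apply]
    rw [← Finset.mul_sum, Finset.sum_add_distrib, ← Finset.sum_mul, ← Finset.sum_mul, hD, zero_mul,
      add_zero, ← Finset.mul_sum]
    push_cast
    rfl
  rw [h]
  simp only [norm_mul, norm_inv, mul_pow, Complex.norm_natCast, Complex.norm_ofNat, Complex.norm_I,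
    Complex.norm_real, Real.norm_eq_abs, sq_abs]
  field_simp
  norm_num
  ring

theorem quadCoeff_eq [Nonempty A₂] (lam : A₁ → ℝ) :
    quadCoeff χ lam W = ∑ i, ∑ j, logSlope (lam i) (lam j) *
      (1 / (4 * (Fintype.card A₂ : ℝ)) *
        ((lam i - lam j) ^ 2 * ∑ a, ∑ b, ‖opJ χ W (i, a) (j, b)‖ ^ 2
          + (lam i + lam j) ^ 2 * ∑ a, ∑ b, ‖opD χ W (i, a) (j, b)‖ ^ 2
          + 2 * ((lam j - lam i) * (lam i + lam j)) * ∑ a, ∑ b,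
            (Complex.I * opJ χ W (i, a) (j, b) * star (opD χ W (i, a) (j, b))).re)
        - 1 / (4 * (Fintype.card A₂ : ℝ) ^ 2) *
          ((lam i - lam j) ^ 2 * ‖traceRight (opJ χ W) i j‖ ^ 2)) := by
  have h0 : (Fintype.card A₂ : ℝ) ≠ 0 := Nat.cast_ne_zero.2 Fintype.card_ne_zero
  rw [quadCoeff, Fintype.sum_prod_type, ← Finset.sum_sub_distrib]
  refine Finset.sum_congr rfl fun i _ => ?_
  simp only [Fintype.sum_prod_type]
  rw [Finset.sum_comm, ← Finset.sum_sub_distrib]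
  refine Finset.sum_congr rfl fun j _ => ?_
  have h1 : ∀ a b, (Fintype.card A₂ : ℝ) * logSlope (lam i) (lam j)
      * ‖firstOrder χ lam W (i, a) (j, b)‖ ^ 2 = logSlope (lam i) (lam j)
        * (1 / (4 * (Fintype.card A₂ : ℝ))) *
        ((lam i - lam j) ^ 2 * ‖opJ χ W (i, a) (j, b)‖ ^ 2
          + (lam i + lam j) ^ 2 * ‖opD χ W (i, a) (j, b)‖ ^ 2
          + 2 * ((lam j - lam i) * (lam i + lam j))
            * (Complex.I * opJ χ W (i, a) (j, b) * star (opD χ W (i, a) (j, b))).re) :=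
      fun a b => by
    have h := norm_sq_firstOrder χ W lam (i, a) (j, b)
    simp only at h
    apply mul_left_cancel₀ h0
    calc _ = logSlope (lam i) (lam j)
          * ((Fintype.card A₂ : ℝ) ^ 2 * ‖firstOrder χ lam W (i, a) (j, b)‖ ^ 2) := by ring
      _ = _ := by
        rw [h]
        field_simp
        ring
  have h2 : ‖traceRight (firstOrder χ lam W) i j‖ ^ 2 = 1 / (4 * (Fintype.card A₂ : ℝ) ^ 2) *
      ((lam i - lam j) ^ 2 * ‖traceRight (opJ χ W) i j‖ ^ 2) := by
    have h := norm_sq_traceRight_firstOrder χ W lam i j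
    apply mul_left_cancel₀ (pow_ne_zero 2 h0)
    rw [h]
    field_simp
    ring
  simp only [h1]
  rw [h2, mul_sub]
  congr 1
  simp only [← Finset.mul_sum, Finset.sum_add_distrib]
  ring

end Average

section Average

variable {A₁ A₂ B : Type*} [Fintype A₁] [Fintype A₂] [Fintype B]
  [DecidableEq A₁] [DecidableEq A₂] [DecidableEq B]

/-! ### The coefficients as sums of squares -/

theorem trace_sq_eq_of_isHermitian {X : Type*} [Fintype X] {M : Matrix X X ℂ}
    (hM : M.IsHermitian) [DecidableEq X] : (M ^ 2).trace.re = ∑ x, ∑ y, ‖M x y‖ ^ 2 := by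
  have h := sum_norm_sq_eq_trace M
  rw [hM.eq, ← sq] at h
  rw [← h, Complex.ofReal_re]

theorem trace_pow_re_of_isHermitian {X : Type*} [Fintype X] {M : Matrix X X ℂ}
    (hM : M.IsHermitian) : (M.trace ^ 2).re = ‖M.trace‖ ^ 2 := by
  have h : star M.trace = M.trace := by
    rw [← Matrix.trace_conjTranspose, hM.eq]
  have h2 := Complex.mul_conj' M.trace
  rw [← Complex.star_def, h, ← sq] at h2
  rw [h2, ← Complex.ofReal_pow, Complex.ofReal_re]

theorem isHermitian_traceLeft {X Y : Type*} [Fintype X]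
    {P : Matrix (X × Y) (X × Y) ℂ} (h : P.IsHermitian) : (traceLeft P).IsHermitian := by
  ext y y'
  simp only [traceLeft, Matrix.conjTranspose_apply, Matrix.of_apply, star_sum]
  exact Finset.sum_congr rfl fun x _ => h.apply _ _

variable (χ : A₂ × B → ℂ) {W : Matrix ((A₁ × A₂) × B) ((A₁ × A₂) × B) ℂ}

omit [Fintype A₂] [Fintype B] [DecidableEq A₂] [DecidableEq B] in
theorem isHermitian_chiOp : (chiOp (A₁ := A₁) χ).IsHermitian := by
  rw [chiOp_eq_attach_mul]
  exact Matrix.isHermitian_mul_conjTranspose_self _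

omit [DecidableEq A₂] [DecidableEq B] in
theorem isHermitian_opJ (hW : W.IsHermitian) : (opJ χ W).IsHermitian := by
  have h : (W * chiOp χ + chiOp χ * W).IsHermitian := by
    rw [Matrix.IsHermitian, Matrix.conjTranspose_add, Matrix.conjTranspose_mul,
      Matrix.conjTranspose_mul, hW.eq, (isHermitian_chiOp χ).eq, add_comm]
  rw [opJ, Matrix.IsHermitian, Matrix.conjTranspose_smul, (isHermitian_traceRight h).eq]
  simp

omit [DecidableEq A₂] [DecidableEq B] in
theorem isHermitian_opD (hW : W.IsHermitian) : (opD χ W).IsHermitian := by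
  have h : (traceRight (W * chiOp χ - chiOp χ * W)).conjTranspose
      = -traceRight (W * chiOp χ - chiOp χ * W) := by
    have h1 : (Complex.I • (W * chiOp χ - chiOp χ * W)).IsHermitian := by
      rw [Matrix.IsHermitian, Matrix.conjTranspose_smul, Matrix.conjTranspose_sub,
        Matrix.conjTranspose_mul, Matrix.conjTranspose_mul, hW.eq, (isHermitian_chiOp χ).eq,
        ← neg_sub, smul_neg]
      simp
    have h2 := (isHermitian_traceRight h1).eq
    rw [traceRight_smul, Matrix.conjTranspose_smul] at h2
    have h3 := congrArg (fun M => Complex.I • M) h2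
    simp only [smul_smul] at h3
    simpa using h3
  rw [opD, Matrix.IsHermitian, Matrix.conjTranspose_smul, h]
  simp

omit [DecidableEq B] in
theorem coeff₁_eq (hW : W.IsHermitian) :
    coeff₁ χ W = (Fintype.card A₁ : ℝ) / (2 * Fintype.card A₂ * ((Fintype.card A₁ : ℝ) ^ 2 - 1)) *
      (∑ x, ∑ y, ‖opJ χ W x y‖ ^ 2
        - 1 / (Fintype.card A₁ : ℝ) * ∑ a, ∑ b, ‖traceLeft (opJ χ W) a b‖ ^ 2
        - 1 / (Fintype.card A₂ : ℝ) * ∑ i, ∑ j, ‖traceRight (opJ χ W) i j‖ ^ 2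
        + 1 / ((Fintype.card A₁ : ℝ) * Fintype.card A₂) * ‖(opJ χ W).trace‖ ^ 2) := by
  have h := isHermitian_opJ χ hW
  rw [coeff₁]
  rw [trace_sq_eq_of_isHermitian h, trace_sq_eq_of_isHermitian (isHermitian_traceLeft h),
    trace_sq_eq_of_isHermitian (isHermitian_traceRight h), trace_pow_re_of_isHermitian h]

omit [DecidableEq B] in
theorem coeff₂_eq (hW : W.IsHermitian) :
    coeff₂ χ W = (Fintype.card A₁ : ℝ) / (2 * Fintype.card A₂ * ((Fintype.card A₁ : ℝ) ^ 2 - 1)) *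
      (∑ x, ∑ y, ‖opD χ W x y‖ ^ 2
        - 1 / (Fintype.card A₁ : ℝ) * ∑ a, ∑ b, ‖traceLeft (opD χ W) a b‖ ^ 2) := by
  have h := isHermitian_opD χ hW
  rw [coeff₂]
  rw [trace_sq_eq_of_isHermitian h, trace_sq_eq_of_isHermitian (isHermitian_traceLeft h)]

omit [DecidableEq B] in
-- After c₂ is inserted the Tr_{A₁} D terms cancel and a factor d² − 1 divides out, so the sign
-- becomes evident.
theorem coeff₃_eq [Nonempty A₂] (hd : 2 ≤ Fintype.card A₁) (hW : W.IsHermitian) :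
    coeff₃ χ W = 1 / ((Fintype.card A₁ : ℝ) * Fintype.card A₂) *
      ∑ x, ∑ y, ‖opD χ W x y‖ ^ 2 := by
  have h := isHermitian_opD χ hW
  have h0 : (Fintype.card A₂ : ℝ) ≠ 0 := Nat.cast_ne_zero.2 Fintype.card_ne_zero
  have hd2 : (2 : ℝ) ≤ Fintype.card A₁ := by exact_mod_cast hd
  have h1 : (Fintype.card A₁ : ℝ) ≠ 0 := by linarith
  have h2 : (Fintype.card A₁ : ℝ) ^ 2 - 1 ≠ 0 := by nlinarith
  rw [coeff₃, coeff₂_eq χ hW]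
  rw [trace_sq_eq_of_isHermitian h, trace_sq_eq_of_isHermitian (isHermitian_traceLeft h)]
  field_simp
  ring

theorem norm_sum_sq_le {ι : Type*} [Fintype ι] (f : ι → ℂ) :
    ‖∑ i, f i‖ ^ 2 ≤ Fintype.card ι * ∑ i, ‖f i‖ ^ 2 := by
  calc ‖∑ i, f i‖ ^ 2 ≤ (∑ i, ‖f i‖) ^ 2 := by gcongr; exact norm_sum_le _ _
    _ ≤ _ := by simpa using sq_sum_le_card_mul_sum_sq (s := Finset.univ) (f := fun i => ‖f i‖)

omit [DecidableEq A₁] [DecidableEq A₂] in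
-- Cauchy–Schwarz on the d summands of each entry, after which the missing entries off the A₁
-- diagonal are added.
theorem sum_norm_sq_traceLeft_le (M : Matrix (A₁ × A₂) (A₁ × A₂) ℂ) :
    ∑ a, ∑ b, ‖traceLeft M a b‖ ^ 2 ≤ Fintype.card A₁ * ∑ x, ∑ y, ‖M x y‖ ^ 2 := by
  calc ∑ a, ∑ b, ‖traceLeft M a b‖ ^ 2
      ≤ ∑ a, ∑ b, Fintype.card A₁ * ∑ i, ‖M (i, a) (i, b)‖ ^ 2 :=
        Finset.sum_le_sum fun a _ => Finset.sum_le_sum fun b _ => norm_sum_sq_le _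
    _ ≤ ∑ a, ∑ b, Fintype.card A₁ * ∑ i, ∑ j, ‖M (i, a) (j, b)‖ ^ 2 := by
        gcongr with a _ b _ i _
        exact Finset.single_le_sum (f := fun j => ‖M (i, a) (j, b)‖ ^ 2)
          (fun _ _ => by positivity) (Finset.mem_univ i)
    _ = _ := by
        simp only [← Finset.mul_sum, Fintype.sum_prod_type]
        congr 1
        calc _ = ∑ a, ∑ i, ∑ b, ∑ j, ‖M (i, a) (j, b)‖ ^ 2 :=
              Finset.sum_congr rfl fun a _ => Finset.sum_comm
          _ = ∑ i, ∑ a, ∑ b, ∑ j, ‖M (i, a) (j, b)‖ ^ 2 := Finset.sum_comm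
          _ = _ := Finset.sum_congr rfl fun i _ => Finset.sum_congr rfl fun a _ => Finset.sum_comm

omit [DecidableEq A₁] [DecidableEq A₂] in
theorem sum_norm_sq_traceRight_le (M : Matrix (A₁ × A₂) (A₁ × A₂) ℂ) :
    ∑ i, ∑ j, ‖traceRight M i j‖ ^ 2 ≤ Fintype.card A₂ * ∑ x, ∑ y, ‖M x y‖ ^ 2 := by
  calc ∑ i, ∑ j, ‖traceRight M i j‖ ^ 2
      ≤ ∑ i, ∑ j, Fintype.card A₂ * ∑ a, ‖M (i, a) (j, a)‖ ^ 2 :=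
        Finset.sum_le_sum fun a _ => Finset.sum_le_sum fun b _ => norm_sum_sq_le _
    _ ≤ ∑ i, ∑ j, Fintype.card A₂ * ∑ a, ∑ b, ‖M (i, a) (j, b)‖ ^ 2 := by
        gcongr with i _ j _ a _
        exact Finset.single_le_sum (f := fun b => ‖M (i, a) (j, b)‖ ^ 2)
          (fun _ _ => by positivity) (Finset.mem_univ a)
    _ = _ := by
        simp only [← Finset.mul_sum, Fintype.sum_prod_type]
        congr 1
        exact Finset.sum_congr rfl fun i _ => Finset.sum_comm

omit [DecidableEq A₂] in
/-- Subtracting the part proportional to the identity of `A₁`. -/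
theorem sum_norm_sq_sub_traceLeft (M : Matrix (A₁ × A₂) (A₁ × A₂) ℂ) [Nonempty A₁] :
    ∑ x, ∑ y, ‖(M - ((Fintype.card A₁ : ℂ)⁻¹) • ((1 : Matrix A₁ A₁ ℂ) ⊗ₖ traceLeft M)) x y‖ ^ 2
      = ∑ x, ∑ y, ‖M x y‖ ^ 2
        - 1 / (Fintype.card A₁ : ℝ) * ∑ a, ∑ b, ‖traceLeft M a b‖ ^ 2 := by
  have h0 : (Fintype.card A₁ : ℂ) ≠ 0 := Nat.cast_ne_zero.2 Fintype.card_ne_zero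
  have h0' : (Fintype.card A₁ : ℝ) ≠ 0 := Nat.cast_ne_zero.2 Fintype.card_ne_zero
  have reorder : ∀ F : A₁ × A₂ → A₁ × A₂ → ℝ,
      ∑ x, ∑ y, F x y = ∑ a, ∑ b, ∑ i, ∑ j, F (i, a) (j, b) := fun F => by
    simp only [Fintype.sum_prod_type]
    calc _ = ∑ i, ∑ a, ∑ b, ∑ j, F (i, a) (j, b) :=
          Finset.sum_congr rfl fun i _ => Finset.sum_congr rfl fun a _ => Finset.sum_comm
      _ = ∑ a, ∑ i, ∑ b, ∑ j, F (i, a) (j, b) := Finset.sum_comm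
      _ = _ := Finset.sum_congr rfl fun a _ => Finset.sum_comm
  rw [reorder, reorder, Finset.mul_sum, ← Finset.sum_sub_distrib]
  refine Finset.sum_congr rfl fun a _ => ?_
  rw [Finset.mul_sum, ← Finset.sum_sub_distrib]
  refine Finset.sum_congr rfl fun b _ => ?_
  set t := traceLeft M a b with ht
  have ht' : t = ∑ i, M (i, a) (i, b) := rfl
  have hpt : ∀ i j, ‖(M - ((Fintype.card A₁ : ℂ)⁻¹) • ((1 : Matrix A₁ A₁ ℂ) ⊗ₖ traceLeft M))
      (i, a) (j, b)‖ ^ 2 = ‖M (i, a) (j, b)‖ ^ 2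
        + if i = j then ‖t‖ ^ 2 / (Fintype.card A₁ : ℝ) ^ 2
          - 2 / (Fintype.card A₁ : ℝ) * (M (i, a) (i, b) * star t).re else 0 := fun i j => by
    rw [Matrix.sub_apply, Matrix.smul_apply, Matrix.kronecker_apply, Matrix.one_apply, ← ht]
    by_cases hij : i = j
    · subst hij
      simp only [if_true, one_mul, smul_eq_mul]
      have : (Fintype.card A₁ : ℂ)⁻¹ = (((Fintype.card A₁ : ℝ)⁻¹ : ℝ) : ℂ) := by push_cast; rfl
      rw [this]
      simp only [← Complex.normSq_eq_norm_sq, Complex.normSq_apply]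
      simp
      field_simp
      ring
    · simp [hij]
  simp only [hpt, Finset.sum_add_distrib, Finset.sum_ite_eq, Finset.mem_univ, if_true,
    Finset.sum_sub_distrib, ← Finset.mul_sum, Finset.sum_const, Finset.card_univ, nsmul_eq_mul]
  rw [← Complex.re_sum, ← Finset.sum_mul, ← ht', Complex.star_def, Complex.mul_conj',
    ← Complex.ofReal_pow, Complex.ofReal_re]
  field_simp
  ring

omit [DecidableEq B] in
-- Let J′ be J without its part 1 ⊗ Tr_{A₁} J / d. The bracket equals ‖J′‖² − ‖Tr_{A₂} J′‖² / d_χ,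
-- which is non-negative by Cauchy–Schwarz.
theorem coeff₁_nonneg [Nonempty A₂] (hd : 2 ≤ Fintype.card A₁) (hW : W.IsHermitian) :
    0 ≤ coeff₁ χ W := by
  have hd2 : (2 : ℝ) ≤ Fintype.card A₁ := by exact_mod_cast hd
  have h2 : 0 < (Fintype.card A₁ : ℝ) ^ 2 - 1 := by nlinarith
  have : Nonempty A₁ := Fintype.card_pos_iff.1 (by omega)
  have h0 : (0 : ℝ) < Fintype.card A₂ := by exact_mod_cast Fintype.card_pos
  rw [coeff₁_eq χ hW]
  refine mul_nonneg (by positivity) ?_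
  set J := opJ χ W
  set J' := J - ((Fintype.card A₁ : ℂ)⁻¹) • ((1 : Matrix A₁ A₁ ℂ) ⊗ₖ traceLeft J) with hJ'
  have e1 := sum_norm_sq_sub_traceLeft J
  rw [← hJ'] at e1
  have htr : (traceLeft J).trace = J.trace := by
    simp [traceLeft, Matrix.trace, Fintype.sum_prod_type]
    exact Finset.sum_comm
  have e2 : ∑ i, ∑ j, ‖traceRight J' i j‖ ^ 2 = ∑ i, ∑ j, ‖traceRight J i j‖ ^ 2
      - 1 / (Fintype.card A₁ : ℝ) * ‖J.trace‖ ^ 2 := by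
    have h1 : traceRight J' = traceRight J
        - ((Fintype.card A₁ : ℂ)⁻¹ * J.trace) • (1 : Matrix A₁ A₁ ℂ) := by
      rw [hJ', traceRight_sub, traceRight_smul, ← htr, ← smul_smul]
      congr 2
      ext i j
      simp only [traceRight, Matrix.trace, Matrix.of_apply, Matrix.kronecker_apply,
        Matrix.smul_apply, Matrix.diag, smul_eq_mul]
      rw [← Finset.mul_sum, mul_comm]
    -- A one-dimensional second factor turns the projection identity into the norm of the traceless
    -- part of Tr_{A₂} J.
    have h3 := sum_norm_sq_sub_traceLeft (A₂ := Unit)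
      (Matrix.of fun x y : A₁ × Unit => traceRight J x.1 y.1)
    have h4 : ∑ i, traceRight J i i = J.trace := trace_traceRight J
    simp only [Fintype.sum_prod_type, Finset.univ_unique, Finset.sum_singleton, Matrix.of_apply,
      Matrix.sub_apply, Matrix.smul_apply, Matrix.kronecker_apply, traceLeft, h4] at h3
    rw [← h3, h1]
    refine Finset.sum_congr rfl fun i _ => Finset.sum_congr rfl fun j _ => ?_
    simp only [Matrix.sub_apply, Matrix.smul_apply, smul_eq_mul]
    congr 3
    ring
  have e3 := sum_norm_sq_traceRight_le J'
  rw [e1, e2] at e3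
  have h1 : (Fintype.card A₁ : ℝ) ≠ 0 := by linarith
  have e4 := mul_le_mul_of_nonneg_left e3 (inv_nonneg.2 h0.le)
  rw [← mul_assoc, inv_mul_cancel₀ h0.ne', one_mul] at e4
  have e5 : (Fintype.card A₂ : ℝ)⁻¹ * (∑ i, ∑ j, ‖traceRight J i j‖ ^ 2
      - 1 / (Fintype.card A₁ : ℝ) * ‖J.trace‖ ^ 2) = 1 / (Fintype.card A₂ : ℝ)
        * ∑ i, ∑ j, ‖traceRight J i j‖ ^ 2
        - 1 / ((Fintype.card A₁ : ℝ) * Fintype.card A₂) * ‖J.trace‖ ^ 2 := by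
    field_simp
  linarith

omit [DecidableEq B] in
theorem coeff₂_nonneg [Nonempty A₂] (hd : 2 ≤ Fintype.card A₁) (hW : W.IsHermitian) :
    0 ≤ coeff₂ χ W := by
  have hd2 : (2 : ℝ) ≤ Fintype.card A₁ := by exact_mod_cast hd
  have h2 : 0 < (Fintype.card A₁ : ℝ) ^ 2 - 1 := by nlinarith
  rw [coeff₂_eq χ hW]
  refine mul_nonneg (by positivity) (sub_nonneg.2 ?_)
  rw [one_div_mul_eq_div, div_le_iff₀' (by linarith)]
  exact sum_norm_sq_traceLeft_le _

omit [DecidableEq B] in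
theorem coeff₃_nonneg [Nonempty A₂] (hd : 2 ≤ Fintype.card A₁) (hW : W.IsHermitian) :
    0 ≤ coeff₃ χ W := by
  rw [coeff₃_eq χ hd hW]
  positivity

end Average

/-! ### Haar integration of the second-order coefficient, block by block -/

section Average

variable {A₁ A₂ B : Type*} [Fintype A₁] [Fintype A₂] [Fintype B]
  [DecidableEq A₁] [DecidableEq A₂] [DecidableEq B]

omit [DecidableEq A₂] in
theorem continuous_sum_norm_sq_block (M : Matrix (A₁ × A₂) (A₁ × A₂) ℂ) (i j : A₁) :
    Continuous fun U : Matrix.unitaryGroup A₁ ℂ =>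
      ∑ a, ∑ b, ‖corotate (block M a b) U.1 i j‖ ^ 2 :=
  continuous_finsetSum _ fun a _ => continuous_finsetSum _ fun b _ =>
    (continuous_corotate_apply (block M a b) i j).norm.pow 2

omit [DecidableEq A₂] in
theorem continuous_sum_mixed_block (M M' : Matrix (A₁ × A₂) (A₁ × A₂) ℂ) (c : ℂ) (i j : A₁) :
    Continuous fun U : Matrix.unitaryGroup A₁ ℂ => ∑ a, ∑ b,
      (c * corotate (block M a b) U.1 i j * star (corotate (block M' a b) U.1 i j)).re :=
  continuous_finsetSum _ fun _ _ => continuous_finsetSum _ fun _ _ =>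
    Complex.continuous_re.comp ((continuous_const.mul (continuous_corotate_apply _ i j)).mul
      (continuous_corotate_apply _ i j).star)

omit [DecidableEq A₁] [DecidableEq A₂] in
theorem sum_norm_sq_block (M : Matrix (A₁ × A₂) (A₁ × A₂) ℂ) :
    ∑ a, ∑ b, ∑ i, ∑ j, ‖block M a b i j‖ ^ 2 = ∑ x, ∑ y, ‖M x y‖ ^ 2 := by
  simp only [Fintype.sum_prod_type, block, Matrix.of_apply]
  calc _ = ∑ a, ∑ i, ∑ b, ∑ j, ‖M (i, a) (j, b)‖ ^ 2 :=
        Finset.sum_congr rfl fun a _ => Finset.sum_comm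
    _ = ∑ i, ∑ a, ∑ b, ∑ j, ‖M (i, a) (j, b)‖ ^ 2 := Finset.sum_comm
    _ = _ := Finset.sum_congr rfl fun i _ => Finset.sum_congr rfl fun a _ => Finset.sum_comm

omit [DecidableEq A₂] in
/-- Second moments of all blocks of an operator on `A₁ ⊗ A₂`. -/
theorem haar_moments_block (M : Matrix (A₁ × A₂) (A₁ × A₂) ℂ) {i j : A₁} (h : i ≠ j) :
    (∫ U : Matrix.unitaryGroup A₁ ℂ, ∑ a, ∑ b, ‖corotate (block M a b) U.1 i j‖ ^ 2
        ∂(haarUnitary A₁)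
      = (∑ x, ∑ y, ‖M x y‖ ^ 2 - (∑ a, ∑ b, ‖traceLeft M a b‖ ^ 2) / (Fintype.card A₁ : ℝ))
        / ((Fintype.card A₁ : ℝ) ^ 2 - 1)) ∧
    (∫ U : Matrix.unitaryGroup A₁ ℂ, ∑ a, ∑ b, ‖corotate (block M a b) U.1 i i‖ ^ 2
        ∂(haarUnitary A₁)
      = (∑ x, ∑ y, ‖M x y‖ ^ 2 + ∑ a, ∑ b, ‖traceLeft M a b‖ ^ 2)
        / ((Fintype.card A₁ : ℝ) * ((Fintype.card A₁ : ℝ) + 1))) := by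
  have hint : ∀ (k l : A₁) (a b : A₂), Integrable (fun U : Matrix.unitaryGroup A₁ ℂ =>
      ‖corotate (block M a b) U.1 k l‖ ^ 2) (haarUnitary A₁) := fun k l a b =>
    integrable_of_continuous ((continuous_corotate_apply (block M a b) k l).norm.pow 2)
  have hsum : ∀ k l : A₁, ∫ U : Matrix.unitaryGroup A₁ ℂ,
      ∑ a, ∑ b, ‖corotate (block M a b) U.1 k l‖ ^ 2 ∂(haarUnitary A₁)
      = ∑ a, ∑ b, ∫ U : Matrix.unitaryGroup A₁ ℂ, ‖corotate (block M a b) U.1 k l‖ ^ 2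
        ∂(haarUnitary A₁) := fun k l => by
    rw [integral_finsetSum _ fun a _ => integrable_finsetSum _ fun b _ => hint k l a b]
    exact Finset.sum_congr rfl fun a _ => integral_finsetSum _ fun b _ => hint k l a b
  have htr : ∀ a b, (block M a b).trace = traceLeft M a b := fun a b => rfl
  constructor
  · simp only [hsum, (haar_moments _ h).1, htr, ← sum_norm_sq_block M, ← Finset.sum_div,
      Finset.sum_sub_distrib]
  · simp only [hsum, (haar_moments _ h).2, htr, ← sum_norm_sq_block M, ← Finset.sum_div,
      Finset.sum_add_distrib]

omit [DecidableEq A₁] in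
theorem sum_antisymm_eq_zero {F : A₁ → A₁ → ℝ} (h : ∀ i j, F i j = -F j i) :
    ∑ i, ∑ j, F i j = 0 := by
  have h1 : ∑ i, ∑ j, F i j = -∑ i, ∑ j, F i j := by
    conv_lhs => rw [Finset.sum_comm]
    simp only [← Finset.sum_neg_distrib]
    exact Finset.sum_congr rfl fun i _ => Finset.sum_congr rfl fun j _ => h j i
  linarith

omit [DecidableEq A₁] in
theorem integral_pair_form {T : Type*} [MeasurableSpace T] {μ : Measure T}
    {f g h k : A₁ → A₁ → T → ℝ} (hf : ∀ i j, Integrable (f i j) μ)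
    (hg : ∀ i j, Integrable (g i j) μ) (hh : ∀ i j, Integrable (h i j) μ)
    (hk : ∀ i j, Integrable (k i j) μ) (s x y z : A₁ → A₁ → ℝ) (c c' : ℝ) :
    ∫ t, ∑ i, ∑ j, s i j * (c * (x i j * f i j t + y i j * g i j t + z i j * h i j t)
        - c' * (x i j * k i j t)) ∂μ
      = ∑ i, ∑ j, s i j * (c * (x i j * ∫ t, f i j t ∂μ + y i j * ∫ t, g i j t ∂μ
        + z i j * ∫ t, h i j t ∂μ) - c' * (x i j * ∫ t, k i j t ∂μ)) := by
  have h1 : ∀ i j, Integrable (fun t => x i j * f i j t + y i j * g i j t) μ := fun i j =>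
    ((hf i j).const_mul _).add ((hg i j).const_mul _)
  have h2 : ∀ i j, Integrable (fun t => x i j * f i j t + y i j * g i j t + z i j * h i j t) μ :=
    fun i j => (h1 i j).add ((hh i j).const_mul _)
  have h3 : ∀ i j, Integrable (fun t => c' * (x i j * k i j t)) μ :=
    fun i j => ((hk i j).const_mul _).const_mul _
  have h4 : ∀ i j, Integrable (fun t => s i j * (c * (x i j * f i j t + y i j * g i j t
      + z i j * h i j t) - c' * (x i j * k i j t))) μ := fun i j =>
    (((h2 i j).const_mul _).sub (h3 i j)).const_mul _
  rw [integral_finsetSum _ fun i _ => integrable_finsetSum _ fun j _ => h4 i j]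
  refine Finset.sum_congr rfl fun i _ => ?_
  rw [integral_finsetSum _ fun j _ => h4 i j]
  refine Finset.sum_congr rfl fun j _ => ?_
  rw [integral_const_mul, integral_sub ((h2 i j).const_mul _) (h3 i j), integral_const_mul,
    integral_add (h1 i j) ((hh i j).const_mul _),
    integral_add ((hf i j).const_mul _) ((hg i j).const_mul _)]
  simp only [integral_const_mul]

variable (χ : A₂ × B → ℂ) (W : Matrix ((A₁ × A₂) × B) ((A₁ × A₂) × B) ℂ)

theorem quadCoeff_corotate [Nonempty A₂] (lam : A₁ → ℝ) (U : Matrix.unitaryGroup A₁ ℂ) :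
    quadCoeff χ lam (corotate W (bulkUnitary A₂ B U).1) = ∑ i, ∑ j, logSlope (lam i) (lam j) *
      (1 / (4 * (Fintype.card A₂ : ℝ)) *
        ((lam i - lam j) ^ 2 * ∑ a, ∑ b, ‖corotate (block (opJ χ W) a b) U.1 i j‖ ^ 2
          + (lam i + lam j) ^ 2 * ∑ a, ∑ b, ‖corotate (block (opD χ W) a b) U.1 i j‖ ^ 2
          + 2 * ((lam j - lam i) * (lam i + lam j)) * ∑ a, ∑ b,
            (Complex.I * corotate (block (opJ χ W) a b) U.1 i j
              * star (corotate (block (opD χ W) a b) U.1 i j)).re)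
        - 1 / (4 * (Fintype.card A₂ : ℝ) ^ 2) *
          ((lam i - lam j) ^ 2 * ‖corotate (traceRight (opJ χ W)) U.1 i j‖ ^ 2)) := by
  rw [quadCoeff_eq, opJ_corotate, opD_corotate, traceRight_corotate_kronecker]
  simp only [corotate_kronecker_apply]

theorem continuous_quadCoeff_corotate [Nonempty A₂] (lam : A₁ → ℝ) :
    Continuous fun U : Matrix.unitaryGroup A₁ ℂ =>
      quadCoeff χ lam (corotate W (bulkUnitary A₂ B U).1) := by
  simp only [quadCoeff_corotate]
  have h1 := continuous_sum_norm_sq_block (opJ χ W)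
  have h2 := continuous_sum_norm_sq_block (opD χ W)
  have h3 := continuous_sum_mixed_block (opJ χ W) (opD χ W) Complex.I
  have h4 := fun i j => (continuous_corotate_apply (traceRight (opJ χ W)) i j).norm.pow 2
  exact continuous_finsetSum _ fun i _ => continuous_finsetSum _ fun j _ =>
    continuous_const.mul ((continuous_const.mul (((continuous_const.mul (h1 i j)).add
      (continuous_const.mul (h2 i j))).add (continuous_const.mul (h3 i j)))).sub
        (continuous_const.mul (continuous_const.mul (h4 i j))))

variable {W}

/-- The Haar average of the second-order coefficient. -/
theorem integral_quadCoeff [Nonempty A₂] (hd : 2 ≤ Fintype.card A₁) (hW : W.IsHermitian)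
    {lam : A₁ → ℝ} (hlam : ∀ i, 0 < lam i) (hsum : ∑ i, lam i = 1) :
    ∫ U, quadCoeff χ lam (corotate W (bulkUnitary A₂ B U).1) ∂(haarUnitary A₁)
      = coeff₁ χ W * f₁ lam + coeff₂ χ W * f₂ lam + coeff₃ χ W := by
  simp only [quadCoeff_corotate]
  have hZ := continuous_sum_mixed_block (opJ χ W) (opD χ W) Complex.I
  have hT : ∀ i j, Integrable (fun U : Matrix.unitaryGroup A₁ ℂ =>
      ‖corotate (traceRight (opJ χ W)) U.1 i j‖ ^ 2) (haarUnitary A₁) := fun i j =>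
    integrable_of_continuous ((continuous_corotate_apply (traceRight (opJ χ W)) i j).norm.pow 2)
  rw [integral_pair_form
    (fun i j => integrable_of_continuous (continuous_sum_norm_sq_block (opJ χ W) i j))
    (fun i j => integrable_of_continuous (continuous_sum_norm_sq_block (opD χ W) i j))
    (fun i j => integrable_of_continuous (hZ i j))
    hT
    (fun i j => logSlope (lam i) (lam j)) (fun i j => (lam i - lam j) ^ 2)
    (fun i j => (lam i + lam j) ^ 2) (fun i j => 2 * ((lam j - lam i) * (lam i + lam j)))]
  have hne : ∀ i : A₁, ∃ j, i ≠ j := fun i => by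
    have : Nontrivial A₁ := Fintype.one_lt_card_iff_nontrivial.1 (by omega)
    obtain ⟨j, hj⟩ := exists_ne i
    exact ⟨j, hj.symm⟩
  set Z : A₁ → A₁ → ℝ := fun i j => ∫ U : Matrix.unitaryGroup A₁ ℂ, ∑ a, ∑ b,
      (Complex.I * corotate (block (opJ χ W) a b) U.1 i j
        * star (corotate (block (opD χ W) a b) U.1 i j)).re ∂(haarUnitary A₁) with hZdef
  -- Rotating by the transposition of i and j exchanges the two indices in both factors at once.
  have hZsymm : ∀ i j, Z i j = Z j i := fun i j => by
    have e : ∀ k l, Z k l = ∑ a, ∑ b, ∫ U : Matrix.unitaryGroup A₁ ℂ,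
        (Complex.I * corotate (block (opJ χ W) a b) U.1 k l
          * star (corotate (block (opD χ W) a b) U.1 k l)).re ∂(haarUnitary A₁) := fun k l => by
      have hi : ∀ a b, Integrable (fun U : Matrix.unitaryGroup A₁ ℂ =>
          (Complex.I * corotate (block (opJ χ W) a b) U.1 k l
            * star (corotate (block (opD χ W) a b) U.1 k l)).re) (haarUnitary A₁) := fun a b =>
        integrable_of_continuous (Complex.continuous_re.comp
          ((continuous_const.mul (continuous_corotate_apply _ k l)).mul
            (continuous_corotate_apply _ k l).star))
      rw [hZdef]
      dsimp only
      rw [integral_finsetSum _ fun a _ => integrable_finsetSum _ fun b _ => hi a b]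
      exact Finset.sum_congr rfl fun a _ => integral_finsetSum _ fun b _ => hi a b
    rw [e, e]
    exact Finset.sum_congr rfl fun a _ => Finset.sum_congr rfl fun b _ =>
      integral_mixed_swap _ _ _ _ _
  set d : ℝ := (Fintype.card A₁ : ℝ) with hd'
  set δ : ℝ := (Fintype.card A₂ : ℝ) with hδ
  set SJ := ∑ x, ∑ y, ‖opJ χ W x y‖ ^ 2 with hSJ
  set SJ₁ := ∑ a, ∑ b, ‖traceLeft (opJ χ W) a b‖ ^ 2 with hSJ₁
  set SJ₂ := ∑ i, ∑ j, ‖traceRight (opJ χ W) i j‖ ^ 2 with hSJ₂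
  set SD := ∑ x, ∑ y, ‖opD χ W x y‖ ^ 2 with hSD
  set SD₁ := ∑ a, ∑ b, ‖traceLeft (opD χ W) a b‖ ^ 2 with hSD₁
  set α := (SJ - SJ₁ / d) / (d ^ 2 - 1) with hα
  set α' := (SJ₂ - ‖(opJ χ W).trace‖ ^ 2 / d) / (d ^ 2 - 1) with hα'
  set β := (SD - SD₁ / d) / (d ^ 2 - 1) with hβ
  set γ := (SD + SD₁) / (d * (d + 1)) with hγ
  have hd2 : (2 : ℝ) ≤ d := by rw [hd']; exact_mod_cast hd
  have hδ0 : δ ≠ 0 := Nat.cast_ne_zero.2 Fintype.card_ne_zero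
  -- Off the diagonal, D enters with the moment β; on it, with γ. Writing β everywhere completes the
  -- sum to `pairSum` and leaves (γ − β)λ_i/δ on the diagonal. The J terms vanish there because λ_i
  -- − λ_i = 0.
  have hterm : ∀ i j, logSlope (lam i) (lam j) * (1 / (4 * δ) *
      ((lam i - lam j) ^ 2 * ∫ U : Matrix.unitaryGroup A₁ ℂ,
          ∑ a, ∑ b, ‖corotate (block (opJ χ W) a b) U.1 i j‖ ^ 2 ∂(haarUnitary A₁)
        + (lam i + lam j) ^ 2 * ∫ U : Matrix.unitaryGroup A₁ ℂ,
          ∑ a, ∑ b, ‖corotate (block (opD χ W) a b) U.1 i j‖ ^ 2 ∂(haarUnitary A₁)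
        + 2 * ((lam j - lam i) * (lam i + lam j)) * Z i j)
      - 1 / (4 * δ ^ 2) * ((lam i - lam j) ^ 2 * ∫ U : Matrix.unitaryGroup A₁ ℂ,
          ‖corotate (traceRight (opJ χ W)) U.1 i j‖ ^ 2 ∂(haarUnitary A₁)))
      = (1 / (4 * δ) * α - 1 / (4 * δ ^ 2) * α') * pairFn (-1) (lam i) (lam j)
        + 1 / (4 * δ) * β * pairFn 1 (lam i) (lam j)
        + (if i = j then 1 / δ * (γ - β) * lam i else 0)
        + 1 / (4 * δ) * (logSlope (lam i) (lam j)
          * (2 * ((lam j - lam i) * (lam i + lam j)) * Z i j)) := fun i j => by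
    by_cases hij : i = j
    · subst hij
      obtain ⟨k, hk⟩ := hne i
      have hs : logSlope (lam i) (lam i) = 1 / lam i := if_pos rfl
      have hl := (hlam i).ne'
      rw [(haar_moments_block (opD χ W) hk).2, ← hd', ← hSD, ← hSD₁, ← hγ, if_pos rfl, pairFn, pairFn, hs]
      field_simp
      ring
    · rw [(haar_moments_block (opJ χ W) hij).1, (haar_moments_block (opD χ W) hij).1,
        (haar_moments _ hij).1, trace_traceRight, if_neg hij, pairFn, pairFn]
      ring
  refine (Finset.sum_congr rfl fun i _ => Finset.sum_congr rfl fun j _ => hterm i j).trans ?_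
  simp only [Finset.sum_add_distrib, ← Finset.mul_sum, Finset.sum_ite_eq, Finset.mem_univ,
    if_true, hsum]
  -- The weight changes sign under i ↔ j while Z does not, so the interference of J and D averages
  -- out.
  have hanti : ∑ i, ∑ j, logSlope (lam i) (lam j)
      * (2 * ((lam j - lam i) * (lam i + lam j)) * Z i j) = 0 :=
    sum_antisymm_eq_zero fun i j => by rw [logSlope_comm (lam i), hZsymm i j]; ring
  have hd0 : d ≠ 0 := by linarith
  have e1 : ∑ i, ∑ j, pairFn (-1) (lam i) (lam j) = 2 * d * f₁ lam := by
    rw [f₁_eq_pairSum hlam, pairSum, ← hd']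
    field_simp
  have e2 : ∑ i, ∑ j, pairFn 1 (lam i) (lam j) = 2 * d * (f₂ lam + 2) := by
    rw [f₂_eq_pairSum hlam hsum, pairSum, ← hd']
    field_simp
    ring
  have hd1 : d ^ 2 - 1 ≠ 0 := by nlinarith
  have hd3 : d + 1 ≠ 0 := by linarith
  have hd4 : d - 1 ≠ 0 := by linarith
  have hd5 : d ^ 2 - 1 = (d - 1) * (d + 1) := by ring
  rw [hanti, e1, e2, coeff₁_eq χ hW, coeff₂_eq χ hW, coeff₃_eq χ hd hW, ← hd', ← hδ, ← hSJ, ← hSJ₁,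
    ← hSJ₂, ← hSD, ← hSD₁, hα, hα', hβ, hγ, hd5]
  field_simp
  ring

end Average

/-! ### The bulk state -/

section BulkState

variable {n : ℕ}

theorem sum_qubits_prod {R : Type*} [CommSemiring R] (F : Fin n → Fin 2 → R) :
    ∑ b : Qubits n, ∏ k, F k (b k) = ∏ k, ∑ i, F k i := by
  rw [Finset.prod_univ_sum, Fintype.piFinset_univ]

/-- The product of single-qubit unitaries. -/
def localUnitary (u : Fin n → Matrix.unitaryGroup (Fin 2) ℂ) :
    Matrix.unitaryGroup (Qubits n) ℂ :=
  ⟨Matrix.of fun x b => ∏ k, (u k).1 (x k) (b k), by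
    rw [Matrix.mem_unitaryGroup_iff']
    ext b b'
    have h : ∀ k, ∑ i, star ((u k).1 i (b k)) * (u k).1 i (b' k) = if b k = b' k then 1 else 0 :=
      fun k => by
        have := congrFun (congrFun (Matrix.mem_unitaryGroup_iff'.1 (u k).2) (b k)) (b' k)
        simpa [Matrix.mul_apply, Matrix.one_apply] using this
    simp only [Matrix.star_eq_conjTranspose, Matrix.mul_apply, Matrix.conjTranspose_apply,
      Matrix.of_apply, star_prod, ← Finset.prod_mul_distrib]
    rw [sum_qubits_prod fun k i => star ((u k).1 i (b k)) * (u k).1 i (b' k)]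
    simp only [h, Matrix.one_apply, funext_iff, Finset.prod_ite_zero, Finset.mem_univ, true_imp_iff,
      Finset.prod_const_one]⟩

theorem weight_nonneg {p : ℝ} (hp : 0 < p ∧ p < 1) (i : Fin 2) : 0 ≤ weight p i :=
  (weight_pos hp i).le

/-- Orthonormality of the reference bases removes the cross terms pair by pair, and the product of
single-qubit sums becomes a sum over bit strings. In particular the state does not depend on `v`. -/
theorem bulkState_eq {p : Fin n → ℝ} (hp : FullRank p)
    (u v : Fin n → Matrix.unitaryGroup (Fin 2) ℂ) :
    bulkState p u v = (localUnitary u).1 * Matrix.diagonal (fun b => (bulkSpectrum p b : ℂ))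
      * (localUnitary u).1.conjTranspose := by
  ext x x'
  have hv : ∀ k i j, ∑ y, (v k).1 y i * star ((v k).1 y j) = if i = j then 1 else 0 :=
    fun k i j => by
      have := congrFun (congrFun (Matrix.mem_unitaryGroup_iff'.1 (v k).2) j) i
      simpa [Matrix.mul_apply, Matrix.one_apply, mul_comm, eq_comm] using this
  have hpair : ∀ k, ∑ y, (∑ i, ((Real.sqrt (weight (p k) i) : ℝ) : ℂ) * (u k).1 (x k) i
        * (v k).1 y i)
      * star (∑ i, ((Real.sqrt (weight (p k) i) : ℝ) : ℂ) * (u k).1 (x' k) i * (v k).1 y i)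
      = ∑ i, (weight (p k) i : ℂ) * ((u k).1 (x k) i * star ((u k).1 (x' k) i)) := fun k => by
    have hs : ∀ i, ((Real.sqrt (weight (p k) i) : ℝ) : ℂ) * ((Real.sqrt (weight (p k) i) : ℝ) : ℂ)
        = (weight (p k) i : ℂ) := fun i => by
      rw [← Complex.ofReal_mul, Real.mul_self_sqrt (weight_nonneg (hp k) i)]
    have hr : ∀ r : ℝ, star (r : ℂ) = r := fun r => Complex.conj_ofReal r
    calc _ = ∑ i, ∑ j, ((Real.sqrt (weight (p k) i) : ℝ) : ℂ)
          * ((Real.sqrt (weight (p k) j) : ℝ) : ℂ) * ((u k).1 (x k) i * star ((u k).1 (x' k) j))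
          * ∑ y, (v k).1 y i * star ((v k).1 y j) := by
          simp only [star_sum, star_mul', hr, Finset.sum_mul_sum]
          simp only [Finset.mul_sum]
          rw [Finset.sum_comm]
          refine Finset.sum_congr rfl fun i _ => ?_
          rw [Finset.sum_comm]
          refine Finset.sum_congr rfl fun j _ => Finset.sum_congr rfl fun y _ => ?_
          ring
      _ = _ := by
          simp only [hv, mul_ite, mul_one, mul_zero, Finset.sum_ite_eq, Finset.mem_univ, if_true,
            hs]
  simp only [bulkState, traceRight, pureState, bellPairs, Matrix.of_apply, Matrix.vecMulVec_apply,
    Pi.star_apply, star_prod, ← Finset.prod_mul_distrib]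
  rw [sum_qubits_prod fun k y => (∑ i, ((Real.sqrt (weight (p k) i) : ℝ) : ℂ) * (u k).1 (x k) i
        * (v k).1 y i)
      * star (∑ i, ((Real.sqrt (weight (p k) i) : ℝ) : ℂ) * (u k).1 (x' k) i * (v k).1 y i)]
  simp only [hpair]
  rw [← sum_qubits_prod fun k i =>
    (weight (p k) i : ℂ) * ((u k).1 (x k) i * star ((u k).1 (x' k) i)), Matrix.mul_apply]
  refine Finset.sum_congr rfl fun b _ => ?_
  rw [Matrix.mul_diagonal, Matrix.conjTranspose_apply]
  simp only [localUnitary, Matrix.of_apply, bulkSpectrum, star_prod, Complex.ofReal_prod,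
    ← Finset.prod_mul_distrib]
  exact Finset.prod_congr rfl fun k _ => by ring

theorem sum_bulkSpectrum_mul (p : Fin n → ℝ) (k : Fin n) (g : Fin 2 → ℝ) :
    ∑ b, bulkSpectrum p b * g (b k) = ∑ i, weight (p k) i * g i := by
  have h : ∀ b : Qubits n, bulkSpectrum p b * g (b k)
      = ∏ j, weight (p j) (b j) * (if j = k then g (b j) else 1) := fun b => by
    rw [Finset.prod_mul_distrib, Finset.prod_ite_eq' Finset.univ k fun j => g (b j)]
    simp [bulkSpectrum]
  simp only [h]
  rw [sum_qubits_prod fun j i => weight (p j) i * (if j = k then g i else 1),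
    Finset.prod_eq_single k]
  · simp
  · intro j _ hj
    simp only [if_neg hj, mul_one]
    exact sum_weight _
  · simp

/-- The logarithm of a product eigenvalue splits over the pairs, and each term only sees its own
marginal. -/
theorem entropy_bulkState {p : Fin n → ℝ} (hp : FullRank p)
    (u v : Fin n → Matrix.unitaryGroup (Fin 2) ℂ) :
    entropy (bulkState p u v) = ∑ k, Real.binEntropy (p k) := by
  rw [bulkState_eq hp, entropy_conj_diagonal (localUnitary u).2]
  have h : ∀ b, Real.negMulLog (bulkSpectrum p b)
      = ∑ k, bulkSpectrum p b * -Real.log (weight (p k) (b k)) := fun b => by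
    rw [← Finset.mul_sum, Finset.sum_neg_distrib, Real.negMulLog, bulkSpectrum,
      Real.log_prod fun k _ => (weight_pos (hp k) (b k)).ne']
    ring
  simp only [h]
  rw [Finset.sum_comm]
  refine Finset.sum_congr rfl fun k _ => ?_
  rw [sum_bulkSpectrum_mul p k fun i => -Real.log (weight (p k) i),
    Real.binEntropy_eq_negMulLog_add_negMulLog_one_sub]
  simp [Fin.sum_univ_two, weight, Real.negMulLog]
  ring

end BulkState

/-! ### Reduction of the correction to the eigenbasis of the bulk state -/

section Reduction

variable {A₁ A₂ B : Type*} [Fintype A₁] [Fintype A₂] [Fintype B]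
  [DecidableEq A₁] [DecidableEq A₂] [DecidableEq B]
  {χ : A₂ × B → ℂ} {V₀ : Matrix ((A₁ × A₂) × B) A₁ ℂ}
  {RA₀ RA : Matrix.unitaryGroup (A₁ × A₂) ℂ} {RB₀ RB : Matrix.unitaryGroup B ℂ}
  {W WR : Matrix ((A₁ × A₂) × B) ((A₁ × A₂) × B) ℂ} {ε : ℝ}

theorem recovery_mul_skew (hV₀ : IsExactCode V₀ χ RA₀ RB₀)
    (hR : IsRecoveredGenerator RA₀ RB₀ W ε RA RB WR) :
    (RA.1 ⊗ₖ RB.1) * skew V₀ W ε = expI ε WR * attach (A₁ := A₁) χ := by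
  have h : V₀ = (RA₀.1 ⊗ₖ RB₀.1).conjTranspose * attach (A₁ := A₁) χ := hV₀
  rw [skew, h, ← hR.2, Matrix.mul_assoc, Matrix.mul_assoc]

/-- The B part of the recovery disappears in the trace and the A part conjugates the reduced state.
Both entropies in the correction can thus be read off the same recovered state. -/
theorem entropy_traceRight_recovered (V : Matrix ((A₁ × A₂) × B) A₁ ℂ)
    (RA : Matrix.unitaryGroup (A₁ × A₂) ℂ) (RB : Matrix.unitaryGroup B ℂ)
    {σ : Matrix A₁ A₁ ℂ} (hσ : σ.IsHermitian) :
    entropy (traceRight (((RA.1 ⊗ₖ RB.1) * V) * σ * ((RA.1 ⊗ₖ RB.1) * V).conjTranspose))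
      = entropy (traceRight (V * σ * V.conjTranspose)) := by
  have h : ((RA.1 ⊗ₖ RB.1) * V) * σ * ((RA.1 ⊗ₖ RB.1) * V).conjTranspose
      = (RA.1 ⊗ₖ RB.1) * (V * σ * V.conjTranspose) * (RA.1 ⊗ₖ RB.1).conjTranspose := by
    rw [Matrix.conjTranspose_mul]
    simp only [Matrix.mul_assoc]
  rw [h, traceRight_conj _ RB.2, entropy_conj_unitary RA.2
    (isHermitian_traceRight (Matrix.isHermitian_mul_mul_conjTranspose V hσ))]

theorem isHermitian_rotate {σ : Matrix A₁ A₁ ℂ} (hσ : σ.IsHermitian)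
    (U : Matrix.unitaryGroup A₁ ℂ) : (rotate σ U).IsHermitian :=
  Matrix.isHermitian_mul_mul_conjTranspose U.1 hσ

omit [DecidableEq A₁] [DecidableEq A₂] in
theorem continuous_traceRight {X Y T : Type*} [Fintype X] [Fintype Y] [TopologicalSpace T]
    {A : T → Matrix (X × Y) (X × Y) ℂ} (hA : Continuous A) :
    Continuous fun t => traceRight (A t) :=
  continuous_matrix fun _ _ => continuous_finsetSum _ fun _ _ => hA.matrix_elem _ _

theorem continuous_correction (χ : A₂ × B → ℂ) (V : Matrix ((A₁ × A₂) × B) A₁ ℂ)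
    (RA : Matrix.unitaryGroup (A₁ × A₂) ℂ) (RB : Matrix.unitaryGroup B ℂ)
    {σ : Matrix A₁ A₁ ℂ} (hσ : σ.IsHermitian) :
    Continuous fun U => correction χ V RA RB (rotate σ U) := by
  have hc : Continuous fun U : Matrix.unitaryGroup A₁ ℂ => rotate σ U :=
    (continuous_subtype_val.matrix_mul continuous_const).matrix_mul
      continuous_subtype_val.matrix_conjTranspose
  have hcV : ∀ V : Matrix ((A₁ × A₂) × B) A₁ ℂ,
      Continuous fun U : Matrix.unitaryGroup A₁ ℂ => V * rotate σ U * V.conjTranspose := fun V =>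
    (continuous_const.matrix_mul hc).matrix_mul continuous_const
  have hh : ∀ (V : Matrix ((A₁ × A₂) × B) A₁ ℂ) (U : Matrix.unitaryGroup A₁ ℂ),
      (V * rotate σ U * V.conjTranspose).IsHermitian := fun V U =>
    Matrix.isHermitian_mul_mul_conjTranspose V (isHermitian_rotate hσ U)
  exact continuous_const.sub (Continuous.sub
    (continuous_entropy_comp (continuous_traceRight (hcV V))
      fun U => isHermitian_traceRight (hh V U))
    (continuous_entropy_comp (continuous_traceRight (continuous_traceRight (hcV _)))
      fun U => isHermitian_traceRight (isHermitian_traceRight (hh _ U))))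

/-- The bulk unitary passes through `attach` as U ⊗ 1 ⊗ 1 and then through the exponential, where it
conjugates the generator; what stays outside does not affect entropies. -/
theorem expI_attach_conj (χ : A₂ × B → ℂ) (WR : Matrix ((A₁ × A₂) × B) ((A₁ × A₂) × B) ℂ) (ε : ℝ)
    (lam : A₁ → ℝ) (U : Matrix.unitaryGroup A₁ ℂ) :
    traceRight ((expI ε WR * attach (A₁ := A₁) χ)
        * (U.1 * Matrix.diagonal (fun i => (lam i : ℂ)) * U.1.conjTranspose)
        * (expI ε WR * attach (A₁ := A₁) χ).conjTranspose)
      = (U.1 ⊗ₖ (1 : Matrix A₂ A₂ ℂ)) * evolved χ lam ε (corotate WR (bulkUnitary A₂ B U).1)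
        * (U.1 ⊗ₖ (1 : Matrix A₂ A₂ ℂ)).conjTranspose := by
  rw [evolved, ← traceRight_conj _ (one_mem (Matrix.unitaryGroup B ℂ))]
  congr 1
  set G : Matrix.unitaryGroup ((A₁ × A₂) × B) ℂ := bulkUnitary A₂ B U with hG
  have hGv : (U.1 ⊗ₖ (1 : Matrix A₂ A₂ ℂ)) ⊗ₖ (1 : Matrix B B ℂ) = G.1 := rfl
  have hE : expI ε WR * G.1 = G.1 * expI ε (corotate WR G.1) := by
    rw [corotate, expI_conj, ← mul_assoc, ← mul_assoc, ← Matrix.star_eq_conjTranspose,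
      Matrix.mem_unitaryGroup_iff.1 G.2, one_mul]
  have hQ : attach (A₁ := A₁) χ * U.1 = G.1 * attach (A₁ := A₁) χ :=
    (kronecker_mul_attach χ U.1).symm
  rw [hGv]
  calc _ = (expI ε WR * (attach (A₁ := A₁) χ * U.1)) * Matrix.diagonal (fun i => (lam i : ℂ))
        * (expI ε WR * (attach (A₁ := A₁) χ * U.1)).conjTranspose := by
        simp only [Matrix.conjTranspose_mul, Matrix.mul_assoc]
    _ = (expI ε WR * G.1) * productState χ lam * (expI ε WR * G.1).conjTranspose := by
        rw [hQ, productState]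
        simp only [Matrix.conjTranspose_mul, Matrix.mul_assoc]
    _ = _ := by
        rw [hE]
        simp only [Matrix.conjTranspose_mul, Matrix.mul_assoc]

theorem correction_eq [Nonempty A₂] (hχ : IsFlat χ) (hV₀ : IsExactCode V₀ χ RA₀ RB₀)
    (hR : IsRecoveredGenerator RA₀ RB₀ W ε RA RB WR) (lam : A₁ → ℝ)
    (U₀ U : Matrix.unitaryGroup A₁ ℂ) :
    correction χ (skew V₀ W ε) RA RB
        (rotate (U₀.1 * Matrix.diagonal (fun i => (lam i : ℂ)) * U₀.1.conjTranspose) U)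
      = Real.log (Fintype.card A₂)
        - entropy (evolved χ lam ε (corotate WR (bulkUnitary A₂ B (U * U₀)).1))
        + entropy (traceRight (evolved χ lam ε (corotate WR (bulkUnitary A₂ B (U * U₀)).1))) := by
  have hσ : (U₀.1 * Matrix.diagonal (fun i => (lam i : ℂ)) * U₀.1.conjTranspose).IsHermitian :=
    isHermitian_conj_diagonal U₀.1 lam
  have hrot : rotate (U₀.1 * Matrix.diagonal (fun i => (lam i : ℂ)) * U₀.1.conjTranspose) U
      = (U * U₀).1 * Matrix.diagonal (fun i => (lam i : ℂ)) * (U * U₀).1.conjTranspose := by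
    simp only [rotate, Submonoid.coe_mul, Matrix.conjTranspose_mul, mul_assoc]
  have hev := isHermitian_evolved χ lam ε (corotate WR (bulkUnitary A₂ B (U * U₀)).1)
  rw [correction, entropy_flat hχ, protoArea,
    ← entropy_traceRight_recovered _ RA RB (isHermitian_rotate hσ U), recoveredBulk,
    recovery_mul_skew hV₀ hR, hrot, expI_attach_conj,
    traceRight_conj _ (one_mem (Matrix.unitaryGroup A₂ ℂ)),
    entropy_conj_unitary (U * U₀).2 (isHermitian_traceRight hev),
    entropy_conj_unitary (kronecker_mem_unitaryGroup (U * U₀).2 (one_mem _)) hev]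
  ring

theorem isHermitian_corotate {X : Type*} [Fintype X] {M : Matrix X X ℂ} (hM : M.IsHermitian)
    (U : Matrix X X ℂ) : (corotate M U).IsHermitian :=
  Matrix.isHermitian_conjTranspose_mul_mul U hM

/-- Keeps the bound K valid for every rotated generator, so that the pointwise error estimate is
uniform in U and can be integrated. -/
theorem trace_corotate_sq {X : Type*} [Fintype X] [DecidableEq X] (M : Matrix X X ℂ)
    (U : Matrix.unitaryGroup X ℂ) :
    ((corotate M U.1).conjTranspose * corotate M U.1).trace = (M.conjTranspose * M).trace := by
  have h : (corotate M U.1).conjTranspose = corotate M.conjTranspose U.1 := by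
    simp only [corotate, Matrix.conjTranspose_mul, Matrix.conjTranspose_conjTranspose, mul_assoc]
  rw [h, corotate_mul_corotate, trace_corotate]

/-- The averaged correction to second order, uniformly for bounded recovered generators. -/
theorem exists_averagedCorrection_expansion [Nonempty A₂] (hd : 2 ≤ Fintype.card A₁)
    (hχ : IsFlat χ) (hV₀ : IsExactCode V₀ χ RA₀ RB₀) {lam : A₁ → ℝ} (hlam : ∀ i, 0 < lam i)
    (hsum : ∑ i, lam i = 1) (U₀ : Matrix.unitaryGroup A₁ ℂ) (K : ℝ) :
    ∃ C > 0, ∃ ε₀ > 0, ∀ ε : ℝ, |ε| < ε₀ →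
      ∀ (W WR : Matrix ((A₁ × A₂) × B) ((A₁ × A₂) × B) ℂ)
        (RA : Matrix.unitaryGroup (A₁ × A₂) ℂ) (RB : Matrix.unitaryGroup B ℂ),
        IsRecoveredGenerator RA₀ RB₀ W ε RA RB WR → (WR.conjTranspose * WR).trace.re ≤ K ^ 2 →
        |averagedCorrection χ (skew V₀ W ε) RA RB
            (U₀.1 * Matrix.diagonal (fun i => (lam i : ℂ)) * U₀.1.conjTranspose)
          - ε ^ 2 / 2 * (coeff₁ χ WR * f₁ lam + coeff₂ χ WR * f₂ lam + coeff₃ χ WR)|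
        ≤ C * |ε| ^ 3 := by
  obtain ⟨C, hC, ε₀, hε₀, h⟩ := exists_correction_expansion hχ hlam hsum K
  refine ⟨C, hC, ε₀, hε₀, fun ε hε W WR RA RB hR hK => ?_⟩
  have hσ : (U₀.1 * Matrix.diagonal (fun i => (lam i : ℂ)) * U₀.1.conjTranspose).IsHermitian :=
    isHermitian_conj_diagonal U₀.1 lam
  have hint := integrable_of_continuous (continuous_correction χ (skew V₀ W ε) RA RB hσ)
  have hq := continuous_quadCoeff_corotate χ WR lam
  have hq' : Continuous fun U : Matrix.unitaryGroup A₁ ℂ =>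
      quadCoeff χ lam (corotate WR (bulkUnitary A₂ B (U * U₀)).1) :=
    hq.comp (continuous_mul_const U₀)
  -- The eigenbasis U₀ of the bulk state is absorbed by right invariance of the Haar measure.
  have havg : ∫ U : Matrix.unitaryGroup A₁ ℂ,
      quadCoeff χ lam (corotate WR (bulkUnitary A₂ B (U * U₀)).1) ∂(haarUnitary A₁)
      = coeff₁ χ WR * f₁ lam + coeff₂ χ WR * f₂ lam + coeff₃ χ WR := by
    rw [← integral_quadCoeff χ hd hR.1 hlam hsum]
    exact integral_mul_right_eq_self (fun U : Matrix.unitaryGroup A₁ ℂ =>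
      quadCoeff χ lam (corotate WR (bulkUnitary A₂ B U).1)) U₀
  rw [← havg, averagedCorrection, ← integral_const_mul,
    ← integral_sub hint ((integrable_of_continuous hq').const_mul _), ← Real.norm_eq_abs]
  refine (norm_integral_le_of_norm_le_const (C := C * |ε| ^ 3)
    (Eventually.of_forall fun U => ?_)).trans (by simp)
  rw [correction_eq hχ hV₀ hR, Real.norm_eq_abs]
  exact h ε hε _ (isHermitian_corotate hR.1 _) (by rw [trace_corotate_sq]; exact hK)

end Reduction

/-! ### Sign and monotonicity of the leading coefficient -/

section Leading

variable {n : ℕ} {A₂ B : Type*} [Fintype A₂] [DecidableEq A₂] [Nonempty A₂] [Fintype B]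
  [DecidableEq B] (χ : A₂ × B → ℂ)
  {WR : Matrix ((Qubits n × A₂) × B) ((Qubits n × A₂) × B) ℂ}

theorem two_le_card_qubits (hn : 1 ≤ n) : 2 ≤ Fintype.card (Qubits n) := by
  rw [Fintype.card_fun, Fintype.card_fin, Fintype.card_fin]
  exact Nat.le_self_pow (by omega) 2

theorem leading_nonneg (hn : 1 ≤ n) (hW : WR.IsHermitian) {p : Fin n → ℝ} (hp : FullRank p) :
    0 ≤ leading χ WR p :=
  have hd := two_le_card_qubits hn
  add_nonneg (add_nonneg (mul_nonneg (coeff₁_nonneg χ hd hW) (f₁_nonneg hp))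
    (mul_nonneg (coeff₂_nonneg χ hd hW) (f₂_nonneg hp))) (coeff₃_nonneg χ hd hW)

theorem leading_decreases (hn : 1 ≤ n) (hW : WR.IsHermitian) :
    DecreasesWithEntropy (leading χ WR) := fun p q hp hq h =>
  have hd := two_le_card_qubits hn
  add_le_add (add_le_add
    (mul_le_mul_of_nonneg_left (f₁_decreases p q hp hq h) (coeff₁_nonneg χ hd hW))
    (mul_le_mul_of_nonneg_left (f₂_decreases p q hp hq h) (coeff₂_nonneg χ hd hW))) le_rfl

theorem leading_strictly_decreases (hn : 1 ≤ n) (hW : WR.IsHermitian)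
    (hc : 0 < coeff₁ χ WR ∨ 0 < coeff₂ χ WR) :
    StrictlyDecreasesWithEntropy (leading χ WR) := fun p q hp hq h hk => by
  have hd := two_le_card_qubits hn
  refine add_lt_add_of_lt_of_le ?_ le_rfl
  rcases hc with hc | hc
  · exact add_lt_add_of_lt_of_le
      (mul_lt_mul_of_pos_left (f₁_strictly_decreases p q hp hq h hk) hc)
      (mul_le_mul_of_nonneg_left (f₂_decreases p q hp hq h) (coeff₂_nonneg χ hd hW))
  · exact add_lt_add_of_le_of_lt
      (mul_le_mul_of_nonneg_left (f₁_decreases p q hp hq h) (coeff₁_nonneg χ hd hW))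
      (mul_lt_mul_of_pos_left (f₂_strictly_decreases p q hp hq h hk) hc)

theorem entropy_bulkState_const {s : ℝ} (hs : FullRank fun _ : Fin n => s)
    (u v : Fin n → Matrix.unitaryGroup (Fin 2) ℂ) :
    entropy (bulkState (fun _ => s) u v) = n * Real.binEntropy s := by
  rw [entropy_bulkState hs, Finset.sum_const, Finset.card_univ, Fintype.card_fin, nsmul_eq_mul]

end Leading

end SkewedCode

/-! ### Assembly of the theorem -/

theorem mainTheorem5 {n : ℕ} (hn : 1 ≤ n) {A₂ B : Type*}
    [Fintype A₂] [DecidableEq A₂] [Nonempty A₂] [Fintype B] [DecidableEq B]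
    (χ : A₂ × B → ℂ) (hχ : IsFlat χ)
    (V₀ : Matrix ((Qubits n × A₂) × B) (Qubits n) ℂ)
    (RA₀ : Matrix.unitaryGroup (Qubits n × A₂) ℂ) (RB₀ : Matrix.unitaryGroup B ℂ)
    (hV₀ : IsExactCode V₀ χ RA₀ RB₀) :
    -- the averaged correction to second order, uniformly over recoveries and skewings
    (∀ (p : Fin n → ℝ), FullRank p → ∀ (u v : Fin n → Matrix.unitaryGroup (Fin 2) ℂ) (K : ℝ),
      ∃ C > 0, ∃ ε₀ > 0, ∀ ε : ℝ, |ε| < ε₀ →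
        ∀ (W WR : Matrix ((Qubits n × A₂) × B) ((Qubits n × A₂) × B) ℂ)
          (RA : Matrix.unitaryGroup (Qubits n × A₂) ℂ) (RB : Matrix.unitaryGroup B ℂ),
          W.IsHermitian → IsRecoveredGenerator RA₀ RB₀ W ε RA RB WR →
          (WR.conjTranspose * WR).trace.re ≤ K ^ 2 →
          Integrable (fun U => correction χ (skew V₀ W ε) RA RB (rotate (bulkState p u v) U))
            (haarUnitary (Qubits n)) ∧
          |averagedCorrection χ (skew V₀ W ε) RA RB (bulkState p u v)
            - ε ^ 2 / 2 * (coeff₁ χ WR * f₁ (bulkSpectrum p)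
                + coeff₂ χ WR * f₂ (bulkSpectrum p) + coeff₃ χ WR)| ≤ C * |ε| ^ 3) ∧
    -- in particular for the proto-area entropy proper, defined by optimal recoveries
    (∀ W : Matrix ((Qubits n × A₂) × B) ((Qubits n × A₂) × B) ℂ, W.IsHermitian →
      ∀ (RA : ℝ → Matrix.unitaryGroup (Qubits n × A₂) ℂ) (RB : ℝ → Matrix.unitaryGroup B ℂ)
        (WR : ℝ → Matrix ((Qubits n × A₂) × B) ((Qubits n × A₂) × B) ℂ) (K : ℝ),
        (∀ᶠ ε in 𝓝[≠] (0 : ℝ), IsOptimalRecovery (skew V₀ W ε) (RA ε) (RB ε) ∧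
          IsRecoveredGenerator RA₀ RB₀ W ε (RA ε) (RB ε) (WR ε) ∧
          ((WR ε).conjTranspose * WR ε).trace.re ≤ K ^ 2) →
        ∀ (p : Fin n → ℝ), FullRank p → ∀ (u v : Fin n → Matrix.unitaryGroup (Fin 2) ℂ),
          (fun ε : ℝ => averagedCorrection χ (skew V₀ W ε) (RA ε) (RB ε) (bulkState p u v)
            - ε ^ 2 / 2 * leading χ (WR ε) p) =O[𝓝[≠] (0 : ℝ)] fun ε => ε ^ 3) ∧
    -- the functions of the bulk spectrum
    (∀ p : Fin n → ℝ, FullRank p → 0 ≤ f₁ (bulkSpectrum p) ∧ 0 ≤ f₂ (bulkSpectrum p)) ∧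
    DecreasesWithEntropy (fun p : Fin n → ℝ => f₁ (bulkSpectrum p)) ∧
    StrictlyDecreasesWithEntropy (fun p : Fin n → ℝ => f₁ (bulkSpectrum p)) ∧
    DecreasesWithEntropy (fun p : Fin n → ℝ => f₂ (bulkSpectrum p)) ∧
    StrictlyDecreasesWithEntropy (fun p : Fin n → ℝ => f₂ (bulkSpectrum p)) ∧
    -- the coefficients, and sign and monotonicity of the leading term
    (∀ WR : Matrix ((Qubits n × A₂) × B) ((Qubits n × A₂) × B) ℂ, WR.IsHermitian →
      0 ≤ coeff₁ χ WR ∧ 0 ≤ coeff₂ χ WR ∧ 0 ≤ coeff₃ χ WR ∧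
      (∀ p : Fin n → ℝ, FullRank p → 0 ≤ leading χ WR p) ∧
      DecreasesWithEntropy (leading χ WR) ∧
      (0 < coeff₁ χ WR ∨ 0 < coeff₂ χ WR → StrictlyDecreasesWithEntropy (leading χ WR)) ∧
      -- identical pairs: monotonicity in the total bulk entropy
      (∀ s t : ℝ, FullRank (fun _ : Fin n => s) → FullRank (fun _ : Fin n => t) →
        ∀ u v u' v' : Fin n → Matrix.unitaryGroup (Fin 2) ℂ,
        (entropy (bulkState (fun _ => s) u v) ≤ entropy (bulkState (fun _ => t) u' v') →
          leading χ WR (fun _ => t) ≤ leading χ WR (fun _ => s)) ∧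
        (0 < coeff₁ χ WR ∨ 0 < coeff₂ χ WR →
          entropy (bulkState (fun _ => s) u v) < entropy (bulkState (fun _ => t) u' v') →
          leading χ WR (fun _ => t) < leading χ WR (fun _ => s)))) := by
  have hd := two_le_card_qubits hn
  have hn0 : (0 : ℝ) < n := by exact_mod_cast hn
  have main : ∀ (p : Fin n → ℝ), FullRank p →
      ∀ (u v : Fin n → Matrix.unitaryGroup (Fin 2) ℂ) (K : ℝ),
      ∃ C > 0, ∃ ε₀ > 0, ∀ ε : ℝ, |ε| < ε₀ →
        ∀ (W WR : Matrix ((Qubits n × A₂) × B) ((Qubits n × A₂) × B) ℂ)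
          (RA : Matrix.unitaryGroup (Qubits n × A₂) ℂ) (RB : Matrix.unitaryGroup B ℂ),
          IsRecoveredGenerator RA₀ RB₀ W ε RA RB WR →
          (WR.conjTranspose * WR).trace.re ≤ K ^ 2 →
          |averagedCorrection χ (skew V₀ W ε) RA RB (bulkState p u v)
            - ε ^ 2 / 2 * (coeff₁ χ WR * f₁ (bulkSpectrum p)
                + coeff₂ χ WR * f₂ (bulkSpectrum p) + coeff₃ χ WR)| ≤ C * |ε| ^ 3 :=
    fun p hp u v K => by
      rw [bulkState_eq hp]
      exact exists_averagedCorrection_expansion hd hχ hV₀ (bulkSpectrum_pos hp)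
        (sum_bulkSpectrum p) (localUnitary u) K
  refine ⟨fun p hp u v K => ?_, fun W _ RA RB WR K hR p hp u v => ?_,
    fun p hp => ⟨f₁_nonneg hp, f₂_nonneg hp⟩, f₁_decreases, f₁_strictly_decreases,
    f₂_decreases, f₂_strictly_decreases, fun WR hW => ⟨coeff₁_nonneg χ hd hW,
      coeff₂_nonneg χ hd hW, coeff₃_nonneg χ hd hW, fun p hp => leading_nonneg χ hn hW hp,
      leading_decreases χ hn hW, leading_strictly_decreases χ hn hW,
      fun s t hs ht u v u' v' => ?_⟩⟩
  · obtain ⟨C, hC, ε₀, hε₀, h⟩ := main p hp u v K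
    refine ⟨C, hC, ε₀, hε₀, fun ε hε W WR RA RB _ hR hK => ⟨?_, h ε hε W WR RA RB hR hK⟩⟩
    -- Integrability is recorded because the integral of a non-integrable function would be zero by
    -- convention.
    refine integrable_of_continuous (continuous_correction χ _ RA RB ?_)
    rw [bulkState_eq hp]
    exact isHermitian_conj_diagonal _ _
  · obtain ⟨C, -, ε₀, hε₀, h⟩ := main p hp u v K
    -- The generator varies with ε, so a bound for each fixed generator would not do; the constant
    -- that is uniform for norm at most |K| applies along the whole family.
    refine Asymptotics.IsBigO.of_bound C ?_
    have hsmall : ∀ᶠ ε in 𝓝[≠] (0 : ℝ), |ε| < ε₀ := by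
      filter_upwards [nhdsWithin_le_nhds (Metric.ball_mem_nhds (0 : ℝ) hε₀)] with ε hε
      simpa using hε
    filter_upwards [hR, hsmall] with ε hRε hε
    rw [Real.norm_eq_abs, Real.norm_eq_abs, abs_pow]
    exact h ε hε W (WR ε) (RA ε) (RB ε) hRε.2.1 hRε.2.2
  -- For identical pairs the total entropy is n times the binary entropy, so comparing totals
  -- compares every pair; n ≥ 1 provides the index at which the comparison is strict.
  · rw [entropy_bulkState_const hs, entropy_bulkState_const ht]
    exact ⟨fun h => leading_decreases χ hn hW _ _ hs ht
        fun _ => le_of_mul_le_mul_left h hn0,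
      fun hc h => leading_strictly_decreases χ hn hW hc _ _ hs ht
        (fun _ => le_of_mul_le_mul_left h.le hn0)
        ⟨⟨0, hn⟩, lt_of_mul_lt_mul_left h hn0.le⟩⟩
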